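/- Let $k$ be a field, and let $A$ be a unital ($\mathbb Z$-graded) dg $k$-algebra which is \emph{smooth}, i.e. the diagonal bimodule $A$ lies in $\mathrm{Perf}(A^{\mathrm{op}}\otimes_k A)$, and \emph{compact}, i.e. $\dim_k\bigoplus_i H^i(A)<\infty$. Here, for a dg algebra $B$, $\mathrm{Perf}(B)$ is the full thick triangulated subcategory of the derived category $D(B)$ of right dg $B$-modules generated by $B$. For an object $E$ of a triangulated category let $[E]_0$ be the class of objects isomorphic to finite direct sums of shifts of $E$, let $[E]_n=[E]_0\star\dots\star[E]_0$ ($n+1$ factors), where $X\star Y$ denotes the class of all objects $F$ that fit into a distinguished triangle $X'\to F\to Y'\to X'[1]$ with $X'\in X$, $Y'\in Y$, and let $\langle E\rangle_n$ be the class of direct summands of objects of $[E]_n$. The \emph{diagonal dimension} $\mathrm{Ddim}\,\mathrm{Perf}(A)\in\mathbb Z_{\ge 0}\cup\{\infty\}$ is the least $n$ for which there are $F\in\mathrm{Perf}(A^{\mathrm{op}})$ and $G\in\mathrm{Perf}(A)$ such that the diagonal bimodule $A$ lies in $\langle F\boxtimes G\rangle_n\subset\mathrm{Perf}(A^{\mathrm{op}}\otimes_k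 A)$, where $F\boxtimes G=F\otimes_k G$ (and $\infty$ if there is no such $n$). Dg algebras $A$ and $B$ are \emph{Morita equivalent} if there is $K\in D(A^{\mathrm{op}}\otimes_k B)$ such that the functor $-\otimes^{\mathbf L}_A K\colon D(A)\to D(B)$ is an equivalence. \textbf{Proposition.} If $\mathrm{Ddim}\,\mathrm{Perf}(A)=0$, then there are an integer $s\ge 0$ and (not necessarily commutative) division $k$-algebras $D_1,\dots,D_s$, finite-dimensional over $k$, such that $A$ is Morita equivalent to the product $D_1\times\dots\times D_s$, regarded as a dg algebra concentrated in degree $0$. (The empty product, $s=0$, is the zero algebra; it is needed when $A$ is acyclic.) -/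

import Mathlib

universe u

open scoped TensorProduct DirectSum
open CategoryTheory

noncomputable section

namespace DGDim

/-! ### Internal `ℤ`-gradings of vector spaces -/

section Grading

variable {k V W X : Type*} [Field k] [AddCommGroup V] [Module k V] [AddCommGroup W] [Module k W]
  [AddCommGroup X] [Module k X] {G : ℤ → Submodule k V} {H : ℤ → Submodule k W}

theorem graded_induction (h : DirectSum.IsInternal G) {p : V → Prop}
    (hom : ∀ i, ∀ x ∈ G i, p x) (add : ∀ x y, p x → p y → p (x + y)) (x : V) : p x := by
  have hx : x ∈ ⨆ i, G i := by rw [h.submodule_iSup_eq_top]; trivial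
  exact Submodule.iSup_induction G (motive := p) hx hom (hom 0 0 (zero_mem _)) add

/-- The isomorphism from the external direct sum of the homogeneous components. -/
def sumEquiv (h : DirectSum.IsInternal G) : (⨁ i, G i) ≃ₗ[k] V :=
  LinearEquiv.ofBijective (DirectSum.coeLinearMap G) h

/-- The linear map that multiplies the homogeneous elements of degree `i` by the sign `σ i`. -/
def twist (h : DirectSum.IsInternal G) (σ : ℤ → ℤˣ) : V →ₗ[k] V :=
  (DirectSum.toModule k ℤ V fun i => σ i • (G i).subtype) ∘ₗ
    (sumEquiv h).symm.toLinearMap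

theorem symm_of_mem (h : DirectSum.IsInternal G) {i : ℤ} {x : V} (hx : x ∈ G i) :
    (sumEquiv h).symm x =
      DirectSum.lof k ℤ (fun i => G i) i ⟨x, hx⟩ := by
  rw [LinearEquiv.symm_apply_eq]
  exact (DirectSum.coeLinearMap_lof G i ⟨x, hx⟩).symm

theorem twist_of_mem (h : DirectSum.IsInternal G) (σ : ℤ → ℤˣ) {i : ℤ} {x : V} (hx : x ∈ G i) :
    twist h σ x = σ i • x := by
  simp [twist, symm_of_mem h hx, DirectSum.toModule_lof]

/-- The map that lists the homogeneous components of a vector. -/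
def components (h : DirectSum.IsInternal G) : V →ₗ[k] (ℤ →₀ V) :=
  (DirectSum.toModule k ℤ (ℤ →₀ V) fun i => Finsupp.lsingle i ∘ₗ (G i).subtype) ∘ₗ
    (sumEquiv h).symm.toLinearMap

theorem components_of_mem (h : DirectSum.IsInternal G) {i : ℤ} {x : V} (hx : x ∈ G i) :
    components h x = Finsupp.single i x := by
  simp [components, symm_of_mem h hx, DirectSum.toModule_lof]

theorem isInternal_of_components (c : V →ₗ[k] (ℤ →₀ V))
    (hc : ∀ i, ∀ x ∈ G i, c x = Finsupp.single i x) (hG : ⨆ i, G i = ⊤) :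
    DirectSum.IsInternal G := by
  have key : ∀ z : ⨁ i, G i, ∀ j, c (DirectSum.coeLinearMap G z) j = (z j : V) := by
    intro z j
    induction z using DirectSum.induction_on with
    | zero => simp
    | of i x =>
      have : DirectSum.coeLinearMap G (DirectSum.of (fun i => G i) i x) = x :=
        DirectSum.coeLinearMap_lof G i x
      rw [this, hc i x x.2]
      by_cases hij : i = j
      · subst hij; simp
      · rw [Finsupp.single_eq_of_ne (Ne.symm hij), DirectSum.of_eq_of_ne _ _ _ (Ne.symm hij)]
        rfl
    | add x y hx hy => simp [hx, hy]
  refine ⟨?_, ?_⟩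
  · change Function.Injective (DirectSum.coeLinearMap G)
    rw [injective_iff_map_eq_zero]
    intro z hz
    ext j
    rw [← key, hz]; simp
  · change Function.Surjective (DirectSum.coeLinearMap G)
    rw [← LinearMap.range_eq_top, DirectSum.range_coeLinearMap, hG]

theorem isInternal_shift (h : DirectSum.IsInternal G) (n : ℤ) :
    DirectSum.IsInternal fun i => G (i + n) := by
  refine isInternal_of_components (Finsupp.lmapDomain V k (fun j => j - n) ∘ₗ components h) ?_ ?_
  · intro i x hx
    simp [components_of_mem h hx]
  · rw [← h.submodule_iSup_eq_top]
    exact (Equiv.addRight n).iSup_comp (g := G)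

theorem isInternal_prod (hG : DirectSum.IsInternal G) (hH : DirectSum.IsInternal H) :
    DirectSum.IsInternal fun i => (G i).prod (H i) := by
  refine isInternal_of_components
    (Finsupp.mapRange.linearMap (LinearMap.inl k V W) ∘ₗ components hG ∘ₗ LinearMap.fst k V W +
     Finsupp.mapRange.linearMap (LinearMap.inr k V W) ∘ₗ components hH ∘ₗ LinearMap.snd k V W) ?_ ?_
  · rintro i ⟨x, y⟩ ⟨hx, hy⟩
    simp only [LinearMap.add_apply, LinearMap.comp_apply, LinearMap.fst_apply, LinearMap.snd_apply,
      components_of_mem hG hx, components_of_mem hH hy, Finsupp.mapRange.linearMap_apply,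
      Finsupp.mapRange_single, LinearMap.inl_apply, LinearMap.inr_apply, ← Finsupp.single_add]
    simp
  · rw [eq_top_iff]
    rintro ⟨x, y⟩ -
    have h1 : ((x, 0) : V × W) ∈ ⨆ i, (G i).prod (H i) := by
      refine graded_induction hG (p := fun x => ((x, 0) : V × W) ∈ ⨆ i, (G i).prod (H i))
        (fun i x hx => Submodule.mem_iSup_of_mem i ⟨hx, zero_mem _⟩) (fun a b ha hb => ?_) x
      simpa using add_mem ha hb
    have h2 : ((0, y) : V × W) ∈ ⨆ i, (G i).prod (H i) := by
      refine graded_induction hH (p := fun y => ((0, y) : V × W) ∈ ⨆ i, (G i).prod (H i))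
        (fun i x hx => Submodule.mem_iSup_of_mem i ⟨zero_mem _, hx⟩) (fun a b ha hb => ?_) y
      simpa using add_mem ha hb
    simpa using add_mem h1 h2

theorem isInternal_zero_degree :
    DirectSum.IsInternal fun i : ℤ => if i = 0 then (⊤ : Submodule k V) else ⊥ := by
  refine isInternal_of_components (Finsupp.lsingle 0) ?_ ?_
  · intro i x hx
    split_ifs at hx with hi
    · subst hi; rfl
    · rw [Submodule.mem_bot] at hx; subst hx; simp
  · exact eq_top_iff.2 ((le_of_eq (by simp)).trans
      (le_iSup (fun i : ℤ => if i = 0 then (⊤ : Submodule k V) else ⊥) 0))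

/-- The degree `n` part of `V ⊗ W`, spanned by `v ⊗ w` with `deg v + deg w = n`. -/
def tensorGrading (G : ℤ → Submodule k V) (H : ℤ → Submodule k W) (n : ℤ) :
    Submodule k (V ⊗[k] W) :=
  Submodule.span k {t | ∃ i j, i + j = n ∧ ∃ v ∈ G i, ∃ w ∈ H j, t = v ⊗ₜ[k] w}

/-- The images in the quotient `V ⊗ W → X` of the degree `n` parts of `V ⊗ W` grade `X` if the
kernel of the quotient map contains the homogeneous components of its elements. -/
theorem isInternal_tensor_quotient (hG : DirectSum.IsInternal G) (hH : DirectSum.IsInternal H)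
    (R : Submodule k (V ⊗[k] W))
    (hR : ∀ t ∈ R, Finsupp.mapRange.linearMap R.mkQ
      ((Finsupp.lmapDomain (V ⊗[k] W) k (fun p : ℤ × ℤ => p.1 + p.2) ∘ₗ
        (finsuppTensorFinsupp k k V W ℤ ℤ).toLinearMap ∘ₗ
          TensorProduct.map (components hG) (components hH)) t) = 0) :
    DirectSum.IsInternal fun n => (tensorGrading G H n).map R.mkQ := by
  refine isInternal_of_components (R.liftQ (Finsupp.mapRange.linearMap R.mkQ ∘ₗ
    (Finsupp.lmapDomain (V ⊗[k] W) k (fun p : ℤ × ℤ => p.1 + p.2) ∘ₗ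
        (finsuppTensorFinsupp k k V W ℤ ℤ).toLinearMap ∘ₗ
          TensorProduct.map (components hG) (components hH))) (fun t ht => hR t ht)) ?_ ?_
  · rintro n _ ⟨t, ht, rfl⟩
    change Finsupp.mapRange.linearMap R.mkQ _ = _
    induction ht using Submodule.span_induction with
    | mem t h =>
      obtain ⟨i, j, rfl, v, hv, w, hw, rfl⟩ := h
      simp [components_of_mem hG hv, components_of_mem hH hw, finsuppTensorFinsupp_single]
    | zero => simp
    | add x y _ _ hx hy => simp only [map_add, hx, hy, Finsupp.single_add]
    | smul a x _ hx => simp only [map_smul, hx, Finsupp.smul_single]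
  · rw [← Submodule.map_iSup]
    have : ⨆ n, tensorGrading G H n = ⊤ := by
      rw [eq_top_iff, ← TensorProduct.span_tmul_eq_top, Submodule.span_le]
      rintro _ ⟨v, w, rfl⟩
      change v ⊗ₜ[k] w ∈ ⨆ n, tensorGrading G H n
      refine graded_induction hG (p := fun v => v ⊗ₜ[k] w ∈ ⨆ n, tensorGrading G H n) ?_ ?_ v
      · intro i x hx
        refine graded_induction hH (p := fun w => x ⊗ₜ[k] w ∈ ⨆ n, tensorGrading G H n) ?_ ?_ w
        · intro j y hy
          exact Submodule.mem_iSup_of_mem (i + j)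
            (Submodule.subset_span ⟨i, j, rfl, x, hx, y, hy, rfl⟩)
        · intro a b ha hb
          rw [TensorProduct.tmul_add]; exact add_mem ha hb
      · intro a b ha hb
        rw [TensorProduct.add_tmul]; exact add_mem ha hb
    rw [this, Submodule.map_top, Submodule.range_mkQ]

end Grading

/-- The cohomology `ker d / im d` of a linear map `d`; for a differential on a graded space this
is the direct sum of the cohomologies in all degrees. -/
abbrev Cohomology {k V : Type*} [Field k] [AddCommGroup V] [Module k V] (d : V →ₗ[k] V) : Type _ :=
  LinearMap.ker d ⧸ (LinearMap.range d).submoduleOf (LinearMap.ker d)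

/-- The map induced on cohomology by a linear map that commutes with the differentials. -/
def cohomologyMap {k V W : Type*} [Field k] [AddCommGroup V] [Module k V] [AddCommGroup W]
    [Module k W] {d : V →ₗ[k] V} {e : W →ₗ[k] W} (f : V →ₗ[k] W) (hf : ∀ x, f (d x) = e (f x)) :
    Cohomology d →ₗ[k] Cohomology e :=
  Submodule.mapQ _ _
    (f.restrict (p := LinearMap.ker d) (q := LinearMap.ker e)
      (fun x hx => by rw [LinearMap.mem_ker] at hx ⊢; rw [← hf, hx, map_zero]))
    (by
      rintro ⟨_, hx⟩ ⟨y, rfl⟩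
      exact ⟨f y, (hf y).symm⟩)

/-! ### Dg algebras and dg bimodules -/

/-- A (cohomologically `ℤ`-graded, associative, unital) dg algebra over the field `k`. -/
structure DGAlgebra (k : Type u) [Field k] where
  carrier : Type u
  [ring : Ring carrier]
  [algebra : Algebra k carrier]
  /-- the homogeneous components -/
  deg : ℤ → Submodule k carrier
  isInternal : DirectSum.IsInternal deg
  one_mem : (1 : carrier) ∈ deg 0
  mul_mem : ∀ {i j : ℤ} {a b : carrier}, a ∈ deg i → b ∈ deg j → a * b ∈ deg (i + j)
  /-- the differential -/
  d : carrier →ₗ[k] carrier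
  d_mem : ∀ {i : ℤ} {a : carrier}, a ∈ deg i → d a ∈ deg (i + 1)
  d_d : ∀ a, d (d a) = 0
  d_mul : ∀ {i : ℤ} {a : carrier} (b : carrier), a ∈ deg i →
    d (a * b) = d a * b + i.negOnePow • (a * d b)

attribute [instance] DGAlgebra.ring DGAlgebra.algebra

variable {k : Type u} [Field k]

instance : CoeSort (DGAlgebra k) (Type u) := ⟨DGAlgebra.carrier⟩

/-- A dg `A`-`B`-bimodule: a complex of `k`-vector spaces with commuting left action of `A` and
right action of `B`, subject to the Leibniz rules. It is the same thing as a right dg module over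
`Aᵒᵖ ⊗ B`, where `m · (a ⊗ b) = (-1)^{|a||m|} a m b`. -/
structure DGBimod (A B : DGAlgebra k) where
  carrier : Type u
  [addCommGroup : AddCommGroup carrier]
  [module : Module k carrier]
  /-- `left a m` is `a m` -/
  left : A →ₐ[k] Module.End k carrier
  /-- `right (op b) m` is `m b` -/
  right : Bᵐᵒᵖ →ₐ[k] Module.End k carrier
  left_right : ∀ a b m, left a (right b m) = right b (left a m)
  /-- the homogeneous components -/
  deg : ℤ → Submodule k carrier
  isInternal : DirectSum.IsInternal deg
  left_mem : ∀ {i j : ℤ} {a : A} {m : carrier}, a ∈ A.deg i → m ∈ deg j → left a m ∈ deg (i + j)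
  right_mem : ∀ {i j : ℤ} {m : carrier} {b : B}, m ∈ deg i → b ∈ B.deg j →
    right (.op b) m ∈ deg (i + j)
  /-- the differential -/
  d : carrier →ₗ[k] carrier
  d_mem : ∀ {i : ℤ} {m : carrier}, m ∈ deg i → d m ∈ deg (i + 1)
  d_d : ∀ m, d (d m) = 0
  d_left : ∀ {i : ℤ} {a : A} (m : carrier), a ∈ A.deg i →
    d (left a m) = left (A.d a) m + i.negOnePow • left a (d m)
  d_right : ∀ {i : ℤ} {m : carrier} (b : B), m ∈ deg i →
    d (right (.op b) m) = right (.op b) (d m) + i.negOnePow • right (.op (B.d b)) m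

attribute [instance] DGBimod.addCommGroup DGBimod.module

instance {A B : DGAlgebra k} : CoeSort (DGBimod A B) (Type u) := ⟨DGBimod.carrier⟩

namespace DGAlgebra

/-- A `k`-algebra, seen as a dg algebra concentrated in degree `0`. -/
def ofAlgebra (k : Type u) [Field k] (D : Type u) [Ring D] [Algebra k D] : DGAlgebra k where
  carrier := D
  deg i := if i = 0 then ⊤ else ⊥
  isInternal := isInternal_zero_degree
  one_mem := by simp
  mul_mem {i j a b} ha hb := by
    by_cases hi : i = 0 <;> by_cases hj : j = 0 <;> simp_all
  d := 0
  d_mem _ := zero_mem _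
  d_d _ := rfl
  d_mul _ _ := by simp

/-- The field `k` as a dg algebra. -/
def base (k : Type u) [Field k] : DGAlgebra k := ofAlgebra k k

/-- The identification of the dg algebra `base k` with `k`. -/
def baseEquiv (k : Type u) [Field k] : base k ≃ₐ[k] k := @AlgEquiv.refl k k _ _ _

/-- The identification of the opposite algebra of `base k` with `k`. -/
def baseOpEquiv (k : Type u) [Field k] : (base k)ᵐᵒᵖ ≃ₐ[k] k := (AlgEquiv.toOpposite k k).symm

theorem base_mem {i : ℤ} {a : base k} (ha : a ∈ (base k).deg i) : i = 0 ∨ a = 0 := by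
  by_cases hi : i = 0
  · exact Or.inl hi
  · have h : (base k).deg i = ⊥ := if_neg hi
    rw [h] at ha
    exact Or.inr ((Submodule.mem_bot k).1 ha)

variable (A : DGAlgebra k)

/-- The automorphism `a ↦ (-1)^{n|a|} a` of the graded algebra `A`. -/
def sgn (n : ℤ) : A →ₐ[k] A :=
  AlgHom.ofLinearMap (twist A.isInternal fun i => (n * i).negOnePow)
    (by rw [twist_of_mem _ _ A.one_mem]; simp)
    (by
      intro x y
      refine graded_induction A.isInternal (p := fun x => twist A.isInternal _ (x * y) =
        twist A.isInternal _ x * twist A.isInternal _ y) ?_ ?_ x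
      · intro i x hx
        refine graded_induction A.isInternal (p := fun y => twist A.isInternal _ (x * y) =
          twist A.isInternal _ x * twist A.isInternal _ y) ?_ ?_ y
        · intro j y hy
          rw [twist_of_mem _ _ hx, twist_of_mem _ _ hy, twist_of_mem _ _ (A.mul_mem hx hy),
            mul_add, Int.negOnePow_add, smul_mul_smul_comm]
        · intro a b ha hb
          rw [mul_add, map_add, map_add, mul_add, ha, hb]
      · intro a b ha hb
        rw [add_mul, map_add, map_add, add_mul, ha, hb])

theorem sgn_of_mem (n : ℤ) {i : ℤ} {a : A} (ha : a ∈ A.deg i) :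
    A.sgn n a = (n * i).negOnePow • a :=
  twist_of_mem A.isInternal _ ha

end DGAlgebra

namespace DGBimod

variable {A B C : DGAlgebra k}

/-- Morphisms of dg bimodules: closed morphisms of degree `0`. -/
@[ext]
structure Hom (M N : DGBimod A B) where
  toLin : M →ₗ[k] N
  map_left : ∀ a m, toLin (M.left a m) = N.left a (toLin m)
  map_right : ∀ b m, toLin (M.right b m) = N.right b (toLin m)
  map_deg : ∀ {i m}, m ∈ M.deg i → toLin m ∈ N.deg i
  map_d : ∀ m, toLin (M.d m) = N.d (toLin m)

instance : Category (DGBimod A B) where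
  Hom := Hom
  id M := ⟨LinearMap.id, fun _ _ => rfl, fun _ _ => rfl, fun h => h, fun _ => rfl⟩
  comp f g := ⟨g.toLin ∘ₗ f.toLin, fun a m => by simp [f.map_left, g.map_left],
    fun a m => by simp [f.map_right, g.map_right], fun h => g.map_deg (f.map_deg h),
    fun m => by simp [f.map_d, g.map_d]⟩

/-- The underlying linear map of a morphism. -/
def lin {M N : DGBimod A B} (f : M ⟶ N) : M →ₗ[k] N := Hom.toLin f

@[ext]
theorem hom_ext {M N : DGBimod A B} {f g : M ⟶ N} (h : ∀ x, lin f x = lin g x) : f = g :=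
  Hom.ext (LinearMap.ext h)

/-- Quasi-isomorphisms of dg bimodules. -/
def quasiIso (A B : DGAlgebra k) : MorphismProperty (DGBimod A B) := fun _ _ f =>
  Function.Bijective (cohomologyMap (lin f) f.map_d)

/-- The derived category of dg `A`-`B`-bimodules, i.e. the derived category of `Aᵒᵖ ⊗ B`. -/
abbrev D (A B : DGAlgebra k) := (quasiIso A B).Localization

/-- The localization functor to the derived category. -/
abbrev Q (A B : DGAlgebra k) : DGBimod A B ⥤ D A B := (quasiIso A B).Q

/-- `M` and `N` are isomorphic in the derived category. -/
def DIso (M N : DGBimod A B) : Prop := Nonempty ((Q A B).obj M ≅ (Q A B).obj N)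

/-- The diagonal bimodule `A`. -/
def diag (A : DGAlgebra k) : DGBimod A A where
  carrier := A
  left := Algebra.lmul k A
  right := AlgHom.ofLinearMap
    ((LinearMap.mul k A).flip ∘ₗ (MulOpposite.opLinearEquiv k).symm.toLinearMap)
    (by ext; simp) (fun x y => by ext; simp [mul_assoc])
  left_right a b m := by simp [mul_assoc]
  deg := A.deg
  isInternal := A.isInternal
  left_mem ha hm := A.mul_mem ha hm
  right_mem hm hb := A.mul_mem hm hb
  d := A.d
  d_mem := A.d_mem
  d_d := A.d_d
  d_left m ha := A.d_mul m ha
  d_right b hm := A.d_mul b hm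

/-- Forget the left action: a dg `A`-`B`-bimodule as a right dg `B`-module. -/
def forgetLeft (M : DGBimod A B) : DGBimod (DGAlgebra.base k) B where
  carrier := M
  left := (Algebra.ofId k (Module.End k M)).comp (DGAlgebra.baseEquiv k).toAlgHom
  right := M.right
  left_right a b m := ((M.right b).map_smul (show k from a) m).symm
  deg := M.deg
  isInternal := M.isInternal
  left_mem {i j a m} ha hm := by
    rcases DGAlgebra.base_mem ha with rfl | rfl
    · rw [zero_add]
      exact (M.deg j).smul_mem (show k from a) hm
    · rw [map_zero]
      exact zero_mem _
  right_mem := M.right_mem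
  d := M.d
  d_mem := M.d_mem
  d_d := M.d_d
  d_left {i a} m ha := by
    have h0 : (DGAlgebra.base k).d a = 0 := rfl
    rw [h0, map_zero, LinearMap.zero_apply, zero_add]
    rcases DGAlgebra.base_mem ha with rfl | rfl
    · rw [Int.negOnePow_zero, one_smul]
      exact M.d.map_smul (show k from a) m
    · simp only [map_zero, LinearMap.zero_apply, smul_zero]
  d_right := M.d_right

/-- Forget the right action: a dg `A`-`B`-bimodule as a left dg `A`-module. -/
def forgetRight (M : DGBimod A B) : DGBimod A (DGAlgebra.base k) where
  carrier := M
  left := M.left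
  right := (Algebra.ofId k (Module.End k M)).comp (DGAlgebra.baseOpEquiv k).toAlgHom
  left_right a b m := (M.left a).map_smul (show k from b.unop) m
  deg := M.deg
  isInternal := M.isInternal
  left_mem := M.left_mem
  right_mem {i j m b} hm hb := by
    rcases DGAlgebra.base_mem hb with rfl | rfl
    · rw [add_zero]
      exact (M.deg i).smul_mem (show k from b) hm
    · rw [MulOpposite.op_zero, map_zero]
      exact zero_mem _
  d := M.d
  d_mem := M.d_mem
  d_d := M.d_d
  d_left := M.d_left
  d_right {i m} b hm := by
    have h0 : (DGAlgebra.base k).d b = 0 := rfl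
    rw [h0, MulOpposite.op_zero, map_zero, LinearMap.zero_apply, smul_zero, add_zero]
    exact M.d.map_smul (show k from b) m


theorem units_smul_map {V W F : Type*} [AddCommGroup V] [AddCommGroup W] [FunLike F V W]
    [AddMonoidHomClass F V W] (f : F) (u : ℤˣ) (x : V) : f (u • x) = u • f x := by
  rw [Units.smul_def, Units.smul_def, map_zsmul]

theorem left_units_smul (M : DGBimod A B) (u : ℤˣ) (a : A) (m : M) :
    M.left (u • a) m = u • M.left a m := by
  rw [units_smul_map, LinearMap.smul_apply]

theorem right_units_smul (M : DGBimod A B) (u : ℤˣ) (b : B) (m : M) :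
    M.right (.op (u • b)) m = u • M.right (.op b) m := by
  rw [MulOpposite.op_smul, units_smul_map, LinearMap.smul_apply]

/-- The map `m ↦ (-1)^{|m|} m`. -/
def sgn (M : DGBimod A B) : M →ₗ[k] M := twist M.isInternal Int.negOnePow

theorem sgn_of_mem (M : DGBimod A B) {i : ℤ} {m : M} (hm : m ∈ M.deg i) :
    M.sgn m = i.negOnePow • m := twist_of_mem M.isInternal _ hm

theorem sgn_d (M : DGBimod A B) (m : M) : M.sgn (M.d m) = - M.d (M.sgn m) := by
  refine graded_induction M.isInternal (p := fun m => M.sgn (M.d m) = - M.d (M.sgn m))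
    (fun i x hx => ?_) (fun x y hx hy => ?_) m
  · rw [M.sgn_of_mem hx, M.sgn_of_mem (M.d_mem hx), units_smul_map, Int.negOnePow_succ,
      Units.neg_smul]
  · simp only [map_add, hx, hy]; abel

theorem sgn_left (M : DGBimod A B) (a : A) (m : M) :
    M.sgn (M.left a m) = M.left (A.sgn 1 a) (M.sgn m) := by
  refine graded_induction A.isInternal
    (p := fun a => M.sgn (M.left a m) = M.left (A.sgn 1 a) (M.sgn m))
    (fun i a ha => ?_) (fun x y hx hy => by simp only [map_add, LinearMap.add_apply, hx, hy]) a
  refine graded_induction M.isInternal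
    (p := fun m => M.sgn (M.left a m) = M.left (A.sgn 1 a) (M.sgn m))
    (fun j m hm => ?_) (fun x y hx hy => by simp only [map_add, hx, hy]) m
  rw [M.sgn_of_mem hm, A.sgn_of_mem 1 ha, M.sgn_of_mem (M.left_mem ha hm), left_units_smul,
    units_smul_map, smul_smul, one_mul, Int.negOnePow_add]

theorem sgn_right (M : DGBimod A B) (b : B) (m : M) :
    M.sgn (M.right (.op b) m) = M.right (.op (B.sgn 1 b)) (M.sgn m) := by
  refine graded_induction B.isInternal
    (p := fun b => M.sgn (M.right (.op b) m) = M.right (.op (B.sgn 1 b)) (M.sgn m))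
    (fun i b hb => ?_)
    (fun x y hx hy => by simp only [map_add, MulOpposite.op_add, LinearMap.add_apply, hx, hy]) b
  refine graded_induction M.isInternal
    (p := fun m => M.sgn (M.right (.op b) m) = M.right (.op (B.sgn 1 b)) (M.sgn m))
    (fun j m hm => ?_) (fun x y hx hy => by simp only [map_add, hx, hy]) m
  rw [M.sgn_of_mem hm, B.sgn_of_mem 1 hb, M.sgn_of_mem (M.right_mem hm hb), right_units_smul,
    units_smul_map, smul_smul, one_mul, Int.negOnePow_add, mul_comm]

theorem sgn_sgn (M : DGBimod A B) (m : M) : M.sgn (M.sgn m) = m := by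
  refine graded_induction M.isInternal (p := fun m => M.sgn (M.sgn m) = m)
    (fun i x hx => ?_) (fun x y hx hy => by simp only [map_add, hx, hy]) m
  rw [M.sgn_of_mem hx, units_smul_map, M.sgn_of_mem hx, smul_smul, Int.units_mul_self, one_smul]

theorem d_left_sgn (M : DGBimod A B) (a : A) (m : M) :
    M.d (M.left a m) = M.left (A.d a) m + M.left (A.sgn 1 a) (M.d m) := by
  refine graded_induction A.isInternal
    (p := fun a => M.d (M.left a m) = M.left (A.d a) m + M.left (A.sgn 1 a) (M.d m))
    (fun i a ha => ?_)
    (fun x y hx hy => by simp only [map_add, LinearMap.add_apply, hx, hy]; abel) a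
  rw [M.d_left m ha, A.sgn_of_mem 1 ha, left_units_smul, one_mul]

theorem d_right_sgn (M : DGBimod A B) (b : B) (m : M) :
    M.d (M.right (.op b) m) = M.right (.op b) (M.d m) + M.right (.op (B.d b)) (M.sgn m) := by
  refine graded_induction M.isInternal (p := fun m => M.d (M.right (.op b) m) =
      M.right (.op b) (M.d m) + M.right (.op (B.d b)) (M.sgn m))
    (fun i m hm => ?_) (fun x y hx hy => by simp only [map_add, hx, hy]; abel) m
  rw [M.d_right b hm, M.sgn_of_mem hm, units_smul_map]

/-! ### Shifts, cones and direct sums -/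

/-- The shift `M[n]`: its degree `i` part is the degree `i + n` part of `M`, its differential is
`(-1)^n d`, the right action is that of `M`, and `a` acts from the left as `(-1)^{n|a|} a`. -/
def shift (M : DGBimod A B) (n : ℤ) : DGBimod A B where
  carrier := M
  left := M.left.comp (A.sgn n)
  right := M.right
  left_right a b m := M.left_right _ b m
  deg i := M.deg (i + n)
  isInternal := isInternal_shift M.isInternal n
  left_mem {i j a m} ha hm := by
    rw [AlgHom.comp_apply, A.sgn_of_mem n ha, add_assoc, left_units_smul]
    exact zsmul_mem (M.left_mem ha hm) _
  right_mem {i j m b} hm hb := by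
    have := M.right_mem hm hb
    rwa [add_right_comm] at this
  d := n.negOnePow • M.d
  d_mem {i m} hm := by
    have := M.d_mem hm
    rw [add_right_comm] at this
    exact zsmul_mem this _
  d_d m := by
    rw [LinearMap.smul_apply, LinearMap.smul_apply, units_smul_map, M.d_d, smul_zero, smul_zero]
  d_left {i a} m ha := by
    rw [AlgHom.comp_apply, AlgHom.comp_apply, A.sgn_of_mem n ha, A.sgn_of_mem n (A.d_mem ha),
      LinearMap.smul_apply, LinearMap.smul_apply, left_units_smul, left_units_smul,
      left_units_smul, units_smul_map, units_smul_map, M.d_left m ha, mul_add, mul_one,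
      Int.negOnePow_add]
    simp only [smul_add, smul_smul]
    congr 2
    · rw [mul_comm]
    · rw [mul_left_comm, mul_comm n.negOnePow, mul_left_comm]
  d_right {i m} b hm := by
    rw [LinearMap.smul_apply, LinearMap.smul_apply, M.d_right b hm, units_smul_map,
      Int.negOnePow_add, smul_add, smul_smul, mul_left_comm, Int.units_mul_self, mul_one]

/-- The zero bimodule. -/
def zero (A B : DGAlgebra k) : DGBimod A B where
  carrier := PUnit
  left := AlgHom.ofLinearMap 0 (Subsingleton.elim _ _) (fun _ _ => Subsingleton.elim _ _)
  right := AlgHom.ofLinearMap 0 (Subsingleton.elim _ _) (fun _ _ => Subsingleton.elim _ _)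
  left_right _ _ _ := rfl
  deg _ := ⊤
  isInternal := isInternal_of_components 0
    (fun _ _ _ => by ext : 1; exact Subsingleton.elim _ _) (Subsingleton.elim _ _)
  left_mem _ _ := trivial
  right_mem _ _ := trivial
  d := 0
  d_mem _ := trivial
  d_d _ := rfl
  d_left _ _ := rfl
  d_right _ _ := rfl

/-- The direct sum of two dg bimodules. -/
def sum (M N : DGBimod A B) : DGBimod A B where
  carrier := M × N
  left := (LinearMap.prodMapAlgHom k M N).comp (M.left.prod N.left)
  right := (LinearMap.prodMapAlgHom k M N).comp (M.right.prod N.right)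
  left_right a b m := Prod.ext (M.left_right a b m.1) (N.left_right a b m.2)
  deg i := (M.deg i).prod (N.deg i)
  isInternal := isInternal_prod M.isInternal N.isInternal
  left_mem ha hm := ⟨M.left_mem ha hm.1, N.left_mem ha hm.2⟩
  right_mem hm hb := ⟨M.right_mem hm.1 hb, N.right_mem hm.2 hb⟩
  d := M.d.prodMap N.d
  d_mem hm := ⟨M.d_mem hm.1, N.d_mem hm.2⟩
  d_d m := Prod.ext (M.d_d m.1) (N.d_d m.2)
  d_left m ha := Prod.ext (M.d_left m.1 ha) (N.d_left m.2 ha)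
  d_right b hm := Prod.ext (M.d_right b hm.1) (N.d_right b hm.2)

/-- The cone of `f : M ⟶ N`: it is `N ⊕ M[1]` with differential `(n, m) ↦ (d n + f m, -d m)`. -/
def cone {M N : DGBimod A B} (f : M ⟶ N) : DGBimod A B where
  carrier := N × M
  left := (LinearMap.prodMapAlgHom k N M).comp (N.left.prod (M.left.comp (A.sgn 1)))
  right := (LinearMap.prodMapAlgHom k N M).comp (N.right.prod M.right)
  left_right a b m := Prod.ext (N.left_right a b m.1) (M.left_right _ b m.2)
  deg i := (N.deg i).prod (M.deg (i + 1))
  isInternal := isInternal_prod N.isInternal (isInternal_shift M.isInternal 1)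
  left_mem ha hm := ⟨N.left_mem ha hm.1, (M.shift 1).left_mem ha hm.2⟩
  right_mem hm hb := ⟨N.right_mem hm.1 hb, (M.shift 1).right_mem hm.2 hb⟩
  d := (N.d.coprod (lin f)).prod (-(M.d ∘ₗ LinearMap.snd k N M))
  d_mem hm := ⟨add_mem (N.d_mem hm.1) (f.map_deg hm.2), neg_mem (M.d_mem hm.2)⟩
  d_d m := by
    refine Prod.ext ?_ ?_
    · change N.d (N.d m.1 + f.toLin m.2) + f.toLin (-M.d m.2) = 0
      rw [map_add, N.d_d, map_neg, f.map_d, zero_add, add_neg_cancel]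
    · change -M.d (-M.d m.2) = 0
      rw [map_neg, M.d_d, neg_zero, neg_zero]
  d_left {i a} m ha := by
    refine Prod.ext ?_ ?_
    · change N.d (N.left a m.1) + f.toLin (M.left (A.sgn 1 a) m.2) =
        N.left (A.d a) m.1 + i.negOnePow • N.left a (N.d m.1 + f.toLin m.2)
      rw [N.d_left _ ha, f.map_left, A.sgn_of_mem 1 ha, left_units_smul, one_mul, map_add,
        smul_add, add_assoc]
    · change -M.d (M.left (A.sgn 1 a) m.2) =
        M.left (A.sgn 1 (A.d a)) m.2 + i.negOnePow • M.left (A.sgn 1 a) (-M.d m.2)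
      rw [A.sgn_of_mem 1 ha, A.sgn_of_mem 1 (A.d_mem ha), left_units_smul, left_units_smul,
        left_units_smul, units_smul_map, M.d_left _ ha, one_mul, one_mul, Int.negOnePow_succ,
        Units.neg_smul, map_neg, smul_neg, smul_neg, smul_add, neg_add]
  d_right {i m} b hm := by
    refine Prod.ext ?_ ?_
    · change N.d (N.right (.op b) m.1) + f.toLin (M.right (.op b) m.2) =
        N.right (.op b) (N.d m.1 + f.toLin m.2) + i.negOnePow • N.right (.op (B.d b)) m.1
      rw [N.d_right _ hm.1, f.map_right, map_add, add_right_comm]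
    · change -M.d (M.right (.op b) m.2) =
        M.right (.op b) (-M.d m.2) + i.negOnePow • M.right (.op (B.d b)) m.2
      rw [M.d_right _ hm.2, Int.negOnePow_succ, Units.neg_smul, neg_add, neg_neg, map_neg]

/-- The finite direct sum of the shifts `E[n]` of `E`, for `n` in a list of integers. -/
def sumShifts (E : DGBimod A B) : List ℤ → DGBimod A B
  | [] => zero A B
  | n :: l => (E.shift n).sum (E.sumShifts l)

/-! ### Tensor products -/

/-- The relations `m b ⊗ x = m ⊗ b x` that define `M ⊗_B K` as a quotient of `M ⊗ K`. -/
def tensorRel (M : DGBimod A B) (K : DGBimod B C) : Submodule k (M ⊗[k] K) :=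
  Submodule.span k {t | ∃ (m : M) (b : B) (x : K),
    t = M.right (.op b) m ⊗ₜ[k] x - m ⊗ₜ[k] K.left b x}

theorem tensorRel_mem (M : DGBimod A B) (K : DGBimod B C) (m : M) (b : B) (x : K) :
    M.right (.op b) m ⊗ₜ[k] x - m ⊗ₜ[k] K.left b x ∈ tensorRel M K :=
  Submodule.subset_span ⟨m, b, x, rfl⟩

theorem tensorRel_le {W : Type*} [AddCommGroup W] [Module k W] {M : DGBimod A B}
    {K : DGBimod B C} {f : M ⊗[k] K →ₗ[k] W} {S : Submodule k W}
    (h : ∀ m b x, f (M.right (.op b) m ⊗ₜ[k] x) - f (m ⊗ₜ[k] K.left b x) ∈ S) :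
    tensorRel M K ≤ S.comap f := by
  rw [tensorRel, Submodule.span_le]
  rintro _ ⟨m, b, x, rfl⟩
  change f _ ∈ S
  rw [map_sub]
  exact h m b x

/-- The differential `m ⊗ x ↦ d m ⊗ x + (-1)^{|m|} m ⊗ d x` of `M ⊗ K`. -/
def tensorD (M : DGBimod A B) (K : DGBimod B C) : M ⊗[k] K →ₗ[k] M ⊗[k] K :=
  M.d.rTensor K + TensorProduct.map M.sgn K.d

theorem tensorD_tmul (M : DGBimod A B) (K : DGBimod B C) (m : M) (x : K) :
    tensorD M K (m ⊗ₜ x) = M.d m ⊗ₜ x + M.sgn m ⊗ₜ K.d x := rfl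

theorem tensorD_rel (M : DGBimod A B) (K : DGBimod B C) :
    tensorRel M K ≤ (tensorRel M K).comap (tensorD M K) := by
  refine tensorRel_le fun m b x => ?_
  have h := add_mem (add_mem (tensorRel_mem M K (M.d m) b x)
    (tensorRel_mem M K (M.sgn m) (B.d b) x)) (tensorRel_mem M K (M.sgn m) (B.sgn 1 b) (K.d x))
  convert h using 1
  rw [tensorD_tmul, tensorD_tmul, M.d_right_sgn, M.sgn_right, K.d_left_sgn,
    TensorProduct.add_tmul, TensorProduct.tmul_add]
  abel

theorem tensorLeft_rel (M : DGBimod A B) (K : DGBimod B C) (a : A) :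
    tensorRel M K ≤ (tensorRel M K).comap ((M.left a).rTensor K) := by
  refine tensorRel_le fun m b x => ?_
  rw [LinearMap.rTensor_tmul, LinearMap.rTensor_tmul, M.left_right]
  exact tensorRel_mem M K _ b x

theorem tensorRight_rel (M : DGBimod A B) (K : DGBimod B C) (c : Cᵐᵒᵖ) :
    tensorRel M K ≤ (tensorRel M K).comap ((K.right c).lTensor M) := by
  refine tensorRel_le fun m b x => ?_
  rw [LinearMap.lTensor_tmul, LinearMap.lTensor_tmul, ← K.left_right]
  exact tensorRel_mem M K m b _

theorem tensorD_tensorD (M : DGBimod A B) (K : DGBimod B C) (t : M ⊗[k] K) :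
    tensorD M K (tensorD M K t) = 0 := by
  induction t using TensorProduct.induction_on with
  | zero => simp
  | tmul m x =>
    simp only [tensorD_tmul, map_add, M.d_d, K.d_d, sgn_d, TensorProduct.neg_tmul,
      TensorProduct.zero_tmul, TensorProduct.tmul_zero]
    abel
  | add x y hx hy => rw [map_add, map_add, hx, hy, add_zero]

theorem tensorD_left (M : DGBimod A B) (K : DGBimod B C) {i : ℤ} {a : A} (ha : a ∈ A.deg i)
    (t : M ⊗[k] K) :
    tensorD M K ((M.left a).rTensor K t) = (M.left (A.d a)).rTensor K t +
      i.negOnePow • (M.left a).rTensor K (tensorD M K t) := by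
  induction t using TensorProduct.induction_on with
  | zero => simp
  | tmul m x =>
    rw [LinearMap.rTensor_tmul, tensorD_tmul, tensorD_tmul, M.d_left m ha, sgn_left,
      A.sgn_of_mem 1 ha, left_units_smul]
    simp only [map_add, LinearMap.rTensor_tmul, TensorProduct.add_tmul, one_mul, smul_add,
      Units.smul_def, TensorProduct.smul_tmul', add_assoc]
  | add x y hx hy => simp only [map_add, hx, hy, smul_add]; abel

theorem tensorD_right (M : DGBimod A B) (K : DGBimod B C) {i : ℤ} {t : M ⊗[k] K} (c : C)
    (ht : t ∈ tensorGrading M.deg K.deg i) :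
    tensorD M K ((K.right (.op c)).lTensor M t) =
      (K.right (.op c)).lTensor M (tensorD M K t) +
        i.negOnePow • (K.right (.op (C.d c))).lTensor M t := by
  induction ht using Submodule.span_induction with
  | mem t h =>
    obtain ⟨p, q, rfl, m, hm, x, hx, rfl⟩ := h
    simp only [tensorD_tmul, map_add, LinearMap.lTensor_tmul, K.d_right c hx,
      M.sgn_of_mem hm, TensorProduct.tmul_add, Int.negOnePow_add, mul_smul,
      Units.smul_def, TensorProduct.smul_tmul', TensorProduct.tmul_smul, add_assoc]
    rw [smul_comm (q.negOnePow : ℤ)]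
  | zero => simp
  | add x y _ _ hx hy => simp only [map_add, hx, hy, smul_add]; abel
  | smul r x _ hx => simp only [map_smul, hx, smul_add, Units.smul_def, smul_comm r]

theorem tensor_isInternal (M : DGBimod A B) (K : DGBimod B C) :
    DirectSum.IsInternal fun n => (tensorGrading M.deg K.deg n).map (tensorRel M K).mkQ := by
  refine isInternal_tensor_quotient M.isInternal K.isInternal _ fun t ht => ?_
  let φ : M ⊗[k] K →ₗ[k] (ℤ →₀ ((M ⊗[k] K) ⧸ tensorRel M K)) :=
    Finsupp.mapRange.linearMap (tensorRel M K).mkQ ∘ₗ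
      (Finsupp.lmapDomain (M ⊗[k] K) k (fun p : ℤ × ℤ => p.1 + p.2) ∘ₗ
        (finsuppTensorFinsupp k k M K ℤ ℤ).toLinearMap ∘ₗ
          TensorProduct.map (components M.isInternal) (components K.isInternal))
  have hφ : ∀ {i j m x}, m ∈ M.deg i → x ∈ K.deg j →
      φ (m ⊗ₜ x) = Finsupp.single (i + j) (Submodule.Quotient.mk (m ⊗ₜ x)) := by
    intro i j m x hm hx
    simp [φ, components_of_mem _ hm, components_of_mem _ hx, finsuppTensorFinsupp_single]
  have key : tensorRel M K ≤ (⊥ : Submodule k _).comap φ := by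
    refine tensorRel_le fun m b x => ?_
    rw [Submodule.mem_bot, sub_eq_zero]
    refine graded_induction M.isInternal (p := fun m => ∀ b x,
      φ (M.right (.op b) m ⊗ₜ x) = φ (m ⊗ₜ K.left b x)) (fun i m hm => ?_)
      (fun m m' h h' b x => ?_) m b x
    · intro b x
      refine graded_induction B.isInternal (p := fun b => ∀ x,
        φ (M.right (.op b) m ⊗ₜ x) = φ (m ⊗ₜ K.left b x)) (fun j b hb => ?_)
        (fun b b' h h' x => ?_) b x
      · intro x
        refine graded_induction K.isInternal (p := fun x =>
          φ (M.right (.op b) m ⊗ₜ x) = φ (m ⊗ₜ K.left b x)) (fun l x hx => ?_)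
          (fun x x' h h' => ?_) x
        · rw [hφ (M.right_mem hm hb) hx, hφ hm (K.left_mem hb hx), add_assoc,
            (Submodule.Quotient.eq (tensorRel M K)).2 (tensorRel_mem M K m b x)]
        · rw [TensorProduct.tmul_add, map_add, map_add, TensorProduct.tmul_add, map_add, h, h']
      · rw [MulOpposite.op_add, map_add, map_add, LinearMap.add_apply, LinearMap.add_apply,
          TensorProduct.tmul_add, TensorProduct.add_tmul, map_add, map_add, h, h']
    · rw [map_add, TensorProduct.add_tmul, TensorProduct.add_tmul, map_add, map_add, h, h']
  exact key ht

/-- The left action on `M ⊗_B K`. -/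
def tensorLeft (M : DGBimod A B) (K : DGBimod B C) :
    A →ₐ[k] Module.End k ((M ⊗[k] K) ⧸ tensorRel M K) where
  toFun a := (tensorRel M K).mapQ _ ((M.left a).rTensor K) (tensorLeft_rel M K a)
  map_one' := by ext; simp
  map_mul' x y := by ext; simp
  map_zero' := by ext; simp
  map_add' x y := by ext; simp
  commutes' r := by ext; simp [Algebra.algebraMap_eq_smul_one]

/-- The right action on `M ⊗_B K`. -/
def tensorRight (M : DGBimod A B) (K : DGBimod B C) :
    Cᵐᵒᵖ →ₐ[k] Module.End k ((M ⊗[k] K) ⧸ tensorRel M K) where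
  toFun c := (tensorRel M K).mapQ _ ((K.right c).lTensor M) (tensorRight_rel M K c)
  map_one' := by ext; simp
  map_mul' x y := by ext; simp
  map_zero' := by ext; simp
  map_add' x y := by ext; simp
  commutes' r := by ext; simp [Algebra.algebraMap_eq_smul_one]

/-- The tensor product `M ⊗_B K` of dg bimodules. With `B = k` it is the exterior product
`M ⊠ K = M ⊗_k K`. -/
def tensor (M : DGBimod A B) (K : DGBimod B C) : DGBimod A C where
  carrier := (M ⊗[k] K) ⧸ tensorRel M K
  left := tensorLeft M K
  right := tensorRight M K
  left_right a c t := by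
    obtain ⟨t, rfl⟩ := Submodule.Quotient.mk_surjective _ t
    change Submodule.Quotient.mk _ = Submodule.Quotient.mk _
    rw [← LinearMap.comp_apply, ← LinearMap.comp_apply, LinearMap.rTensor_comp_lTensor,
      LinearMap.lTensor_comp_rTensor]
  deg n := (tensorGrading M.deg K.deg n).map (tensorRel M K).mkQ
  isInternal := tensor_isInternal M K
  left_mem {i j a _} ha := by
    rintro ⟨t, ht, rfl⟩
    refine ⟨(M.left a).rTensor K t, ?_, rfl⟩
    induction ht using Submodule.span_induction with
    | mem t h =>
      obtain ⟨p, q, rfl, m, hm, x, hx, rfl⟩ := h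
      exact Submodule.subset_span ⟨i + p, q, add_assoc _ _ _, _, M.left_mem ha hm, x, hx, rfl⟩
    | zero => rw [map_zero]; exact zero_mem _
    | add x y _ _ hx hy => rw [map_add]; exact add_mem hx hy
    | smul r x _ hx => rw [map_smul]; exact Submodule.smul_mem _ _ hx
  right_mem {i j _ c} := by
    rintro ⟨t, ht, rfl⟩ hc
    refine ⟨(K.right (.op c)).lTensor M t, ?_, rfl⟩
    induction ht using Submodule.span_induction with
    | mem t h =>
      obtain ⟨p, q, rfl, m, hm, x, hx, rfl⟩ := h
      exact Submodule.subset_span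
        ⟨p, q + j, (add_assoc _ _ _).symm, m, hm, _, K.right_mem hx hc, rfl⟩
    | zero => rw [map_zero]; exact zero_mem _
    | add x y _ _ hx hy => rw [map_add]; exact add_mem hx hy
    | smul r x _ hx => rw [map_smul]; exact Submodule.smul_mem _ _ hx
  d := (tensorRel M K).mapQ _ (tensorD M K) (tensorD_rel M K)
  d_mem {i _} := by
    rintro ⟨t, ht, rfl⟩
    refine ⟨tensorD M K t, ?_, rfl⟩
    induction ht using Submodule.span_induction with
    | mem t h =>
      obtain ⟨p, q, rfl, m, hm, x, hx, rfl⟩ := h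
      rw [tensorD_tmul]
      refine add_mem
        (Submodule.subset_span ⟨p + 1, q, add_right_comm _ _ _, _, M.d_mem hm, x, hx, rfl⟩)
        (Submodule.subset_span ⟨p, q + 1, (add_assoc _ _ _).symm, _, ?_, _, K.d_mem hx, rfl⟩)
      rw [M.sgn_of_mem hm]
      exact zsmul_mem hm _
    | zero => rw [map_zero]; exact zero_mem _
    | add x y _ _ hx hy => rw [map_add]; exact add_mem hx hy
    | smul r x _ hx => rw [map_smul]; exact Submodule.smul_mem _ _ hx
  d_d t := by
    obtain ⟨t, rfl⟩ := Submodule.Quotient.mk_surjective _ t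
    change Submodule.Quotient.mk _ = _
    rw [tensorD_tensorD]; rfl
  d_left {i a} t ha := by
    obtain ⟨t, rfl⟩ := Submodule.Quotient.mk_surjective _ t
    have h := congrArg (tensorRel M K).mkQ (tensorD_left M K ha t)
    rw [map_add, units_smul_map] at h
    exact h
  d_right {i _} c := by
    rintro ⟨t, ht, rfl⟩
    have h := congrArg (tensorRel M K).mkQ (tensorD_right M K c ht)
    rw [map_add, units_smul_map] at h
    exact h

/-- The functor `- ⊗_B K`. -/
def tensorFunctor (A : DGAlgebra k) (K : DGBimod B C) : DGBimod A B ⥤ DGBimod A C where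
  obj M := M.tensor K
  map {M N} f :=
    { toLin := (tensorRel M K).mapQ (tensorRel N K) ((lin f).rTensor K)
        (tensorRel_le fun m b x => by
          rw [LinearMap.rTensor_tmul, LinearMap.rTensor_tmul, lin, f.map_right]
          exact tensorRel_mem N K _ b x)
      map_left := fun a t => by
        obtain ⟨t, rfl⟩ := Submodule.Quotient.mk_surjective _ t
        change Submodule.Quotient.mk _ = Submodule.Quotient.mk _
        rw [← LinearMap.comp_apply, ← LinearMap.comp_apply, ← LinearMap.rTensor_comp,
          ← LinearMap.rTensor_comp]
        congr 3
        ext m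
        exact f.map_left a m
      map_right := fun c t => by
        obtain ⟨t, rfl⟩ := Submodule.Quotient.mk_surjective _ t
        change Submodule.Quotient.mk _ = Submodule.Quotient.mk _
        rw [← LinearMap.comp_apply, ← LinearMap.comp_apply, LinearMap.rTensor_comp_lTensor,
          LinearMap.lTensor_comp_rTensor]
      map_deg := by
        rintro i _ ⟨t, ht, rfl⟩
        refine ⟨(lin f).rTensor K t, ?_, rfl⟩
        induction ht using Submodule.span_induction with
        | mem t h =>
          obtain ⟨p, q, rfl, m, hm, x, hx, rfl⟩ := h
          exact Submodule.subset_span ⟨p, q, rfl, _, f.map_deg hm, x, hx, rfl⟩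
        | zero => rw [map_zero]; exact zero_mem _
        | add x y _ _ hx hy => rw [map_add]; exact add_mem hx hy
        | smul r x _ hx => rw [map_smul]; exact Submodule.smul_mem _ _ hx
      map_d := fun t => by
        obtain ⟨t, rfl⟩ := Submodule.Quotient.mk_surjective _ t
        have hs : ∀ m, f.toLin (M.sgn m) = N.sgn (f.toLin m) := fun m => by
          refine graded_induction M.isInternal
            (p := fun m => f.toLin (M.sgn m) = N.sgn (f.toLin m))
            (fun i m hm => ?_) (fun x y hx hy => by simp only [map_add, hx, hy]) m
          rw [M.sgn_of_mem hm, N.sgn_of_mem (f.map_deg hm), units_smul_map]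
        have : (lin f).rTensor K (tensorD M K t) = tensorD N K ((lin f).rTensor K t) := by
          induction t using TensorProduct.induction_on with
          | zero => simp
          | tmul m x =>
            simp only [tensorD_tmul, map_add, LinearMap.rTensor_tmul, lin, f.map_d, hs]
          | add x y hx hy => simp only [map_add, hx, hy]
        change Submodule.Quotient.mk _ = Submodule.Quotient.mk _
        rw [this] }
  map_id M := by
    ext t
    obtain ⟨t, rfl⟩ := Submodule.Quotient.mk_surjective _ t
    exact congrArg Submodule.Quotient.mk (LinearMap.congr_fun (LinearMap.rTensor_id K M) t)
  map_comp f g := by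
    ext t
    obtain ⟨t, rfl⟩ := Submodule.Quotient.mk_surjective _ t
    exact congrArg Submodule.Quotient.mk
      (LinearMap.congr_fun (LinearMap.rTensor_comp K (lin g) (lin f)) t)

/-! ### Perfect bimodules and generation -/

/-- The free bimodule `A ⊗ B`, i.e. the right module `Aᵒᵖ ⊗ B` over `Aᵒᵖ ⊗ B`. -/
def free (A B : DGAlgebra k) : DGBimod A B := (diag A).forgetRight.tensor (diag B).forgetLeft

/-- The objects of `Perf(Aᵒᵖ ⊗ B)`: the smallest class of objects of the derived category which is
closed under isomorphisms, shifts, cones and direct summands and contains `A ⊗ B`. -/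
inductive IsPerfect : DGBimod A B → Prop
  | free : IsPerfect (free A B)
  | iso {M N : DGBimod A B} : DIso M N → IsPerfect M → IsPerfect N
  | shift {M : DGBimod A B} (n : ℤ) : IsPerfect M → IsPerfect (M.shift n)
  | cone {M N : DGBimod A B} (f : M ⟶ N) : IsPerfect M → IsPerfect N → IsPerfect (cone f)
  | summand {M N : DGBimod A B} : IsPerfect (M.sum N) → IsPerfect M

/-- There is a distinguished triangle `X → Y → Z → X[1]` in the derived category, i.e. one that is
isomorphic to `M → N → cone f → M[1]` for some morphism `f : M ⟶ N` of dg bimodules. -/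
def HasTriangle (X Y Z : DGBimod A B) : Prop :=
  ∃ (M N : DGBimod A B) (f : M ⟶ N), DIso X M ∧ DIso Y N ∧ DIso Z (cone f)

/-- The operation `P ⋆ R` on classes of objects of the derived category. -/
def star (P R : DGBimod A B → Prop) (Y : DGBimod A B) : Prop :=
  ∃ X Z, P X ∧ R Z ∧ HasTriangle X Y Z

/-- The objects isomorphic to a finite direct sum of shifts of `E`. -/
def bracketZero (E X : DGBimod A B) : Prop := ∃ l : List ℤ, DIso X (E.sumShifts l)

/-- The class `[E]_n`, the star product of `n + 1` factors `[E]_0`. -/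
def bracket (E : DGBimod A B) : ℕ → DGBimod A B → Prop
  | 0 => bracketZero E
  | n + 1 => star (bracketZero E) (bracket E n)

/-- The class `⟨E⟩_n` of direct summands of objects of `[E]_n`. -/
def angle (E : DGBimod A B) (n : ℕ) (X : DGBimod A B) : Prop :=
  ∃ X', bracket E n (X.sum X')

end DGBimod

open DGBimod

namespace DGAlgebra

/-- `A` is homologically smooth: the diagonal bimodule is perfect. -/
def IsSmooth (A : DGAlgebra k) : Prop := IsPerfect (diag A)

/-- `A` is compact: its total cohomology is finite dimensional. -/
def IsCompact (A : DGAlgebra k) : Prop := Module.Finite k (Cohomology A.d)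

/-- The diagonal dimension of `Perf(A)`: the least `n` such that the diagonal bimodule lies in
`⟨F ⊠ G⟩_n` for a perfect left dg `A`-module `F` and a perfect right dg `A`-module `G`, and `⊤` if
there is no such `n`. -/
def diagDim (A : DGAlgebra k) : ℕ∞ :=
  ⨅ n ∈ {n : ℕ | ∃ (F : DGBimod A (base k)) (G : DGBimod (base k) A),
    IsPerfect F ∧ IsPerfect G ∧ angle (F.tensor G) n (diag A)}, (n : ℕ∞)

/-- `A` and `B` are Morita equivalent: for some dg `A`-`B`-bimodule `K`, the derived functor
`- ⊗ᴸ_A K : D(A) ⥤ D(B)` is an equivalence. -/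
def MoritaEquivalent (A B : DGAlgebra k) : Prop :=
  ∃ (K : DGBimod A B) (Φ : DGBimod.D (base k) A ⥤ DGBimod.D (base k) B)
    (α : Q (base k) A ⋙ Φ ⟶ tensorFunctor (base k) K ⋙ Q (base k) B),
    Φ.IsLeftDerivedFunctor α (quasiIso (base k) A) ∧ Φ.IsEquivalence

end DGAlgebra

end DGDim

end

/-!
Let `H = H(A)`, a finite-dimensional graded algebra.

If the diagonal dimension vanishes, `A` is a direct summand, in the derived category of bimodules,
of a finite sum of shifts of `F ⊠ G`. Cohomology is a functor on the derived category with values in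
`H`-bimodules, and the Künneth formula turns `F ⊠ G` into a tensor product over `k`, so `H`
is a retract of an `H`-bimodule `X ⊗ Y` (`DGAlgebra.exists_externalRetract`). This has two
consequences.

* `H` is von Neumann regular (`ExternalRetract.regular`): a generalized inverse of the linear map
  by which `x ∈ H` acts on `X` is carried over to `H` by the retraction. In particular each
  homogeneous `x` is of the form `x y x` with a homogeneous `y`. Among the full idempotents of
  degree `0`, choose `e` with `e H e` of least dimension. A nonzero homogeneous nilpotent element of
  `e H e` would give two orthogonal equivalent idempotents in `e H e`, one of which could be removed
  from `e`. So `e H e` has no homogeneous nilpotent elements; as elements of nonzero degree are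
  nilpotent, `e H e` is of degree `0` (`IsMinimalFull.corner_le`) and reduced, i.e. a product
  `B = D_1 × ⋯ × D_s` of division algebras (`exists_divisionRings`).
* `B` is separable over `k` (`ExternalRetract.exists_isSeparabilityFamily`), i.e. `B ⊗ B` contains
  a central element `∑ p_j ⊗ q_j` with `∑ p_j q_j = 1`.

The embedding of `B` in `H` lifts to a linear map from `B` to the cocycles of `A`, which is
multiplicative only up to homotopy. The separability element replaces a multiplicative lift. For a
right dg `A`-module `M`, the endomorphism `m ⊗ b ↦ ∑ m p_j ⊗ q_j b` of the induced module `M ⊗_k B`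
is strictly functorial in `M`, and it is idempotent on cohomology. The colimit of its iterates
(`tele`) is thus a module whose cohomology is `H(M) e`, and `M ↦ tele` is a functor `transfer`, which
preserves quasi-isomorphisms and is the tensor product with a bimodule (`transferToTensor`). In the
same way there is a transfer from `B` to `A`. Both directions are instances of one construction.

The data needed are collected in `CornerData`. The map `n ↦ ∑ n p_j ⊗ q_j p_l ⊗ q_l` induces a
quasi-isomorphism from a `B`-module `N` to its double transfer (`CornerData.quasiIso_unit`). On the
side of `A`, the map `m ⊗ b ⊗ a ↦ m b a` from `M ⊗ B ⊗ A` to `M` is, on cohomology, a split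
surjection, because `e` is full, and the resulting idempotent is the one that defines the double
transfer (`CornerData.hmap_endo_endo_counit`). The homotopy fibre of the map from `M ⊗ B ⊗ A` to
the image of the complementary idempotent maps to `M` and to the double transfer by natural
quasi-isomorphisms (`CornerData.roof`). Hence the transfers induce mutually inverse equivalences of
derived categories (`CornerData.moritaEquivalent`).
-/

open scoped TensorProduct DirectSum
open CategoryTheory

noncomputable section

namespace DGDim

variable {k : Type u} [Field k]

open DGBimod

/-! ### Cohomology classes -/

section Classes

variable {V W X : Type*} [AddCommGroup V] [Module k V] [AddCommGroup W] [Module k W]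
  [AddCommGroup X] [Module k X] {d : V →ₗ[k] V} {e : W →ₗ[k] W}

/-- The cohomology class of a cocycle. -/
def cls (d : V →ₗ[k] V) (z : V) (hz : d z = 0) : Cohomology d :=
  Submodule.Quotient.mk ⟨z, hz⟩

theorem cls_surjective (x : Cohomology d) : ∃ z hz, cls d z hz = x := by
  obtain ⟨⟨z, hz⟩, rfl⟩ := Submodule.Quotient.mk_surjective _ x
  exact ⟨z, hz, rfl⟩

theorem cls_eq_iff {z w : V} (hz : d z = 0) (hw : d w = 0) :
    cls d z hz = cls d w hw ↔ ∃ y, d y = z - w := by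
  rw [cls, cls, Submodule.Quotient.eq]
  rfl

theorem cls_eq_zero_iff {z : V} (hz : d z = 0) : cls d z hz = 0 ↔ ∃ y, d y = z := by
  rw [cls, Submodule.Quotient.mk_eq_zero]
  rfl

theorem cls_congr {z w : V} (hz : d z = 0) (h : z = w) : cls d z hz = cls d w (h ▸ hz) := by
  subst h; rfl

theorem cls_add {z w : V} (hz : d z = 0) (hw : d w = 0) :
    cls d (z + w) (by rw [map_add, hz, hw, add_zero]) = cls d z hz + cls d w hw := rfl

/-- The map induced on cohomology by a linear map that preserves cocycles and coboundaries. -/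
def cohMap (f : V →ₗ[k] W) (h1 : ∀ z, d z = 0 → e (f z) = 0) (h2 : ∀ x, ∃ y, e y = f (d x)) :
    Cohomology d →ₗ[k] Cohomology e :=
  Submodule.mapQ _ _ (f.restrict (p := LinearMap.ker d) (q := LinearMap.ker e) h1)
    (by
      rintro ⟨_, hx⟩ ⟨y, rfl⟩
      exact h2 y)

theorem cohomology_hom_ext {f g : Cohomology d →ₗ[k] X}
    (h : ∀ z hz, f (cls d z hz) = g (cls d z hz)) : f = g := by
  ext ⟨z, hz⟩
  exact h z hz

end Classes

/-! ### The cohomology algebra of a dg algebra and its actions -/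

namespace DGAlgebra

variable (A : DGAlgebra k)

theorem sgn_one_eq (a : A) : A.sgn 1 a = (diag A).sgn a := by
  refine graded_induction A.isInternal (p := fun a => A.sgn 1 a = (diag A).sgn a)
    (fun i a ha => ?_) (fun x y hx hy => by rw [map_add, hx, hy]; exact (map_add _ _ _).symm) a
  rw [A.sgn_of_mem 1 ha, one_mul]
  exact ((diag A).sgn_of_mem ha).symm

theorem sgn_sgn (a : A) : A.sgn 1 (A.sgn 1 a) = a := by
  rw [sgn_one_eq, sgn_one_eq]; exact DGBimod.sgn_sgn _ _

theorem d_sgn (a : A) : A.d (A.sgn 1 a) = -A.sgn 1 (A.d a) := by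
  rw [sgn_one_eq, sgn_one_eq]
  exact (neg_eq_iff_eq_neg.2 (DGBimod.sgn_d (diag A) a)).symm

theorem d_mul_sgn (a b : A) : A.d (a * b) = A.d a * b + A.sgn 1 a * A.d b :=
  (diag A).d_left_sgn a b

theorem d_one : A.d 1 = 0 := by
  have := A.d_mul_sgn 1 1
  rwa [map_one (A.sgn 1), one_mul, one_mul, mul_one, left_eq_add] at this

/-- The subalgebra of cocycles. -/
def cocycles : Subalgebra k A where
  carrier := {a | A.d a = 0}
  mul_mem' {a b} ha hb := by
    change A.d _ = 0 at *
    rw [d_mul_sgn, ha, hb, zero_mul, mul_zero, add_zero]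
  add_mem' {a b} ha hb := by
    change A.d _ = 0 at *
    rw [map_add, ha, hb, add_zero]
  algebraMap_mem' r := by
    change A.d _ = 0
    rw [Algebra.algebraMap_eq_smul_one, map_smul, d_one, smul_zero]

/-- The two-sided ideal of coboundaries in the algebra of cocycles. -/
def coboundaries : Ideal A.cocycles where
  carrier := {z | ∃ a, A.d a = z}
  add_mem' := by
    rintro _ _ ⟨a, ha⟩ ⟨b, hb⟩
    exact ⟨a + b, by rw [map_add, ha, hb]; rfl⟩
  zero_mem' := ⟨0, map_zero _⟩
  smul_mem' := by
    rintro c z ⟨a, ha⟩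
    refine ⟨A.sgn 1 c * a, ?_⟩
    have hc : A.d c = 0 := c.2
    rw [d_mul_sgn, d_sgn, sgn_sgn, hc, map_zero, neg_zero, zero_mul, zero_add, ha]
    rfl

instance : A.coboundaries.IsTwoSided where
  mul_mem_of_left {z} c := by
    rintro ⟨a, ha⟩
    refine ⟨a * c, ?_⟩
    have hc : A.d c = 0 := c.2
    rw [d_mul_sgn, hc, mul_zero, add_zero, ha]
    rfl

/-- The cohomology algebra. -/
abbrev H : Type u := A.cocycles ⧸ A.coboundaries

/-- The class of a cocycle in the cohomology algebra. -/
def hcls (a : A) (ha : A.d a = 0) : A.H := Ideal.Quotient.mk _ ⟨a, ha⟩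

variable {A}

theorem hcls_surjective (x : A.H) : ∃ a ha, A.hcls a ha = x := by
  obtain ⟨⟨a, ha⟩, rfl⟩ := Ideal.Quotient.mk_surjective x
  exact ⟨a, ha, rfl⟩

variable (A)

end DGAlgebra

namespace DGBimod

variable {A B C : DGAlgebra k}

/-- The map induced on cohomology by a morphism of dg bimodules. -/
def hmap {M N : DGBimod A B} (f : M ⟶ N) : Cohomology M.d →ₗ[k] Cohomology N.d :=
  cohomologyMap (lin f) f.map_d

theorem lin_d {M N : DGBimod A B} (f : M ⟶ N) (x : M) : lin f (M.d x) = N.d (lin f x) := f.map_d x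

theorem lin_left {M N : DGBimod A B} (f : M ⟶ N) (a : A) (x : M) :
    lin f (M.left a x) = N.left a (lin f x) := f.map_left a x

theorem lin_right {M N : DGBimod A B} (f : M ⟶ N) (b : Bᵐᵒᵖ) (x : M) :
    lin f (M.right b x) = N.right b (lin f x) := f.map_right b x

@[simp]
theorem hmap_cls {M N : DGBimod A B} (f : M ⟶ N) (z : M) (hz : M.d z = 0) :
    hmap f (cls M.d z hz) = cls N.d (lin f z) (by rw [← lin_d, hz, map_zero]) := rfl

@[simp]
theorem hmap_id (M : DGBimod A B) : hmap (𝟙 M) = LinearMap.id :=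
  cohomology_hom_ext fun _ _ => rfl

@[simp]
theorem hmap_comp {M N P : DGBimod A B} (f : M ⟶ N) (g : N ⟶ P) :
    hmap (f ≫ g) = hmap g ∘ₗ hmap f :=
  cohomology_hom_ext fun _ _ => rfl

theorem quasiIso_iff {M N : DGBimod A B} (f : M ⟶ N) :
    quasiIso A B f ↔ Function.Bijective (hmap f) := Iff.rfl

/-- The left action of the cohomology algebra on the cohomology of a dg bimodule. -/
def hLeft (M : DGBimod A B) : A.H →ₐ[k] Module.End k (Cohomology M.d) :=
  Ideal.Quotient.liftₐ A.coboundaries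
    { toFun := fun a => cohMap (M.left a)
        (fun z hz => by
          rw [M.d_left_sgn, hz, map_zero, add_zero, show A.d a = 0 from a.2, map_zero,
            LinearMap.zero_apply])
        (fun x => ⟨M.left (A.sgn 1 a) x, by
          rw [M.d_left_sgn, A.d_sgn, A.sgn_sgn, show A.d a = 0 from a.2, map_zero, neg_zero,
            map_zero, LinearMap.zero_apply, zero_add]⟩)
      map_one' := cohomology_hom_ext fun z hz => cls_congr _ (by simp)
      map_mul' := fun a b => cohomology_hom_ext fun z hz => cls_congr _ (by simp; rfl)
      map_zero' := cohomology_hom_ext fun z hz => cls_congr _ (by simp)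
      map_add' := fun a b => cohomology_hom_ext fun z hz => cls_congr _ (by simp; rfl)
      commutes' := fun r => cohomology_hom_ext fun z hz => cls_congr _ (by
        simp [Algebra.algebraMap_eq_smul_one]) }
    (by
      rintro z ⟨a, ha⟩
      refine cohomology_hom_ext fun x hx => ?_
      refine (cls_eq_zero_iff (d := M.d) _).2 ⟨M.left a x, ?_⟩
      rw [M.d_left_sgn, hx, map_zero, add_zero, ha]
      rfl)

/-- The right action of the cohomology algebra on the cohomology of a dg bimodule. -/
def hRightOp (M : DGBimod A B) : B.H →ₐ[k] (Module.End k (Cohomology M.d))ᵐᵒᵖ :=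
  Ideal.Quotient.liftₐ B.coboundaries
    { toFun := fun b => .op (cohMap (M.right (.op b))
        (fun z hz => by
          rw [M.d_right_sgn, hz, map_zero, zero_add, show B.d b = 0 from b.2, MulOpposite.op_zero,
            map_zero, LinearMap.zero_apply])
        (fun x => ⟨M.right (.op b) x, by
          rw [M.d_right_sgn, show B.d b = 0 from b.2, MulOpposite.op_zero, map_zero,
            LinearMap.zero_apply, add_zero]⟩))
      map_one' := congrArg MulOpposite.op (cohomology_hom_ext fun z hz => cls_congr _ (by simp))
      map_mul' := fun a b => congrArg MulOpposite.op
        (cohomology_hom_ext fun z hz => cls_congr _ (by simp; rfl))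
      map_zero' := congrArg MulOpposite.op (cohomology_hom_ext fun z hz => cls_congr _ (by simp))
      map_add' := fun a b => congrArg MulOpposite.op
        (cohomology_hom_ext fun z hz => cls_congr _ (by simp; rfl))
      commutes' := fun r => congrArg MulOpposite.op (cohomology_hom_ext fun z hz => cls_congr _ (by
        simp [Algebra.algebraMap_eq_smul_one])) }
    (by
      rintro z ⟨a, ha⟩
      refine congrArg MulOpposite.op (cohomology_hom_ext fun x hx => ?_)
      refine (cls_eq_zero_iff (d := M.d) _).2 ⟨M.right (.op a) (M.sgn x), ?_⟩
      rw [M.d_right_sgn, M.sgn_sgn, ← neg_eq_iff_eq_neg.2 (M.sgn_d x), hx, map_zero, neg_zero,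
        map_zero, zero_add, ha]
      rfl)

/-- The right action of the cohomology algebra, as a linear map to endomorphisms. -/
def hRight (M : DGBimod A B) : B.H →ₗ[k] Module.End k (Cohomology M.d) :=
  (MulOpposite.opLinearEquiv k).symm.toLinearMap ∘ₗ (hRightOp M).toLinearMap

theorem hRight_one (M : DGBimod A B) : hRight M 1 = 1 := by simp [hRight]

theorem hRight_mul (M : DGBimod A B) (x y : B.H) (m : Cohomology M.d) :
    hRight M (x * y) m = hRight M y (hRight M x m) := by simp [hRight]

theorem hRight_cls (M : DGBimod A B) (b : B) (hb : B.d b = 0) (z : M) (hz : M.d z = 0) :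
    hRight M (B.hcls b hb) (cls M.d z hz) = cls M.d (M.right (.op b) z) (by
      rw [M.d_right_sgn, hz, map_zero, zero_add, hb, MulOpposite.op_zero, map_zero,
        LinearMap.zero_apply]) := rfl

theorem hmap_hLeft {M N : DGBimod A B} (f : M ⟶ N) (a : A.H) (x : Cohomology M.d) :
    hmap f (hLeft M a x) = hLeft N a (hmap f x) := by
  obtain ⟨a, ha, rfl⟩ := DGAlgebra.hcls_surjective a
  obtain ⟨z, hz, rfl⟩ := cls_surjective x
  exact cls_congr _ (lin_left f a z)

theorem hmap_hRight {M N : DGBimod A B} (f : M ⟶ N) (b : B.H) (x : Cohomology M.d) :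
    hmap f (hRight M b x) = hRight N b (hmap f x) := by
  obtain ⟨b, hb, rfl⟩ := DGAlgebra.hcls_surjective b
  obtain ⟨z, hz, rfl⟩ := cls_surjective x
  exact cls_congr _ (lin_right f _ z)

end DGBimod

/-- The class `[a]` in the cohomology of the diagonal bimodule is `[a] · [1]`. -/
theorem DGAlgebra.hLeft_cls_one (A : DGAlgebra k) (a : A) (ha : A.d a = 0) :
    hLeft (diag A) (A.hcls a ha) (cls (diag A).d (1 : A) A.d_one) = cls (diag A).d a ha :=
  cls_congr _ (mul_one a)

/-- The cohomology algebra is the cohomology of the diagonal bimodule. -/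
def DGAlgebra.hEquiv (A : DGAlgebra k) : A.H ≃ₗ[k] Cohomology (diag A).d :=
  LinearEquiv.ofBijective
    ((hLeft (diag A)).toLinearMap.flip (cls (diag A).d (1 : A) A.d_one))
    (by
      constructor
      · rw [injective_iff_map_eq_zero]
        intro x hx
        obtain ⟨a, ha, rfl⟩ := hcls_surjective x
        have h := (A.hLeft_cls_one a ha).symm.trans hx
        exact Ideal.Quotient.eq_zero_iff_mem.2 ((cls_eq_zero_iff _).1 h)
      · intro x
        obtain ⟨a, ha, rfl⟩ := cls_surjective x
        exact ⟨A.hcls a ha, A.hLeft_cls_one a ha⟩)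

theorem DGAlgebra.hEquiv_apply (A : DGAlgebra k) (x : A.H) :
    A.hEquiv x = hLeft (diag A) x (cls (diag A).d (1 : A) A.d_one) := rfl

theorem DGAlgebra.hEquiv_hcls (A : DGAlgebra k) (a : A) (ha : A.d a = 0) :
    A.hEquiv (A.hcls a ha) = cls (diag A).d a ha := A.hLeft_cls_one a ha

/-! ### Homogeneous components and homotopies -/

section Homotopy

variable {V : Type*} [AddCommGroup V] [Module k V] {G : ℤ → Submodule k V}

/-- The projection to the homogeneous component of degree `i`. -/
def proj (h : DirectSum.IsInternal G) (i : ℤ) : V →ₗ[k] V := Finsupp.lapply i ∘ₗ components h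

theorem proj_of_mem (h : DirectSum.IsInternal G) {i : ℤ} {x : V} (hx : x ∈ G i) :
    proj h i x = x := by
  simp [proj, components_of_mem h hx]

theorem proj_of_mem_ne (h : DirectSum.IsInternal G) {i j : ℤ} (hij : i ≠ j) {x : V}
    (hx : x ∈ G i) : proj h j x = 0 := by
  simp [proj, components_of_mem h hx, Finsupp.single_eq_of_ne hij.symm]

theorem proj_mem (h : DirectSum.IsInternal G) (i : ℤ) (x : V) : proj h i x ∈ G i := by
  refine graded_induction h (p := fun x => proj h i x ∈ G i) (fun j x hx => ?_)
    (fun x y hx hy => by rw [map_add]; exact add_mem hx hy) x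
  by_cases hij : j = i
  · subst hij; rwa [proj_of_mem h hx]
  · rw [proj_of_mem_ne h hij hx]; exact zero_mem _

theorem sum_proj (h : DirectSum.IsInternal G) (x : V) :
    ∑ i ∈ (components h x).support, proj h i x = x := by
  have hs : ((components h x).sum fun _ v => v) = x := by
    refine graded_induction h (p := fun x => ((components h x).sum fun _ v => v) = x)
      (fun i x hx => by rw [components_of_mem h hx, Finsupp.sum_single_index rfl])
      (fun x y hx hy => by
        rw [map_add, Finsupp.sum_add_index (fun _ _ => rfl) (fun _ _ _ _ => rfl), hx, hy]) x
  exact hs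

theorem eq_zero_of_proj (h : DirectSum.IsInternal G) {x : V} (hx : ∀ i, proj h i x = 0) :
    x = 0 := by
  rw [← sum_proj h x]
  exact Finset.sum_eq_zero fun i _ => hx i

theorem proj_comm (h : DirectSum.IsInternal G) {d : V →ₗ[k] V}
    (hd : ∀ {i x}, x ∈ G i → d x ∈ G (i + 1)) (i : ℤ) (x : V) :
    proj h (i + 1) (d x) = d (proj h i x) := by
  refine graded_induction h (p := fun x => proj h (i + 1) (d x) = d (proj h i x))
    (fun j x hx => ?_) (fun x y hx hy => by simp only [map_add, hx, hy]) x
  by_cases hij : j = i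
  · subst hij; rw [proj_of_mem h hx, proj_of_mem h (hd hx)]
  · rw [proj_of_mem_ne h hij hx, proj_of_mem_ne h (fun e => hij (add_right_cancel e)) (hd hx),
      map_zero]

theorem exists_generalizedInverse (f : V →ₗ[k] V) :
    ∃ h : V →ₗ[k] V, f ∘ₗ h ∘ₗ f = f := by
  obtain ⟨r, hr⟩ := f.rangeRestrict.exists_rightInverse_of_surjective f.range_rangeRestrict
  obtain ⟨h, hh⟩ := LinearMap.exists_extend r
  refine ⟨h, LinearMap.ext fun x => ?_⟩
  have h1 : h (f x) = r ⟨f x, x, rfl⟩ := LinearMap.congr_fun hh ⟨f x, x, rfl⟩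
  rw [LinearMap.comp_apply, LinearMap.comp_apply, h1]
  exact congrArg Subtype.val (LinearMap.congr_fun hr ⟨f x, x, rfl⟩)

/-- A differential on a graded vector space has a generalized inverse of degree `-1`. -/
theorem exists_homotopy (h : DirectSum.IsInternal G) {d : V →ₗ[k] V}
    (hd : ∀ {i x}, x ∈ G i → d x ∈ G (i + 1)) :
    ∃ s : V →ₗ[k] V, (∀ x, d (s (d x)) = d x) ∧ (∀ i x, x ∈ G i → s x ∈ G (i - 1)) := by
  obtain ⟨s, hs⟩ := exists_generalizedInverse d
  have hsd : ∀ x, d (s (d x)) = d x := LinearMap.congr_fun hs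
  let t : V →ₗ[k] V := Finsupp.lsum k (fun i => proj h (i - 1) ∘ₗ s) ∘ₗ components h
  have ht : ∀ {i x}, x ∈ G i → t x = proj h (i - 1) (s x) := fun {i x} hx => by
    simp [t, components_of_mem h hx]
  refine ⟨t, fun x => ?_, fun i x hx => by rw [ht hx]; exact proj_mem h _ _⟩
  refine graded_induction h (p := fun x => d (t (d x)) = d x)
    (fun i x hx => ?_) (fun x y hx hy => by simp only [map_add, hx, hy]) x
  rw [ht (hd hx), ← proj_comm h hd, hsd, sub_add_cancel, proj_of_mem h (hd hx)]

end Homotopy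

/-! ### The Künneth formula -/

namespace DGBimod

variable {A B C : DGAlgebra k}

/-- The element `m ⊗ x` of `M ⊗_B K`. -/
def tm (M : DGBimod A B) (K : DGBimod B C) : M →ₗ[k] K →ₗ[k] M.tensor K :=
  (TensorProduct.mk k M K).compr₂ (tensorRel M K).mkQ

theorem tensor_hom_ext {M : DGBimod A B} {K : DGBimod B C} {W : Type*} [AddCommGroup W]
    [Module k W] {f g : M.tensor K →ₗ[k] W} (h : ∀ m x, f (tm M K m x) = g (tm M K m x)) :
    f = g :=
  Submodule.linearMap_qext _ (TensorProduct.ext' h)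

theorem tensor_induction {M : DGBimod A B} {K : DGBimod B C} {p : M.tensor K → Prop}
    (zero : p 0) (tmul : ∀ m x, p (tm M K m x)) (add : ∀ s t, p s → p t → p (s + t))
    (t : M.tensor K) : p t := by
  obtain ⟨t, rfl⟩ := Submodule.Quotient.mk_surjective _ t
  induction t using TensorProduct.induction_on with
  | zero => exact zero
  | tmul m x => exact tmul m x
  | add s t hs ht => exact add _ _ hs ht

theorem tm_balanced (M : DGBimod A B) (K : DGBimod B C) (m : M) (b : B) (x : K) :
    tm M K (M.right (.op b) m) x = tm M K m (K.left b x) :=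
  (Submodule.Quotient.eq _).2 (tensorRel_mem M K m b x)

theorem d_tm (M : DGBimod A B) (K : DGBimod B C) (m : M) (x : K) :
    (M.tensor K).d (tm M K m x) = tm M K (M.d m) x + tm M K (M.sgn m) (K.d x) := rfl

theorem left_tm (M : DGBimod A B) (K : DGBimod B C) (a : A) (m : M) (x : K) :
    (M.tensor K).left a (tm M K m x) = tm M K (M.left a m) x := rfl

theorem right_tm (M : DGBimod A B) (K : DGBimod B C) (c : Cᵐᵒᵖ) (m : M) (x : K) :
    (M.tensor K).right c (tm M K m x) = tm M K m (K.right c x) := rfl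

theorem tm_mem {M : DGBimod A B} {K : DGBimod B C} {i j : ℤ} {m : M} {x : K}
    (hm : m ∈ M.deg i) (hx : x ∈ K.deg j) : tm M K m x ∈ (M.tensor K).deg (i + j) :=
  ⟨m ⊗ₜ x, Submodule.subset_span ⟨i, j, rfl, m, hm, x, hx, rfl⟩, rfl⟩

/-- A linear map out of `M ⊗_B K`. -/
def tlift {M : DGBimod A B} {K : DGBimod B C} {W : Type*} [AddCommGroup W] [Module k W]
    (f : M →ₗ[k] K →ₗ[k] W) (hf : ∀ m b x, f (M.right (.op b) m) x = f m (K.left b x)) :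
    M.tensor K →ₗ[k] W :=
  (tensorRel M K).liftQ (TensorProduct.lift f) (by
    rw [← Submodule.comap_bot]
    exact tensorRel_le fun m b x => by simp [hf])

@[simp]
theorem tlift_tm {M : DGBimod A B} {K : DGBimod B C} {W : Type*} [AddCommGroup W] [Module k W]
    (f : M →ₗ[k] K →ₗ[k] W) (hf : ∀ m b x, f (M.right (.op b) m) x = f m (K.left b x))
    (m : M) (x : K) : tlift f hf (tm M K m x) = f m x := rfl

theorem right_base (M : DGBimod A (DGAlgebra.base k)) (c : DGAlgebra.base k) (m : M) :
    M.right (.op c) m = (show k from c) • m := by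
  have h : (MulOpposite.op c : (DGAlgebra.base k)ᵐᵒᵖ) =
      algebraMap k (DGAlgebra.base k)ᵐᵒᵖ (show k from c) := rfl
  rw [h, AlgHom.commutes, Module.algebraMap_end_apply]

theorem left_base (K : DGBimod (DGAlgebra.base k) C) (c : DGAlgebra.base k) (x : K) :
    K.left c x = (show k from c) • x := by
  have h : c = algebraMap k (DGAlgebra.base k) (show k from c) := rfl
  rw [h, AlgHom.commutes, Module.algebraMap_end_apply]
  rfl

theorem base_balanced {M : DGBimod A (DGAlgebra.base k)} {K : DGBimod (DGAlgebra.base k) C}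
    {W : Type*} [AddCommGroup W] [Module k W] (f : M →ₗ[k] K →ₗ[k] W) (m : M)
    (c : DGAlgebra.base k) (x : K) : f (M.right (.op c) m) x = f m (K.left c x) := by
  rw [right_base, left_base, map_smul, map_smul, LinearMap.smul_apply]

/-- The product `[m] ⊗ [x] ↦ [m ⊗ x]` of cohomology classes. -/
def cross (M : DGBimod A B) (K : DGBimod B C) :
    Cohomology M.d →ₗ[k] Cohomology K.d →ₗ[k] Cohomology (M.tensor K).d :=
  Submodule.liftQ _
    { toFun := fun z => cohMap (tm M K z)
        (fun x hx => by rw [d_tm, hx, show M.d z = 0 from z.2]; simp)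
        (fun x => ⟨tm M K (M.sgn z) x, by
          rw [d_tm, M.sgn_sgn, ← neg_eq_iff_eq_neg.2 (M.sgn_d z), show M.d z = 0 from z.2]; simp⟩)
      map_add' := fun z w => cohomology_hom_ext fun x hx => cls_congr _ (by simp; rfl)
      map_smul' := fun c z => cohomology_hom_ext fun x hx => cls_congr _ (by simp; rfl) }
    (by
      rintro ⟨_, hz⟩ ⟨y, rfl⟩
      refine cohomology_hom_ext fun x hx => ?_
      exact (cls_eq_zero_iff (d := (M.tensor K).d) _).2 ⟨tm M K y x, by rw [d_tm, hx]; simp⟩)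

theorem cross_cls (M : DGBimod A B) (K : DGBimod B C) (z : M) (hz : M.d z = 0) (x : K)
    (hx : K.d x = 0) : cross M K (cls M.d z hz) (cls K.d x hx) =
      cls (M.tensor K).d (tm M K z x) (by rw [d_tm, hx, hz]; simp) := rfl

/-- The Künneth formula over a field. A generalized inverse of each differential gives projections
`P` and `R`, homotopic to the identity, onto complements of the coboundaries in the cocycles, and
`P ⊗ R` is homotopic to the identity of `M ⊗ K`. -/
theorem bijective_lift_cross (M : DGBimod A (DGAlgebra.base k))
    (K : DGBimod (DGAlgebra.base k) C) :
    Function.Bijective (TensorProduct.lift (cross M K)) := by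
  obtain ⟨s, hs, hs'⟩ := exists_homotopy M.isInternal M.d_mem
  obtain ⟨r, hr, -⟩ := exists_homotopy K.isInternal K.d_mem
  let P : M →ₗ[k] M := LinearMap.id - M.d ∘ₗ s - s ∘ₗ M.d
  let R : K →ₗ[k] K := LinearMap.id - K.d ∘ₗ r - r ∘ₗ K.d
  have hP : ∀ x, P x = x - M.d (s x) - s (M.d x) := fun _ => rfl
  have hR : ∀ x, R x = x - K.d (r x) - r (K.d x) := fun _ => rfl
  have hdP : ∀ x, M.d (P x) = 0 := fun x => by simp [hP, M.d_d, hs]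
  have hdR : ∀ x, K.d (R x) = 0 := fun x => by simp [hR, K.d_d, hr]
  have hsgn : ∀ x, M.sgn (s x) = -s (M.sgn x) := fun x => by
    refine graded_induction M.isInternal (p := fun x => M.sgn (s x) = -s (M.sgn x))
      (fun i x hx => ?_) (fun x y hx hy => by simp only [map_add, hx, hy, neg_add]) x
    rw [M.sgn_of_mem hx, M.sgn_of_mem (hs' i x hx), units_smul_map, ← Units.neg_smul,
      Int.negOnePow_sub, Int.negOnePow_one, mul_neg_one]
  have hPsgn : ∀ x, M.sgn (P x) = P (M.sgn x) := fun x => by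
    simp only [hP, map_sub, sgn_d, hsgn, map_neg, neg_neg]
  have hPd : ∀ x, P (M.d x) = 0 := fun x => by simp [hP, M.d_d, hs]
  have hRd : ∀ x, R (K.d x) = 0 := fun x => by simp [hR, K.d_d, hr]
  let pm : M →ₗ[k] Cohomology M.d :=
    Submodule.mkQ _ ∘ₗ P.codRestrict (LinearMap.ker M.d) fun x => hdP x
  let pk : K →ₗ[k] Cohomology K.d :=
    Submodule.mkQ _ ∘ₗ R.codRestrict (LinearMap.ker K.d) fun x => hdR x
  have hpm : ∀ x, pm x = cls M.d (P x) (hdP x) := fun _ => rfl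
  have hpk : ∀ x, pk x = cls K.d (R x) (hdR x) := fun _ => rfl
  have hpm0 : ∀ x, pm (M.d x) = 0 := fun x => (cls_eq_zero_iff (hdP _)).2 ⟨0, by simp [hPd]⟩
  have hpk0 : ∀ x, pk (K.d x) = 0 := fun x => (cls_eq_zero_iff (hdR _)).2 ⟨0, by simp [hRd]⟩
  have hpmz : ∀ x (hx : M.d x = 0), pm x = cls M.d x hx := fun x hx =>
    (cls_eq_iff (hdP x) hx).2 ⟨-s x, by rw [hP, hx, map_zero, map_neg]; abel⟩
  have hpkz : ∀ x (hx : K.d x = 0), pk x = cls K.d x hx := fun x hx =>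
    (cls_eq_iff (hdR x) hx).2 ⟨-r x, by rw [hR, hx, map_zero, map_neg]; abel⟩
  let l : M.tensor K →ₗ[k] Cohomology M.d ⊗[k] Cohomology K.d :=
    tlift ((TensorProduct.mk k _ _).compl₁₂ pm pk) (base_balanced _)
  have hl : ∀ m x, l (tm M K m x) = pm m ⊗ₜ pk x := fun _ _ => rfl
  have hl0 : ∀ t, l ((M.tensor K).d t) = 0 := fun t => by
    induction t using tensor_induction with
    | zero => simp
    | tmul m x => rw [d_tm, map_add, hl, hl, hpm0, hpk0]; simp
    | add s t hs ht => simp only [map_add, hs, ht, add_zero]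
  let L : Cohomology (M.tensor K).d →ₗ[k] Cohomology M.d ⊗[k] Cohomology K.d :=
    Submodule.liftQ _ (l ∘ₗ Submodule.subtype _) (by rintro ⟨_, ht⟩ ⟨y, rfl⟩; exact hl0 y)
  have hL : ∀ t ht, L (cls _ t ht) = l t := fun _ _ => rfl
  -- the contracting homotopy for `1 - P ⊗ R`
  let S : M.tensor K →ₗ[k] M.tensor K :=
    tlift ((tm M K).compl₁₂ s LinearMap.id + (tm M K).compl₁₂ (P ∘ₗ M.sgn) r) (base_balanced _)
  have hS : ∀ m x, S (tm M K m x) = tm M K (s m) x + tm M K (P (M.sgn m)) (r x) :=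
    fun _ _ => rfl
  let PR : M.tensor K →ₗ[k] M.tensor K := tlift ((tm M K).compl₁₂ P R) (base_balanced _)
  have hPR : ∀ m x, PR (tm M K m x) = tm M K (P m) (R x) := fun _ _ => rfl
  have key : ∀ t, PR t = t - (M.tensor K).d (S t) - S ((M.tensor K).d t) := fun t => by
    induction t using tensor_induction with
    | zero => simp
    | tmul m x =>
      simp only [d_tm, hS, hPR, map_add, hdP, hPsgn, sgn_sgn, hsgn, sgn_d, hPd, map_neg,
        LinearMap.neg_apply, map_zero, LinearMap.zero_apply]
      rw [hR x, map_sub, map_sub, hP m]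
      simp only [map_sub, LinearMap.sub_apply]
      abel
    | add s t hs ht => simp only [map_add, hs, ht]; abel
  have hPRd : ∀ t, (M.tensor K).d (PR t) = 0 := fun t => by
    induction t using tensor_induction with
    | zero => simp
    | tmul m x => rw [hPR, d_tm, hdP, hdR]; simp
    | add s t hs ht => simp only [map_add, hs, ht, add_zero]
  have hcl : ∀ t, TensorProduct.lift (cross M K) (l t) = cls _ (PR t) (hPRd t) := fun t => by
    induction t using tensor_induction with
    | zero => rw [map_zero, map_zero]; exact ((cls_eq_zero_iff _).2 ⟨0, by simp⟩).symm
    | tmul m x => rfl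
    | add s t hs ht =>
      rw [map_add, map_add, hs, ht, ← cls_add]
      exact cls_congr _ (map_add _ _ _).symm
  refine Function.bijective_iff_has_inverse.2 ⟨L, fun t => ?_, fun t => ?_⟩
  · induction t using TensorProduct.induction_on with
    | zero => simp
    | tmul x y =>
      obtain ⟨x, hx, rfl⟩ := cls_surjective x
      obtain ⟨y, hy, rfl⟩ := cls_surjective y
      rw [TensorProduct.lift.tmul, cross_cls, hL, hl, hpmz x hx, hpkz y hy]
    | add s t hs ht => rw [map_add, map_add, hs, ht]
  · obtain ⟨t, ht, rfl⟩ := cls_surjective t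
    rw [hL, hcl, cls_eq_iff]
    exact ⟨-S t, by rw [key, ht, map_zero, map_neg]; abel⟩

/-- The Künneth isomorphism. -/
def kunneth (M : DGBimod A (DGAlgebra.base k)) (K : DGBimod (DGAlgebra.base k) C) :
    Cohomology M.d ⊗[k] Cohomology K.d ≃ₗ[k] Cohomology (M.tensor K).d :=
  LinearEquiv.ofBijective _ (bijective_lift_cross M K)

theorem hLeft_cross (M : DGBimod A B) (K : DGBimod B C) (a : A.H) (x : Cohomology M.d)
    (y : Cohomology K.d) :
    hLeft (M.tensor K) a (cross M K x y) = cross M K (hLeft M a x) y := by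
  obtain ⟨a, ha, rfl⟩ := DGAlgebra.hcls_surjective a
  obtain ⟨x, hx, rfl⟩ := cls_surjective x
  obtain ⟨y, hy, rfl⟩ := cls_surjective y
  rfl

theorem hRight_cross (M : DGBimod A B) (K : DGBimod B C) (c : C.H) (x : Cohomology M.d)
    (y : Cohomology K.d) :
    hRight (M.tensor K) c (cross M K x y) = cross M K x (hRight K c y) := by
  obtain ⟨c, hc, rfl⟩ := DGAlgebra.hcls_surjective c
  obtain ⟨x, hx, rfl⟩ := cls_surjective x
  obtain ⟨y, hy, rfl⟩ := cls_surjective y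
  rfl

end DGBimod

/-! ### Morphisms out of tensor products, and the external product of a sum of shifts -/

namespace DGBimod

variable {A B C : DGAlgebra k}

theorem tensor_deg_le {M : DGBimod A B} {K : DGBimod B C} {n : ℤ} {S : Submodule k (M.tensor K)}
    (h : ∀ i j m x, i + j = n → m ∈ M.deg i → x ∈ K.deg j → tm M K m x ∈ S) :
    (M.tensor K).deg n ≤ S := by
  refine Submodule.map_le_iff_le_comap.2 (Submodule.span_le.2 ?_)
  rintro _ ⟨i, j, hij, m, hm, x, hx, rfl⟩
  exact h i j m x hij hm hx

/-- A morphism out of `M ⊗_B K`. -/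
def homOfTensor {M : DGBimod A B} {K : DGBimod B C} {N : DGBimod A C} (f : M →ₗ[k] K →ₗ[k] N)
    (hf : ∀ m b x, f (M.right (.op b) m) x = f m (K.left b x))
    (left : ∀ a m x, f (M.left a m) x = N.left a (f m x))
    (right : ∀ c m x, f m (K.right c x) = N.right c (f m x))
    (deg : ∀ i j m x, m ∈ M.deg i → x ∈ K.deg j → f m x ∈ N.deg (i + j))
    (d : ∀ m x, f (M.d m) x + f (M.sgn m) (K.d x) = N.d (f m x)) : M.tensor K ⟶ N where
  toLin := tlift f hf
  map_left a t := by
    induction t using tensor_induction with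
    | zero => simp
    | tmul m x => rw [left_tm, tlift_tm, tlift_tm, left]
    | add s t hs ht => simp only [map_add, hs, ht]
  map_right c t := by
    induction t using tensor_induction with
    | zero => simp
    | tmul m x => rw [right_tm, tlift_tm, tlift_tm, right]
    | add s t hs ht => simp only [map_add, hs, ht]
  map_deg {i t} ht := by
    refine tensor_deg_le (S := (N.deg i).comap (tlift f hf)) ?_ ht
    rintro p q m x rfl hm hx
    exact deg p q m x hm hx
  map_d t := by
    induction t using tensor_induction with
    | zero => simp
    | tmul m x => rw [d_tm, map_add, tlift_tm, tlift_tm, tlift_tm, d]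
    | add s t hs ht => simp only [map_add, hs, ht]

theorem sgn_shift (M : DGBimod A B) (n : ℤ) (m : M) :
    (M.shift n).sgn m = (n.negOnePow • M.sgn m : M) := by
  refine graded_induction (M.shift n).isInternal
    (p := fun m => (M.shift n).sgn m = (n.negOnePow • M.sgn m : M)) (fun i x hx => ?_)
    (fun x y hx hy => ?_) m
  · have h : i.negOnePow = n.negOnePow * (i + n).negOnePow := by
      rw [← Int.negOnePow_add, eq_comm, Int.negOnePow_eq_iff,
        show n + (i + n) - i = 2 * n by ring]
      exact even_two_mul n
    have h' : ∀ y : M, y ∈ M.deg (i + n) → n.negOnePow • M.sgn y = i.negOnePow • y :=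
      fun y hy => by rw [M.sgn_of_mem hy, smul_smul, ← h]
    exact ((M.shift n).sgn_of_mem hx).trans (h' x hx).symm
  · refine (map_add (M.shift n).sgn x y).trans ?_
    rw [hx, hy]
    exact ((congrArg _ (map_add M.sgn x y)).trans (smul_add _ _ _)).symm

/-- The identification of `M[n] ⊗ G` with `(M ⊗ G)[n]`. -/
def shiftTensor (M : DGBimod A B) (G : DGBimod B C) (n : ℤ) :
    (M.shift n).tensor G ⟶ (M.tensor G).shift n :=
  homOfTensor (N := (M.tensor G).shift n) (tm M G) (tm_balanced M G) (fun _ _ _ => rfl)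
    (fun _ _ _ => rfl)
    (fun i j m x hm hx => by
      have h := tm_mem (M := M) (K := G) hm hx
      rwa [add_right_comm] at h)
    (fun m x => by
      have h : ∀ m : M, tm M G (n.negOnePow • M.d m) x + tm M G (n.negOnePow • M.sgn m) (G.d x) =
          n.negOnePow • (M.tensor G).d (tm M G m x) := fun m => by
        rw [d_tm, smul_add, units_smul_map, units_smul_map]
        rfl
      exact (congrArg (fun y : M => tm M G (n.negOnePow • M.d m) x + tm M G y (G.d x))
        (sgn_shift M n m)).trans (h m))

theorem bijective_shiftTensor (M : DGBimod A B) (G : DGBimod B C) (n : ℤ) :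
    Function.Bijective (lin (shiftTensor M G n)) := by
  let g : M.tensor G →ₗ[k] (M.shift n).tensor G :=
    tlift (tm (M.shift n) G) (tm_balanced (M.shift n) G)
  refine Function.bijective_iff_has_inverse.2 ⟨g, fun t => ?_, fun t => ?_⟩
  · induction t using tensor_induction with
    | zero => rfl
    | tmul m x => rfl
    | add s t hs ht =>
      exact (congrArg g (map_add (lin (shiftTensor M G n)) s t)).trans
        ((map_add g _ _).trans (congrArg₂ _ hs ht))
  · refine tensor_induction (M := M) (K := G)
      (p := fun t => lin (shiftTensor M G n) (g t) = t) rfl (fun _ _ => rfl) (fun s t hs ht => ?_) t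
    exact (congrArg _ (map_add g s t)).trans
      ((map_add (lin (shiftTensor M G n)) _ _).trans (congrArg₂ _ hs ht))

/-- The identification of `(M ⊕ N) ⊗ G` with `M ⊗ G ⊕ N ⊗ G`. -/
def sumTensor (M N : DGBimod A B) (G : DGBimod B C) :
    (M.sum N).tensor G ⟶ (M.tensor G).sum (N.tensor G) :=
  homOfTensor (N := (M.tensor G).sum (N.tensor G))
    (LinearMap.mk₂ k (fun m x => (tm M G m.1 x, tm N G m.2 x))
      (fun m m' x => Prod.ext ((tm M G).map_add₂ _ _ x) ((tm N G).map_add₂ _ _ x))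
      (fun c m x => Prod.ext ((tm M G).map_smul₂ c _ x) ((tm N G).map_smul₂ c _ x))
      (fun m x x' => Prod.ext (map_add (tm M G m.1) x x') (map_add (tm N G m.2) x x'))
      (fun c m x => Prod.ext (map_smul (tm M G m.1) c x) (map_smul (tm N G m.2) c x)))
    (fun m b x => Prod.ext (tm_balanced M G m.1 b x) (tm_balanced N G m.2 b x))
    (fun _ _ _ => rfl) (fun _ _ _ => rfl)
    (fun i j m x hm hx => ⟨tm_mem hm.1 hx, tm_mem hm.2 hx⟩)
    (fun m x => by
      have h : (M.sum N).sgn m = (M.sgn m.1, N.sgn m.2) := by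
        refine graded_induction (M.sum N).isInternal
          (p := fun m => (M.sum N).sgn m = (M.sgn m.1, N.sgn m.2)) (fun i m hm => ?_)
          (fun x y hx hy => ?_) m
        · rw [(M.sum N).sgn_of_mem hm, M.sgn_of_mem hm.1, N.sgn_of_mem hm.2]; rfl
        · rw [map_add, hx, hy]; exact Prod.ext (map_add M.sgn _ _).symm (map_add N.sgn _ _).symm
      rw [h]
      rfl)

theorem bijective_sumTensor (M N : DGBimod A B) (G : DGBimod B C) :
    Function.Bijective (lin (sumTensor M N G)) := by
  let g : M.tensor G →ₗ[k] (M.sum N).tensor G :=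
    tlift ((tm (M.sum N) G) ∘ₗ LinearMap.inl k M N) (fun m b x => by
      have := tm_balanced (M.sum N) G (m, 0) b x
      rw [show (M.sum N).right (.op b) (m, 0) = (M.right (.op b) m, 0) from
        Prod.ext rfl (map_zero (N.right (.op b)))] at this
      exact this)
  let g' : N.tensor G →ₗ[k] (M.sum N).tensor G :=
    tlift ((tm (M.sum N) G) ∘ₗ LinearMap.inr k M N) (fun m b x => by
      have := tm_balanced (M.sum N) G (0, m) b x
      rw [show (M.sum N).right (.op b) (0, m) = (0, N.right (.op b) m) from
        Prod.ext (map_zero (M.right (.op b))) rfl] at this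
      exact this)
  have hg : ∀ t, lin (sumTensor M N G) (g t) = (t, 0) := fun t => by
    induction t using tensor_induction with
    | zero => rw [map_zero, map_zero]; rfl
    | tmul m x =>
      exact Prod.ext rfl (show tm N G 0 x = 0 by rw [map_zero, LinearMap.zero_apply])
    | add s t hs ht => rw [map_add, map_add, hs, ht]; exact Prod.ext rfl (add_zero _)
  have hg' : ∀ t, lin (sumTensor M N G) (g' t) = (0, t) := fun t => by
    induction t using tensor_induction with
    | zero => rw [map_zero, map_zero]; rfl
    | tmul m x =>
      exact Prod.ext (show tm M G 0 x = 0 by rw [map_zero, LinearMap.zero_apply]) rfl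
    | add s t hs ht => rw [map_add, map_add, hs, ht]; exact Prod.ext (add_zero _) rfl
  refine Function.bijective_iff_has_inverse.2 ⟨fun t => g t.1 + g' t.2, fun t => ?_, fun t => ?_⟩
  · induction t using tensor_induction with
    | zero => rw [map_zero]; exact (congrArg₂ _ (map_zero g) (map_zero g')).trans (add_zero 0)
    | tmul m x =>
      exact ((tm (M.sum N) G).map_add₂ (m.1, 0) (0, m.2) x).symm.trans
        (congrArg (fun y => tm (M.sum N) G y x) (Prod.ext (add_zero m.1) (zero_add m.2)))
    | add s t hs ht =>
      rw [map_add]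
      refine Eq.trans ?_ (congrArg₂ _ hs ht)
      exact (congrArg₂ _ (map_add g _ _) (map_add g' _ _)).trans (add_add_add_comm _ _ _ _)
  · rw [map_add, hg, hg']
    exact Prod.ext (add_zero _) (zero_add _)

/-- The direct sum of two morphisms. -/
def sumMap {M N M' N' : DGBimod A B} (f : M ⟶ M') (g : N ⟶ N') : M.sum N ⟶ M'.sum N' where
  toLin := (lin f).prodMap (lin g)
  map_left a m := Prod.ext (lin_left f a m.1) (lin_left g a m.2)
  map_right b m := Prod.ext (lin_right f b m.1) (lin_right g b m.2)
  map_deg h := ⟨f.map_deg h.1, g.map_deg h.2⟩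
  map_d m := Prod.ext (lin_d f m.1) (lin_d g m.2)

/-- The external product with a finite sum of shifts is a finite sum of shifts. -/
theorem exists_sumShifts_tensor (F : DGBimod A B) (G : DGBimod B C) (l : List ℤ) :
    ∃ f : (F.sumShifts l).tensor G ⟶ (F.tensor G).sumShifts l, Function.Bijective (lin f) := by
  induction l with
  | nil =>
    refine ⟨homOfTensor (N := zero A C) 0 (fun _ _ _ => rfl) (fun _ _ _ => rfl) (fun _ _ _ => rfl)
      (fun _ _ _ _ _ _ => trivial) (fun _ _ => rfl), ?_, ?_⟩
    · intro s t _
      have h0 : ∀ t : (zero A B).tensor G, t = 0 := fun t => by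
        induction t using tensor_induction with
        | zero => rfl
        | tmul m x => rw [show m = 0 from rfl, map_zero, LinearMap.zero_apply]
        | add s t hs ht => rw [hs, ht, add_zero]
      exact (h0 s).trans (h0 t).symm
    · intro t; exact ⟨0, rfl⟩
  | cons n l ih =>
    obtain ⟨f, hf⟩ := ih
    refine ⟨sumTensor (F.shift n) (F.sumShifts l) G ≫ sumMap (shiftTensor F G n) f, ?_⟩
    exact (Function.Bijective.prodMap (bijective_shiftTensor F G n) hf).comp
      (bijective_sumTensor _ _ G)

theorem bijective_hmap {M N : DGBimod A B} {f : M ⟶ N} (h : Function.Bijective (lin f)) :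
    Function.Bijective (hmap f) := by
  refine ⟨(injective_iff_map_eq_zero _).2 fun x hx => ?_, fun y => ?_⟩
  · obtain ⟨z, hz, rfl⟩ := cls_surjective x
    obtain ⟨y, hy⟩ := (cls_eq_zero_iff (d := N.d) (z := lin f z) _).1 hx
    obtain ⟨y, rfl⟩ := h.2 y
    exact (cls_eq_zero_iff _).2 ⟨y, h.1 (by rw [lin_d, hy])⟩
  · obtain ⟨z, hz, rfl⟩ := cls_surjective y
    obtain ⟨z, rfl⟩ := h.2 z
    exact ⟨cls _ z (h.1 (by rw [lin_d, hz, map_zero])), rfl⟩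

/-! ### Cohomology as a functor on the derived category -/

/-- A functor that inverts `W` sends objects which become isomorphic in the localization to
isomorphic objects, by an isomorphism that commutes with all endomorphisms of the functor. -/
theorem exists_iso_of_localization {C D E : Type*} [Category* C] [Category* D] [Category* E]
    (L : C ⥤ D) (W : MorphismProperty C) [L.IsLocalization W] (F : C ⥤ E)
    (hF : W.IsInvertedBy F) {M N : C} (φ : L.obj M ≅ L.obj N) :
    ∃ e : F.obj M ≅ F.obj N, ∀ τ : F ⟶ F, e.hom ≫ τ.app N = τ.app M ≫ e.hom := by
  let F' := Localization.lift F hF L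
  let ι : L ⋙ F' ≅ F := Localization.Lifting.iso L W F F'
  refine ⟨(ι.app M).symm ≪≫ F'.mapIso φ ≪≫ ι.app N, fun τ => ?_⟩
  have h1 := (Localization.liftNatTrans L W F F F' F' τ).naturality φ.hom
  rw [Localization.liftNatTrans_app, Localization.liftNatTrans_app] at h1
  change (ι.inv.app M ≫ F'.map φ.hom ≫ ι.hom.app N) ≫ τ.app N =
    τ.app M ≫ (ι.inv.app M ≫ F'.map φ.hom ≫ ι.hom.app N)
  change F'.map φ.hom ≫ (ι.hom.app N ≫ τ.app N ≫ ι.inv.app N) =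
    (ι.hom.app M ≫ τ.app M ≫ ι.inv.app M) ≫ F'.map φ.hom at h1
  rw [← cancel_mono (ι.inv.app N)]
  simp only [Category.assoc, Iso.hom_inv_id_app, Functor.comp_obj, Category.comp_id] at h1 ⊢
  rw [h1, Iso.inv_hom_id_app_assoc]

/-- Cohomology as a functor. -/
def hFunctor (A B : DGAlgebra k) : DGBimod A B ⥤ ModuleCat.{u} k where
  obj M := ModuleCat.of k (Cohomology M.d)
  map f := ModuleCat.ofHom (hmap f)
  map_id M := by rw [hmap_id]; rfl
  map_comp f g := by rw [hmap_comp]; rfl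

theorem hFunctor_inverts (A B : DGAlgebra k) : (quasiIso A B).IsInvertedBy (hFunctor A B) :=
  fun _ _ f hf => (LinearEquiv.ofBijective (hmap f) hf).toModuleIso.isIso_hom

/-- Objects which are isomorphic in the derived category have isomorphic cohomology, as bimodules
over the cohomology algebras. -/
theorem DIso.exists_equiv {M N : DGBimod A B} (h : DIso M N) :
    ∃ e : Cohomology M.d ≃ₗ[k] Cohomology N.d, (∀ a x, e (hLeft M a x) = hLeft N a (e x)) ∧
      ∀ b x, e (hRight M b x) = hRight N b (e x) := by
  obtain ⟨φ⟩ := h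
  obtain ⟨e, key⟩ := exists_iso_of_localization (Q A B) (quasiIso A B) (hFunctor A B)
    (hFunctor_inverts A B) φ
  refine ⟨e.toLinearEquiv, fun a x => ?_, fun b x => ?_⟩
  · exact (LinearMap.congr_fun (congrArg ModuleCat.Hom.hom (key
      { app := fun M => ModuleCat.ofHom (hLeft M a)
        naturality := fun M N f => ModuleCat.hom_ext
          (LinearMap.ext fun x => (hmap_hLeft f a x).symm) })) x).symm
  · exact (LinearMap.congr_fun (congrArg ModuleCat.Hom.hom (key
      { app := fun M => ModuleCat.ofHom (hRight M b)
        naturality := fun M N f => ModuleCat.hom_ext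
          (LinearMap.ext fun x => (hmap_hRight f b x).symm) })) x).symm

end DGBimod

/-! ### Algebras which are retracts of an external product -/

/-- Data that exhibit the bimodule `R` over a `k`-algebra `R` as a retract of the bimodule `X ⊗ Y`,
for a left module `X` and a right module `Y`: the retraction is `r`, and `θ` is the image of `1`
under the section. -/
structure ExternalRetract (k : Type*) [Field k] (R X Y : Type*) [Ring R] [Algebra k R]
    [AddCommGroup X] [Module k X] [AddCommGroup Y] [Module k Y] where
  /-- the left action on `X` -/
  lam : R →ₐ[k] Module.End k X
  /-- the right action on `Y` -/
  rho : R →ₗ[k] Module.End k Y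
  /-- the image of `1` under the section -/
  θ : X ⊗[k] Y
  /-- the retraction -/
  r : X ⊗[k] Y →ₗ[k] R
  central : ∀ a, (lam a).rTensor Y θ = (rho a).lTensor X θ
  r_left : ∀ a t, r ((lam a).rTensor Y t) = a * r t
  r_right : ∀ a t, r ((rho a).lTensor X t) = r t * a
  r_θ : r θ = 1

/-- If the diagonal dimension vanishes, the cohomology algebra is a retract of an external
product. -/
theorem DGAlgebra.exists_externalRetract {A : DGAlgebra k} (hA : A.diagDim = 0) :
    ∃ (F : DGBimod A (base k)) (G : DGBimod (base k) A),
      Nonempty (ExternalRetract k A.H (Cohomology F.d) (Cohomology G.d)) := by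
  have h0 : ∃ (F : DGBimod A (base k)) (G : DGBimod (base k) A), angle (F.tensor G) 0 (diag A) := by
    by_contra hcon
    have : (1 : ℕ∞) ≤ A.diagDim := by
      refine le_iInf₂ fun n hn => ?_
      obtain ⟨F, G, -, -, h⟩ := hn
      rcases n with _ | n
      · exact absurd ⟨F, G, h⟩ hcon
      · exact_mod_cast Nat.succ_pos n
    rw [hA] at this
    exact absurd this (by simp)
  obtain ⟨F, G, X', l, h⟩ := h0
  obtain ⟨f, hf⟩ := exists_sumShifts_tensor F G l
  -- `e` identifies `H(A ⊕ X')` with the cohomology of a sum of shifts of `F ⊠ G`, and `E` identifies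
  -- it with `H(F') ⊗ H(G)`, where `F'` is the sum of the same shifts of `F`
  obtain ⟨e, he, he'⟩ := h.exists_equiv
  let g := LinearEquiv.ofBijective (hmap f) (bijective_hmap hf)
  let κ := kunneth (F.sumShifts l) G
  let E := e ≪≫ₗ (κ ≪≫ₗ g).symm
  let inl : diag A ⟶ (diag A).sum X' :=
    { toLin := LinearMap.inl k (diag A) X'
      map_left := fun a m => Prod.ext rfl (map_zero (X'.left a)).symm
      map_right := fun a m => Prod.ext rfl (map_zero (X'.right a)).symm
      map_deg := fun h => ⟨h, zero_mem _⟩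
      map_d := fun m => Prod.ext rfl (map_zero X'.d).symm }
  let fst : (diag A).sum X' ⟶ diag A :=
    { toLin := LinearMap.fst k (diag A) X'
      map_left := fun a m => rfl
      map_right := fun a m => rfl
      map_deg := fun h => h.1
      map_d := fun m => rfl }
  -- the image of the class of `1` is central, because left and right multiplication agree on it
  let one : Cohomology (diag A).d := cls (diag A).d (1 : A) A.d_one
  have hone : ∀ a, hLeft (diag A) a one = hRight (diag A) a one := fun a => by
    obtain ⟨a, ha, rfl⟩ := hcls_surjective a
    exact cls_congr _ ((mul_one a).trans (one_mul a).symm)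
  have hκl : ∀ a t, κ ((hLeft (F.sumShifts l) a).rTensor _ t) =
      hLeft ((F.sumShifts l).tensor G) a (κ t) := fun a t => by
    induction t using TensorProduct.induction_on with
    | zero => simp
    | tmul x y => exact (hLeft_cross _ _ a x y).symm
    | add s t hs ht => simp only [map_add, hs, ht]
  have hκr : ∀ a t, κ ((hRight G a).lTensor _ t) =
      hRight ((F.sumShifts l).tensor G) a (κ t) := fun a t => by
    induction t using TensorProduct.induction_on with
    | zero => simp
    | tmul x y => exact (hRight_cross _ _ a x y).symm
    | add s t hs ht => simp only [map_add, hs, ht]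
  have hEl : ∀ a t, E.symm ((hLeft (F.sumShifts l) a).rTensor _ t) =
      hLeft ((diag A).sum X') a (E.symm t) := fun a t => by
    refine e.symm_apply_eq.2 ?_
    rw [he]
    change hmap f (κ _) = hLeft ((F.tensor G).sumShifts l) a (e (e.symm (hmap f (κ t))))
    rw [e.apply_symm_apply, hκl, hmap_hLeft]
  have hEr : ∀ a t, E.symm ((hRight G a).lTensor _ t) =
      hRight ((diag A).sum X') a (E.symm t) := fun a t => by
    refine e.symm_apply_eq.2 ?_
    rw [he']
    change hmap f (κ _) = hRight ((F.tensor G).sumShifts l) a (e (e.symm (hmap f (κ t))))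
    rw [e.apply_symm_apply, hκr, hmap_hRight]
  have hHl : ∀ a x, A.hEquiv.symm (hLeft (diag A) a x) = a * A.hEquiv.symm x := fun a x => by
    rw [LinearEquiv.symm_apply_eq, A.hEquiv_apply, map_mul, Module.End.mul_apply,
      ← A.hEquiv_apply, A.hEquiv.apply_symm_apply]
  have hHr : ∀ a x, A.hEquiv.symm (hRight (diag A) a x) = A.hEquiv.symm x * a := fun a x => by
    obtain ⟨x, rfl⟩ := A.hEquiv.surjective x
    obtain ⟨x, hx, rfl⟩ := hcls_surjective x
    obtain ⟨a, ha, rfl⟩ := hcls_surjective a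
    rw [LinearEquiv.symm_apply_eq, A.hEquiv.symm_apply_apply, A.hEquiv_hcls]
    exact (A.hEquiv_hcls (x * a) (A.cocycles.mul_mem hx ha)).symm
  refine ⟨F.sumShifts l, G, ⟨{
    lam := hLeft _
    rho := hRight G
    θ := E (hmap inl one)
    r := A.hEquiv.symm.toLinearMap ∘ₗ hmap fst ∘ₗ E.symm.toLinearMap
    central := fun a => E.symm.injective ?_
    r_left := fun a t => ?_
    r_right := fun a t => ?_
    r_θ := ?_ }⟩⟩
  · rw [hEl, hEr, E.symm_apply_apply, ← hmap_hLeft, hone, hmap_hRight]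
  · change A.hEquiv.symm (hmap fst (E.symm _)) = a * A.hEquiv.symm (hmap fst (E.symm t))
    rw [hEl, hmap_hLeft, hHl]
  · change A.hEquiv.symm (hmap fst (E.symm _)) = A.hEquiv.symm (hmap fst (E.symm t)) * a
    rw [hEr, hmap_hRight, hHr]
  · change A.hEquiv.symm (hmap fst (E.symm (E (hmap inl one)))) = 1
    rw [E.symm_apply_apply, LinearEquiv.symm_apply_eq, A.hEquiv_apply, map_one]
    rfl

/-! ### Graded regular algebras and minimal full idempotents -/

/-- An algebra that is a retract of an external product is von Neumann regular: a generalized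
inverse of the action of `x` on `X` is transported to `R` by the retraction. -/
theorem ExternalRetract.regular {R X Y : Type*} [Ring R] [Algebra k R]
    [AddCommGroup X] [Module k X] [AddCommGroup Y] [Module k Y] (E : ExternalRetract k R X Y)
    (x : R) : ∃ y, x * y * x = x := by
  obtain ⟨h, hh⟩ := exists_generalizedInverse (E.lam x)
  refine ⟨E.r (h.rTensor Y E.θ), ?_⟩
  have hc : ∀ t, (E.rho x).lTensor X ((E.lam x).rTensor Y (h.rTensor Y t)) =
      (E.lam x).rTensor Y (h.rTensor Y ((E.rho x).lTensor X t)) := fun t => by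
    induction t using TensorProduct.induction_on with
    | zero => simp
    | tmul a b => rfl
    | add s t hs ht => simp only [map_add, hs, ht]
  rw [← E.r_left, ← E.r_right, hc, ← E.central, ← LinearMap.rTensor_comp_apply,
    ← LinearMap.rTensor_comp_apply, LinearMap.comp_assoc, hh, E.r_left, E.r_θ, mul_one]

section Regular

variable {R : Type*} [Ring R] [Algebra k R] {Γ : ℤ → Submodule k R}

/-- A grading of an algebra in which homogeneous elements have homogeneous quasi-inverses. -/
structure IsGradedRegular (Γ : ℤ → Submodule k R) : Prop where
  isInternal : DirectSum.IsInternal Γ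
  one_mem : (1 : R) ∈ Γ 0
  mul_mem : ∀ {i j x y}, x ∈ Γ i → y ∈ Γ j → x * y ∈ Γ (i + j)
  regular : ∀ {i x}, x ∈ Γ i → ∃ y ∈ Γ (-i), x * y * x = x

theorem proj_mul_mul (h : DirectSum.IsInternal Γ)
    (mul : ∀ {i j x y}, x ∈ Γ i → y ∈ Γ j → x * y ∈ Γ (i + j)) {i j l : ℤ} {x z : R}
    (hx : x ∈ Γ i) (hz : z ∈ Γ l) (y : R) :
    proj h (i + j + l) (x * y * z) = x * proj h j y * z := by
  refine graded_induction h (p := fun y => proj h (i + j + l) (x * y * z) = x * proj h j y * z)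
    (fun m y hy => ?_) (fun a b ha hb => by
      rw [mul_add, add_mul, map_add, ha, hb, map_add, mul_add, add_mul]) y
  by_cases hm : m = j
  · subst hm
    rw [proj_of_mem h hy, proj_of_mem h (mul (mul hx hy) hz)]
  · rw [proj_of_mem_ne h hm hy, mul_zero, zero_mul,
      proj_of_mem_ne h (fun e => hm (by linarith)) (mul (mul hx hy) hz)]

/-- A generalized inverse of a homogeneous element may be replaced by one of its homogeneous
components. -/
theorem isGradedRegular_of_regular (h : DirectSum.IsInternal Γ) (one : (1 : R) ∈ Γ 0)
    (mul : ∀ {i j x y}, x ∈ Γ i → y ∈ Γ j → x * y ∈ Γ (i + j))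
    (reg : ∀ x : R, ∃ y, x * y * x = x) : IsGradedRegular Γ where
  isInternal := h
  one_mem := one
  mul_mem := mul
  regular {i x} hx := by
    obtain ⟨y, hy⟩ := reg x
    refine ⟨proj h (-i) y, proj_mem h _ _, ?_⟩
    rw [← proj_mul_mul h mul hx hx y, hy, add_neg_cancel, zero_add, proj_of_mem h hx]

/-- The vector space `e R e`, for an idempotent `e`. -/
def cornerSpace (k : Type*) [Field k] {R : Type*} [Ring R] [Algebra k R] (e : R) :
    Submodule k R where
  carrier := {x | e * x = x ∧ x * e = x}
  add_mem' := fun ⟨h1, h2⟩ ⟨h3, h4⟩ => ⟨by rw [mul_add, h1, h3], by rw [add_mul, h2, h4]⟩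
  zero_mem' := ⟨mul_zero e, zero_mul e⟩
  smul_mem' c x := fun ⟨h1, h2⟩ => ⟨by rw [mul_smul_comm, h1], by rw [smul_mul_assoc, h2]⟩

theorem mul_mem_cornerSpace {e x y : R} (hx : x ∈ cornerSpace k e) (hy : y ∈ cornerSpace k e) :
    x * y ∈ cornerSpace k e :=
  ⟨by rw [← mul_assoc, hx.1], by rw [mul_assoc, hy.2]⟩

/-- An element is full if the two-sided ideal that it generates contains `1`. -/
def IsFull (e : R) : Prop := ∀ I : TwoSidedIdeal R, e ∈ I → 1 ∈ I

/-- A full idempotent of degree `0` for which the dimension of `e R e` is as small as possible. -/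
structure IsMinimalFull (Γ : ℤ → Submodule k R) (e : R) : Prop where
  idem : e * e = e
  mem : e ∈ Γ 0
  full : IsFull e
  le : ∀ f, f * f = f → f ∈ Γ 0 → IsFull f →
    Module.finrank k (cornerSpace k e) ≤ Module.finrank k (cornerSpace k f)

theorem exists_isMinimalFull (one : (1 : R) ∈ Γ 0) : ∃ e, IsMinimalFull Γ e := by
  let S : Set R := {e | e * e = e ∧ e ∈ Γ 0 ∧ IsFull e}
  have hS : S.Nonempty := ⟨1, mul_one 1, one, fun _ h => h⟩
  obtain ⟨he, he0, hef⟩ :=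
    Function.argminOn_mem (fun e : R => Module.finrank k (cornerSpace k e)) S hS
  exact ⟨_, he, he0, hef, fun f hf hf0 hff =>
    Function.argminOn_le (fun e : R => Module.finrank k (cornerSpace k e)) S ⟨hf, hf0, hff⟩⟩

variable {e : R}

/-- The corner of a minimal full idempotent contains no pair of orthogonal idempotents which are
equivalent: one of them could be removed. -/
theorem IsMinimalFull.eq_zero_of_orthogonal [Module.Finite k R] (he : IsMinimalFull Γ e)
    {p q x y : R} (hp : p ∈ cornerSpace k e) (hq : q ∈ cornerSpace k e) (hqm : q ∈ Γ 0)
    (hqq : q * q = q) (hpq : p * q = 0) (hxy : x * y = p)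
    (hyx : y * x = q) : q = 0 := by
  by_contra hq0
  have hidem : (e - q) * (e - q) = e - q := by
    rw [mul_sub, sub_mul, sub_mul, he.idem, hq.1, hq.2, hqq]; abel
  have hfull : IsFull (e - q) := fun I hI => he.full I (by
    have h1 : p ∈ I := by
      have : p = p * (e - q) := by rw [mul_sub, hp.2, hpq, sub_zero]
      rw [this]
      exact I.mul_mem_left _ _ hI
    have h2 : q ∈ I := by
      have : q = y * p * x := by rw [← hxy, ← hqq, ← hyx]; simp only [mul_assoc]
      rw [this]
      exact I.mul_mem_right _ _ (I.mul_mem_left _ _ h1)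
    simpa using I.add_mem hI h2)
  have hlt : cornerSpace k (e - q) < cornerSpace k e := by
    refine lt_of_le_of_ne (fun z hz => ?_) (fun h => hq0 ?_)
    · have h1 : e * (e - q) = e - q := by rw [mul_sub, he.idem, hq.1]
      have h2 : (e - q) * e = e - q := by rw [sub_mul, he.idem, hq.2]
      refine ⟨?_, ?_⟩
      · rw [← hz.1, ← mul_assoc, h1]
      · rw [← hz.2, mul_assoc, h2]
    · have : q ∈ cornerSpace k (e - q) := h ▸ hq
      rw [← this.1, sub_mul, hq.1, hqq, sub_self]
  exact absurd (he.le _ hidem (sub_mem he.mem hqm) hfull)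
    (not_le.2 (Submodule.finrank_lt_finrank_of_lt hlt))

/-- If `x = x y x` and `x² = 0`, then `q = y x` is an idempotent, equivalent to `x y`. After `x y`
has been made orthogonal to `q`, minimality gives `q = 0` and thus `x = x q = 0`. -/
theorem IsMinimalFull.eq_zero_of_sq [Module.Finite k R] (he : IsMinimalFull Γ e)
    (hΓ : IsGradedRegular Γ) {i : ℤ} {x : R} (hx : x ∈ cornerSpace k e) (hxi : x ∈ Γ i)
    (hxx : x * x = 0) : x = 0 := by
  obtain ⟨y, hy, hxyx⟩ := hΓ.regular hxi
  have hy' : e * y * e ∈ Γ (-i) := by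
    have := hΓ.mul_mem (hΓ.mul_mem he.mem hy) he.mem
    rwa [zero_add, add_zero] at this
  have hyc : e * y * e ∈ cornerSpace k e :=
    ⟨by rw [← mul_assoc, ← mul_assoc, he.idem], by rw [mul_assoc, he.idem]⟩
  have hx' : x * (e * y * e) * x = x := by
    have : x * (e * y * e) * x = x * e * y * (e * x) := by simp only [mul_assoc]
    rw [this, hx.1, hx.2, hxyx]
  generalize e * y * e = y at hy' hyc hx'
  have hq : y * x ∈ cornerSpace k e := mul_mem_cornerSpace hyc hx
  have hp : x * y ∈ cornerSpace k e := mul_mem_cornerSpace hx hyc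
  have hqp : y * x * (x * y) = 0 := by
    rw [mul_assoc, ← mul_assoc x x, hxx, zero_mul, mul_zero]
  have hqq : y * x * (y * x) = y * x := by rw [mul_assoc, ← mul_assoc x, hx']
  have hpp : x * y * (x * y) = x * y := by rw [← mul_assoc, hx']
  have hqm : y * x ∈ Γ 0 := by
    have := hΓ.mul_mem hy' hxi
    rwa [neg_add_cancel] at this
  generalize hpd : x * y = p at *
  generalize hqd : y * x = q at *
  have hxq : x * q = x := by rw [← hqd, ← mul_assoc, hpd, hx']
  -- `p - p q` is orthogonal to `q` and still equivalent to it
  have h1 : p * (p - p * q) = p - p * q := by rw [mul_sub, ← mul_assoc, hpp]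
  have h2 : (p - p * q) * p = p := by rw [sub_mul, mul_assoc, hqp, hpp, mul_zero, sub_zero]
  have h3 : (p - p * q) * (p - p * q) = p - p * q := by
    rw [mul_sub, ← mul_assoc, h2]
  have h4 : (p - p * q) * q = 0 := by rw [sub_mul, mul_assoc, hqq, sub_self]
  have h6 : (p - p * q) * x * (y * (p - p * q)) = p - p * q := by
    rw [mul_assoc, ← mul_assoc x, hpd, ← mul_assoc, h2, h1]
  have hqx : q * x = 0 := by rw [← hqd, mul_assoc, hxx, mul_zero]
  have h7 : y * (p - p * q) * ((p - p * q) * x) = q := by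
    rw [mul_assoc, ← mul_assoc (p - p * q), h3, sub_mul, mul_assoc p q, hqx, mul_zero, sub_zero,
      hx', hqd]
  have hq0 := he.eq_zero_of_orthogonal (sub_mem hp (mul_mem_cornerSpace hp hq)) hq hqm hqq h4
    h6 h7
  rw [← hxq, hq0, mul_zero]

theorem pow_mem_cornerSpace {x : R} (hx : x ∈ cornerSpace k e) (n : ℕ) :
    x ^ (n + 1) ∈ cornerSpace k e := by
  induction n with
  | zero => simpa using hx
  | succ n ih => rw [pow_succ]; exact mul_mem_cornerSpace ih hx

theorem IsGradedRegular.pow_mem (hΓ : IsGradedRegular Γ) {i : ℤ} {x : R} (hx : x ∈ Γ i) (n : ℕ) :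
    x ^ n ∈ Γ (n * i) := by
  induction n with
  | zero => simpa using hΓ.one_mem
  | succ n ih =>
    rw [pow_succ, Nat.cast_succ, add_mul, one_mul]
    exact hΓ.mul_mem ih hx

theorem IsMinimalFull.eq_zero_of_isNilpotent [Module.Finite k R] (he : IsMinimalFull Γ e)
    (hΓ : IsGradedRegular Γ) {i : ℤ} {x : R} (hx : x ∈ cornerSpace k e) (hxi : x ∈ Γ i)
    (hn : IsNilpotent x) : x = 0 := by
  obtain ⟨n, hn⟩ := hn
  have key : ∀ m : ℕ, ∀ i, ∀ x ∈ cornerSpace k e, x ∈ Γ i → x ^ 2 ^ m = 0 → x = 0 := by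
    intro m
    induction m with
    | zero => intro i x _ _ h; simpa using h
    | succ m ih =>
      intro i x hx hxi h
      rw [pow_succ', pow_mul] at h
      have := ih _ (x ^ 2) (pow_mem_cornerSpace hx 1) (hΓ.pow_mem hxi 2) h
      exact he.eq_zero_of_sq hΓ hx hxi (by rwa [← pow_two])
  exact key n i x hx hxi (pow_eq_zero_of_le Nat.lt_two_pow_self.le hn)

/-- The corner of a minimal full idempotent is concentrated in degree `0`, because homogeneous
elements of other degrees are nilpotent. -/
theorem IsMinimalFull.corner_le [Module.Finite k R] (he : IsMinimalFull Γ e)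
    (hΓ : IsGradedRegular Γ) : cornerSpace k e ≤ Γ 0 := by
  intro x hx
  have hp : ∀ i, proj hΓ.isInternal i x ∈ cornerSpace k e := fun i => by
    have h1 := proj_mul_mul hΓ.isInternal hΓ.mul_mem (j := i) he.mem hΓ.one_mem x
    have h2 := proj_mul_mul hΓ.isInternal hΓ.mul_mem (j := i) hΓ.one_mem he.mem x
    rw [add_zero, zero_add, mul_one, mul_one, hx.1] at h1
    rw [add_zero, zero_add, one_mul, one_mul, hx.2] at h2
    exact ⟨h1.symm, h2.symm⟩
  have h0 : x - proj hΓ.isInternal 0 x = 0 := by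
    refine eq_zero_of_proj hΓ.isInternal fun i => ?_
    rw [map_sub]
    by_cases hi : i = 0
    · subst hi
      rw [proj_of_mem _ (proj_mem hΓ.isInternal 0 x), sub_self]
    · rw [proj_of_mem_ne _ (Ne.symm hi) (proj_mem hΓ.isInternal 0 x), sub_zero]
      refine he.eq_zero_of_isNilpotent hΓ (hp i) (proj_mem _ _ _) ?_
      -- only finitely many of the degrees `n * i` occur
      have hfin : {j | Γ j ≠ ⊥}.Finite :=
        Submodule.finite_ne_bot_of_iSupIndep hΓ.isInternal.submodule_iSupIndep
      have hinj : Function.Injective fun n : ℕ => (n : ℤ) * i := fun a b hab => by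
        exact_mod_cast mul_right_cancel₀ hi hab
      obtain ⟨n, hn⟩ := (hfin.preimage hinj.injOn).exists_notMem
      have hb : Γ (n * i) = ⊥ := by simpa using hn
      refine ⟨n, ?_⟩
      have := hΓ.pow_mem (proj_mem hΓ.isInternal i x) n
      rwa [hb, Submodule.mem_bot] at this
  rw [sub_eq_zero.1 h0]
  exact proj_mem _ _ _

end Regular

/-! ### The corner as a product of division algebras, and its separability -/

section Corner

variable {R : Type u} [Ring R] [Algebra k R] {e : R}

theorem coe_mem_cornerSpace (he : IsIdempotentElem e) (x : he.Corner) :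
    (x.1 : R) ∈ cornerSpace k e := (Subsemigroup.mem_corner_iff he).1 x.2

instance cornerModule (he : IsIdempotentElem e) : Module k he.Corner where
  smul c x := ⟨c • x.1, (Subsemigroup.mem_corner_iff he).2
    ((cornerSpace k e).smul_mem c (coe_mem_cornerSpace he x))⟩
  one_smul x := Subtype.ext (one_smul k x.1)
  mul_smul a b x := Subtype.ext (mul_smul a b x.1)
  smul_zero a := Subtype.ext (smul_zero (A := R) a)
  smul_add a x y := Subtype.ext (smul_add a x.1 y.1)
  add_smul a b x := Subtype.ext (add_smul a b x.1)
  zero_smul x := Subtype.ext (zero_smul k x.1)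

/-- The corner `e R e` of a `k`-algebra is a `k`-algebra with unit `e`. -/
instance cornerAlgebra (he : IsIdempotentElem e) : Algebra k he.Corner :=
  Algebra.ofModule (fun c x y => Subtype.ext (smul_mul_assoc c x.1 y.1))
    (fun c x y => Subtype.ext (mul_smul_comm c x.1 y.1))

/-- The inclusion of a corner. -/
def cornerVal (he : IsIdempotentElem e) : he.Corner →ₗ[k] R where
  toFun x := x.1
  map_add' _ _ := rfl
  map_smul' _ _ := rfl

theorem cornerVal_injective (he : IsIdempotentElem e) :
    Function.Injective (cornerVal (k := k) he) := Subtype.val_injective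

/-- A finite-dimensional algebra without nilpotent elements is a product of division algebras. -/
theorem exists_algEquiv_pi_of_isReduced (S : Type u) [Ring S] [Algebra k S] [Module.Finite k S]
    (hS : ∀ x : S, IsNilpotent x → x = 0) :
    ∃ (s : ℕ) (D : Fin s → Type u) (_ : ∀ i, DivisionRing (D i)) (_ : ∀ i, Algebra k (D i)),
      (∀ i, Module.Finite k (D i)) ∧ Nonempty ((∀ i, D i) ≃ₐ[k] S) := by
  have : IsArtinianRing S := IsArtinianRing.of_finite k S
  have hss : IsSemisimpleRing S := by
    rw [IsArtinianRing.isSemisimpleRing_iff_jacobson, eq_bot_iff]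
    intro x hx
    obtain ⟨n, hn⟩ := IsSemiprimaryRing.isNilpotent (R := S)
    refine hS x ⟨n, ?_⟩
    have := Ideal.pow_mem_pow hx n
    rwa [hn] at this
  obtain ⟨s, D, d, _, _, hfin, hd, ⟨f⟩⟩ :=
    IsSemisimpleRing.exists_algEquiv_pi_matrix_divisionRing_finite k S
  -- a matrix algebra of size at least `2` contains a nilpotent matrix unit
  have hone : ∀ i, d i = 1 := fun i => by
    by_contra hne
    have h2 : 2 ≤ d i := by have := (hd i).out; omega
    let M : ∀ i, Matrix (Fin (d i)) (Fin (d i)) (D i) :=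
      Pi.single i (Matrix.single ⟨0, by omega⟩ ⟨1, by omega⟩ 1)
    have hM : M * M = 0 := by
      rw [← Pi.single_mul, Matrix.single_mul_single_of_ne _ _ _ _ (by simp), Pi.single_zero]
    have h0 := hS (f.symm M) ⟨2, by rw [pow_two, ← map_mul, hM, map_zero]⟩
    have h1 : M = 0 := f.symm.injective (by rw [h0, map_zero])
    have := congrFun (congrFun (congrFun h1 i) ⟨0, by omega⟩) ⟨1, by omega⟩
    simp [M] at this
  have hg : ∀ i, Nonempty (D i ≃ₐ[k] Matrix (Fin (d i)) (Fin (d i)) (D i)) := fun i => by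
    rw [hone i]
    refine ⟨.ofBijective (Matrix.scalarAlgHom (Fin 1) k) ⟨fun a b hab => ?_, fun M => ?_⟩⟩
    · have := congrFun (congrFun hab 0) 0
      simpa using this
    refine ⟨M 0 0, ?_⟩
    ext a b
    rw [Subsingleton.elim a 0, Subsingleton.elim b 0]
    simp
  exact ⟨s, D, inferInstance, inferInstance, hfin,
    ⟨(AlgEquiv.piCongrRight fun i => (hg i).some).trans f.symm⟩⟩

/-- A reduced corner of a finite-dimensional algebra is a product of division algebras. -/
theorem exists_divisionRings [Module.Finite k R] (he : e * e = e)
    (hred : ∀ x ∈ cornerSpace k e, IsNilpotent x → x = 0) :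
    ∃ (s : ℕ) (D : Fin s → Type u) (_ : ∀ i, DivisionRing (D i)) (_ : ∀ i, Algebra k (D i)),
      (∀ i, Module.Finite k (D i)) ∧ ∃ φ : (∀ i, D i) →ₗ[k] R, (∀ x y, φ (x * y) = φ x * φ y) ∧
        φ 1 = e ∧ Function.Injective φ ∧ LinearMap.range φ = cornerSpace k e := by
  have he' : IsIdempotentElem e := he
  have : Module.Finite k he'.Corner :=
    Module.Finite.of_injective (cornerVal (k := k) he') (cornerVal_injective he')
  obtain ⟨s, D, _, _, hfin, ⟨f⟩⟩ := exists_algEquiv_pi_of_isReduced (k := k) he'.Corner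
    (fun x ⟨n, hn⟩ => Subtype.ext (hred x.1 (coe_mem_cornerSpace he' x) ⟨n + 1, by
      have key : ∀ m : ℕ, (x ^ (m + 1)).1 = x.1 ^ (m + 1) := fun m => by
        induction m with
        | zero => simp
        | succ m ih =>
          rw [pow_succ, pow_succ x.1, ← ih]
          rfl
      rw [← key, pow_succ, hn, zero_mul]
      rfl⟩))
  refine ⟨s, D, inferInstance, inferInstance, hfin, cornerVal he' ∘ₗ f.toLinearMap,
    fun x y => ?_, ?_, ?_, ?_⟩
  · exact congrArg (cornerVal (k := k) he') (map_mul f x y)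
  · exact congrArg (cornerVal (k := k) he') (map_one f)
  · exact (cornerVal_injective (k := k) he').comp f.injective
  · ext x
    constructor
    · rintro ⟨y, rfl⟩
      exact coe_mem_cornerSpace he' (f y)
    · intro hx
      refine ⟨f.symm ⟨x, (Subsemigroup.mem_corner_iff he').2 hx⟩, ?_⟩
      exact congrArg (cornerVal (k := k) he') (f.apply_symm_apply _)

end Corner

/-- A representation of a semisimple algebra `B` is projective: the action `B ⊗ V → V` has an
equivariant section. -/
theorem exists_section_of_isSemisimpleRing {B V : Type*} [Ring B] [Algebra k B]
    [IsSemisimpleRing B] [AddCommGroup V] [Module k V] (f : B →ₐ[k] Module.End k V) :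
    ∃ σ : V →ₗ[k] B ⊗[k] V,
      (∀ b v, σ (f b v) = (LinearMap.mulLeft k b).rTensor V (σ v)) ∧
        ∀ v, TensorProduct.lift f.toLinearMap (σ v) = v := by
  let _ : Module B V := Module.compHom V f.toRingHom
  have hsm : ∀ (b : B) (v : V), b • v = f b v := fun _ _ => rfl
  have : IsScalarTower k B V := ⟨fun c b v => by rw [hsm, hsm, map_smul, LinearMap.smul_apply]⟩
  have := Module.projective_of_isSemisimpleRing B V
  let a : B ⊗[k] V →ₗ[B] V :=
    { TensorProduct.lift f.toLinearMap with
      map_smul' := fun b t => by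
        change TensorProduct.lift f.toLinearMap (b • t) = b • TensorProduct.lift f.toLinearMap t
        induction t using TensorProduct.induction_on with
        | zero => simp
        | tmul x v => simp [TensorProduct.smul_tmul', hsm]
        | add s t hs ht => rw [smul_add, map_add, hs, ht, map_add, smul_add] }
  have ha : Function.Surjective a := fun v => ⟨1 ⊗ₜ v, by
    change TensorProduct.lift f.toLinearMap (1 ⊗ₜ v) = v
    simp⟩
  obtain ⟨σ, hσ⟩ := Module.projective_lifting_property a LinearMap.id ha
  refine ⟨σ.restrictScalars k, fun b v => ?_, fun v => LinearMap.congr_fun hσ v⟩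
  change σ (b • v) = _
  rw [map_smul]
  change b • σ v = (LinearMap.mulLeft k b).rTensor V (σ v)
  induction σ v using TensorProduct.induction_on with
  | zero => simp
  | tmul x w => rw [TensorProduct.smul_tmul', LinearMap.rTensor_tmul]; rfl
  | add s t hs ht => rw [smul_add, map_add, hs, ht]

/-- A finite family `p_j ⊗ q_j` whose sum in `B ⊗ B` is a separability idempotent. -/
structure IsSeparabilityFamily (k : Type*) [Field k] {B ι : Type*} [Ring B] [Algebra k B]
    [Fintype ι] (p q : ι → B) : Prop where
  sum_mul : ∑ j, p j * q j = 1
  central : ∀ b, ∑ j, (b * p j) ⊗ₜ[k] q j = ∑ j, p j ⊗ₜ[k] (q j * b)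

/-- A semisimple corner `B = e R e` of an algebra `R` which is a retract of `X ⊗ Y` is separable: an
equivariant section of the action `B ⊗ e X → e X` induces a bimodule map from `e X ⊗ Y` to `B ⊗ B`,
and the image of the central element of `e X ⊗ Y` given by the retract is a separability element. -/
theorem ExternalRetract.exists_isSeparabilityFamily {R X Y B : Type*} [Ring R] [Algebra k R]
    [AddCommGroup X] [Module k X] [AddCommGroup Y] [Module k Y] (E : ExternalRetract k R X Y)
    [Ring B] [Algebra k B] [IsSemisimpleRing B] (φ : B →ₗ[k] R)
    (hmul : ∀ x y, φ (x * y) = φ x * φ y) (hinj : Function.Injective φ)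
    (hrange : LinearMap.range φ = cornerSpace k (φ 1)) :
    ∃ S : Finset (B × B), IsSeparabilityFamily k (fun j : S => j.1.1) (fun j : S => j.1.2) := by
  have hone : ∀ b, φ 1 * φ b = φ b := fun b => by rw [← hmul, one_mul]
  have hone' : ∀ b, φ b * φ 1 = φ b := fun b => by rw [← hmul, mul_one]
  let V := LinearMap.range (E.lam (φ 1))
  let c : X →ₗ[k] V := (E.lam (φ 1)).rangeRestrict
  have hV : ∀ b (v : X), E.lam (φ b) v ∈ V := fun b v =>
    ⟨E.lam (φ b) v, by rw [← Module.End.mul_apply, ← map_mul, hone]⟩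
  let f : B →ₐ[k] Module.End k V := AlgHom.ofLinearMap
    { toFun := fun b => (E.lam (φ b)).restrict fun v _ => hV b v
      map_add' := fun a b => LinearMap.ext fun v => Subtype.ext (by simp)
      map_smul' := fun a b => LinearMap.ext fun v => Subtype.ext (by simp) }
    (LinearMap.ext fun ⟨_, v, hv⟩ => Subtype.ext (by
      subst hv
      change E.lam (φ 1) (E.lam (φ 1) v) = E.lam (φ 1) v
      rw [← Module.End.mul_apply, ← map_mul, hone]))
    (fun a b => LinearMap.ext fun v => Subtype.ext (by
      change E.lam (φ (a * b)) v = E.lam (φ a) (E.lam (φ b) v)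
      rw [hmul, map_mul, Module.End.mul_apply]))
  have hf : ∀ b v, (f b v : X) = E.lam (φ b) v := fun _ _ => rfl
  have hfc : ∀ b x, f b (c x) = c (E.lam (φ b) x) := fun b x => Subtype.ext (by
    change E.lam (φ b) (E.lam (φ 1) x) = E.lam (φ 1) (E.lam (φ b) x)
    rw [← Module.End.mul_apply, ← map_mul, ← Module.End.mul_apply, ← map_mul E.lam, hone, hone'])
  obtain ⟨σ, hσ, hσ'⟩ := exists_section_of_isSemisimpleRing f
  obtain ⟨ψ, hψ⟩ := φ.exists_leftInverse_of_injective (LinearMap.ker_eq_bot.2 hinj)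
  have hψφ : ∀ z ∈ cornerSpace k (φ 1), φ (ψ z) = z := fun z hz => by
    rw [← hrange] at hz
    obtain ⟨b, rfl⟩ := hz
    rw [← LinearMap.comp_apply ψ, hψ, LinearMap.id_apply]
  let rV : V ⊗[k] Y →ₗ[k] R := E.r ∘ₗ V.subtype.rTensor Y
  have hrV : ∀ b t, rV ((f b).rTensor Y t) = φ b * rV t := fun b t => by
    change E.r _ = φ b * E.r _
    rw [← E.r_left, ← LinearMap.rTensor_comp_apply, ← LinearMap.rTensor_comp_apply]
    rfl
  have hrV1 : ∀ t, φ 1 * rV t = rV t := fun t => by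
    rw [← hrV, map_one]; exact congrArg rV (LinearMap.congr_fun (LinearMap.rTensor_id Y V) t)
  have hrV' : ∀ b t, rV ((E.rho (φ b)).lTensor V t) = rV t * φ b := fun b t => by
    change E.r _ = E.r _ * φ b
    rw [← E.r_right]
    congr 1
    induction t using TensorProduct.induction_on with
    | zero => simp
    | tmul v y => rfl
    | add s t hs ht => simp only [map_add, hs, ht]
  let g : V ⊗[k] Y →ₗ[k] B := ψ ∘ₗ LinearMap.mulRight k (φ 1) ∘ₗ rV
  have hg : ∀ t, φ (g t) = rV t * φ 1 := fun t =>
    hψφ (rV t * φ 1) ⟨by rw [← mul_assoc, hrV1], by rw [mul_assoc, hone]⟩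
  have hgl : ∀ b t, g ((f b).rTensor Y t) = b * g t := fun b t => hinj (by
    rw [hg, hmul, hg, hrV, mul_assoc])
  have hgr : ∀ b t, g ((E.rho (φ b)).lTensor V t) = g t * b := fun b t => hinj (by
    rw [hg, hmul, hg, hrV', mul_assoc, mul_assoc, hone, hone'])
  let T : V ⊗[k] Y →ₗ[k] B ⊗[k] B :=
    g.lTensor B ∘ₗ (TensorProduct.assoc k B V Y).toLinearMap ∘ₗ σ.rTensor Y
  have hTl : ∀ b t, T ((f b).rTensor Y t) = (LinearMap.mulLeft k b).rTensor B (T t) := fun b t => by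
    induction t using TensorProduct.induction_on with
    | zero => simp
    | tmul v y =>
      change g.lTensor B (TensorProduct.assoc k B V Y (σ (f b v) ⊗ₜ y)) =
        (LinearMap.mulLeft k b).rTensor B (g.lTensor B (TensorProduct.assoc k B V Y (σ v ⊗ₜ y)))
      rw [hσ]
      induction σ v using TensorProduct.induction_on with
      | zero => simp
      | tmul x w => simp
      | add s t hs ht => simp only [map_add, TensorProduct.add_tmul, hs, ht]
    | add s t hs ht => simp only [map_add, hs, ht]
  have hTr : ∀ b t, T ((E.rho (φ b)).lTensor V t) =
      (LinearMap.mulRight k b).lTensor B (T t) := fun b t => by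
    induction t using TensorProduct.induction_on with
    | zero => simp
    | tmul v y =>
      change g.lTensor B (TensorProduct.assoc k B V Y (σ v ⊗ₜ E.rho (φ b) y)) =
        (LinearMap.mulRight k b).lTensor B (g.lTensor B (TensorProduct.assoc k B V Y (σ v ⊗ₜ y)))
      induction σ v using TensorProduct.induction_on with
      | zero => simp
      | tmul x w =>
        have := hgr b (w ⊗ₜ y)
        rw [LinearMap.lTensor_tmul] at this
        simp [this]
      | add s t hs ht => simp only [map_add, TensorProduct.add_tmul, hs, ht]
    | add s t hs ht => simp only [map_add, hs, ht]
  have hTm : ∀ t, LinearMap.mul' k B (T t) = g t := fun t => by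
    induction t using TensorProduct.induction_on with
    | zero => simp
    | tmul v y =>
      change LinearMap.mul' k B (g.lTensor B (TensorProduct.assoc k B V Y (σ v ⊗ₜ y))) = _
      conv_rhs => rw [← hσ' v]
      induction σ v using TensorProduct.induction_on with
      | zero => simp
      | tmul x w =>
        have := hgl x (w ⊗ₜ y)
        rw [LinearMap.rTensor_tmul] at this
        simp [this]
      | add s t hs ht => simp only [map_add, TensorProduct.add_tmul, hs, ht]
    | add s t hs ht => simp only [map_add, hs, ht]
  let θ := c.rTensor Y E.θ
  have hθ : ∀ b, (f b).rTensor Y θ = (E.rho (φ b)).lTensor V θ := fun b => by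
    have h1 : (f b).rTensor Y θ = c.rTensor Y ((E.lam (φ b)).rTensor Y E.θ) := by
      rw [← LinearMap.rTensor_comp_apply, ← LinearMap.rTensor_comp_apply]
      congr 2
      exact LinearMap.ext fun x => hfc b x
    rw [h1, E.central, ← LinearMap.comp_apply, LinearMap.rTensor_comp_lTensor,
      ← LinearMap.lTensor_comp_rTensor, LinearMap.comp_apply]
  have hmθ : g θ = 1 := hinj (by
    rw [hg]
    have : rV θ = φ 1 := by
      change E.r (V.subtype.rTensor Y (c.rTensor Y E.θ)) = φ 1
      rw [← LinearMap.rTensor_comp_apply]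
      change E.r ((E.lam (φ 1)).rTensor Y E.θ) = φ 1
      rw [E.r_left, E.r_θ, mul_one]
    rw [this, hone])
  obtain ⟨S, hS⟩ := TensorProduct.exists_finset (T θ)
  have hS' : T θ = ∑ j : S, j.1.1 ⊗ₜ[k] j.1.2 := by rw [hS, ← Finset.sum_coe_sort]
  refine ⟨S, ?_, fun b => ?_⟩
  · rw [← hmθ, ← hTm, hS']; simp
  · have := (hTl b θ).symm.trans ((congrArg T (hθ b)).trans (hTr b θ))
    rw [hS'] at this
    simpa using this

/-! ### The colimit of the iterates of an endomorphism -/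

namespace DGBimod

variable {A B C : DGAlgebra k}

theorem pow_comm_apply {V W : Type*} [AddCommGroup V] [Module k V] [AddCommGroup W] [Module k W]
    {f : V →ₗ[k] V} {g : W →ₗ[k] W} {h : V →ₗ[k] W} (hc : ∀ x, h (f x) = g (h x)) (n : ℕ) (x : V) :
    h ((f ^ n) x) = (g ^ n) (h x) := by
  induction n generalizing x with
  | zero => rfl
  | succ n ih => rw [pow_succ, pow_succ, Module.End.mul_apply, Module.End.mul_apply, ih, hc]

/-- The transition maps of the sequence `V → V → ⋯` all of whose maps are `f`. -/
abbrev iterSys {V : Type*} [AddCommGroup V] [Module k V] (f : V →ₗ[k] V) :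
    ∀ i j : ℕ, i ≤ j → V →ₗ[k] V := fun i j _ => f ^ (j - i)

instance directedSystem_iterSys {V : Type*} [AddCommGroup V] [Module k V] (f : V →ₗ[k] V) :
    DirectedSystem (fun _ : ℕ => V) (iterSys f · · ·) where
  map_self i x := by simp [iterSys]
  map_map i j l hij hjl x := by
    rw [← Module.End.mul_apply, ← pow_add]
    congr 2
    omega

/-- The colimit of the sequence `V → V → ⋯` all of whose maps are `f`. -/
abbrev Iter {V : Type u} [AddCommGroup V] [Module k V] (f : V →ₗ[k] V) : Type u :=
  Module.DirectLimit (fun _ : ℕ => V) (iterSys f)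

section Iter

variable {V W X : Type u} [AddCommGroup V] [Module k V] [AddCommGroup W] [Module k W]
  [AddCommGroup X] [Module k X] {f : V →ₗ[k] V} {g : W →ₗ[k] W}

/-- The map from the `n`-th copy of `V` to the colimit. -/
def iterOf (f : V →ₗ[k] V) (n : ℕ) : V →ₗ[k] Iter f :=
  Module.DirectLimit.of k ℕ (fun _ => V) (iterSys f) n

theorem iterOf_pow (n m : ℕ) (x : V) : iterOf f (n + m) ((f ^ m) x) = iterOf f n x := by
  have := Module.DirectLimit.of_f (R := k) (f := iterSys f) (hij := Nat.le_add_right n m) (x := x)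
  rwa [iterSys, Nat.add_sub_cancel_left] at this

theorem iterOf_succ (n : ℕ) (x : V) : iterOf f (n + 1) (f x) = iterOf f n x := by
  simpa using iterOf_pow (f := f) n 1 x

theorem exists_iterOf (x : Iter f) : ∃ n v, iterOf f n v = x := Module.DirectLimit.exists_of x

theorem exists_pow_eq_zero {n : ℕ} {x : V} (h : iterOf f n x = 0) : ∃ m, (f ^ m) x = 0 := by
  obtain ⟨j, hj, h⟩ := Module.DirectLimit.of.zero_exact h
  exact ⟨j - n, h⟩

/-- Maps out of the colimit. -/
def iterDesc (φ : ℕ → V →ₗ[k] X) (hφ : ∀ n x, φ (n + 1) (f x) = φ n x) : Iter f →ₗ[k] X :=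
  Module.DirectLimit.lift k ℕ _ _ φ (fun i j hij x => by
    induction j, hij using Nat.le_induction with
    | base => simp [iterSys]
    | succ j hij ih => rw [← ih, iterSys, Nat.succ_sub hij, pow_succ', Module.End.mul_apply, hφ])

@[simp]
theorem iterDesc_of (φ : ℕ → V →ₗ[k] X) (hφ : ∀ n x, φ (n + 1) (f x) = φ n x) (n : ℕ) (x : V) :
    iterDesc φ hφ (iterOf f n x) = φ n x := Module.DirectLimit.lift_of _ _ _

theorem iter_hom_ext {φ ψ : Iter f →ₗ[k] X} (h : ∀ n x, φ (iterOf f n x) = ψ (iterOf f n x)) :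
    φ = ψ := Module.DirectLimit.hom_ext fun n => LinearMap.ext fun x => h n x

/-- The map induced on colimits by a map that commutes with the transition maps. -/
def iterMap (h : V →ₗ[k] W) (hc : ∀ x, h (f x) = g (h x)) : Iter f →ₗ[k] Iter g :=
  iterDesc (fun n => iterOf g n ∘ₗ h) fun n x => by
    rw [LinearMap.comp_apply, hc, iterOf_succ, LinearMap.comp_apply]

@[simp]
theorem iterMap_of (h : V →ₗ[k] W) (hc : ∀ x, h (f x) = g (h x)) (n : ℕ) (x : V) :
    iterMap h hc (iterOf f n x) = iterOf g n (h x) := iterDesc_of _ _ _ _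

end Iter

theorem pow_lin_mem {P : DGBimod A B} (ε : P ⟶ P) {i : ℤ} {p : P} (hp : p ∈ P.deg i) (n : ℕ) :
    (lin ε ^ n) p ∈ P.deg i := by
  induction n with
  | zero => exact hp
  | succ n ih => rw [pow_succ', Module.End.mul_apply]; exact ε.map_deg ih

/-- The homogeneous components of the colimit of the iterates of `ε`. -/
def teleDeg {P : DGBimod A B} (ε : P ⟶ P) (i : ℤ) : Submodule k (Iter (lin ε)) where
  carrier := {x | ∃ n, ∃ p ∈ P.deg i, iterOf (lin ε) n p = x}
  add_mem' := by
    rintro _ _ ⟨n, p, hp, rfl⟩ ⟨m, q, hq, rfl⟩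
    refine ⟨n + m, (lin ε ^ m) p + (lin ε ^ n) q,
      add_mem (pow_lin_mem ε hp m) (pow_lin_mem ε hq n), ?_⟩
    rw [map_add, iterOf_pow, add_comm n m, iterOf_pow]
  zero_mem' := ⟨0, 0, zero_mem _, map_zero _⟩
  smul_mem' c := by
    rintro _ ⟨n, p, hp, rfl⟩
    exact ⟨n, c • p, Submodule.smul_mem _ c hp, map_smul _ c p⟩

theorem tele_isInternal {P : DGBimod A B} (ε : P ⟶ P) : DirectSum.IsInternal (teleDeg ε) := by
  refine isInternal_of_components
    (iterDesc (fun n => Finsupp.mapRange.linearMap (iterOf (lin ε) n) ∘ₗ components P.isInternal)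
      fun n x => ?_) ?_ ?_
  · refine graded_induction P.isInternal (p := fun x => (Finsupp.mapRange.linearMap
      (iterOf (lin ε) (n + 1)) ∘ₗ components P.isInternal) (lin ε x) = (Finsupp.mapRange.linearMap
      (iterOf (lin ε) n) ∘ₗ components P.isInternal) x) (fun i x hx => ?_)
      (fun x y hx hy => by simp only [map_add, hx, hy]) x
    have hx' : components P.isInternal (lin ε x) = Finsupp.single i (lin ε x) :=
      components_of_mem _ (ε.map_deg hx)
    rw [LinearMap.comp_apply, LinearMap.comp_apply, components_of_mem _ hx, hx',
      Finsupp.mapRange.linearMap_apply, Finsupp.mapRange.linearMap_apply,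
      Finsupp.mapRange_single, Finsupp.mapRange_single]
    exact congrArg _ (iterOf_succ n x)
  · rintro i _ ⟨n, p, hp, rfl⟩
    rw [iterDesc_of, LinearMap.comp_apply, components_of_mem _ hp,
      Finsupp.mapRange.linearMap_apply, Finsupp.mapRange_single]
  · rw [eq_top_iff]
    rintro x -
    obtain ⟨n, p, rfl⟩ := exists_iterOf x
    refine graded_induction P.isInternal (p := fun p => iterOf (lin ε) n p ∈ ⨆ i, teleDeg ε i)
      (fun i p hp => Submodule.mem_iSup_of_mem i ⟨n, p, hp, rfl⟩)
      (fun x y hx hy => by rw [map_add]; exact add_mem hx hy) p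

/-- The left action on the colimit of the iterates of `ε`. -/
def teleLeft {P : DGBimod A B} (ε : P ⟶ P) : A →ₐ[k] Module.End k (Iter (lin ε)) where
  toFun a := iterMap (P.left a) fun x => (lin_left ε a x).symm
  map_one' := iter_hom_ext fun n x => by simp
  map_mul' a b := iter_hom_ext fun n x => by simp
  map_zero' := iter_hom_ext fun n x => by simp
  map_add' a b := iter_hom_ext fun n x => by simp
  commutes' r := iter_hom_ext fun n x => by simp [Algebra.algebraMap_eq_smul_one]

/-- The right action on the colimit of the iterates of `ε`. -/
def teleRight {P : DGBimod A B} (ε : P ⟶ P) : Bᵐᵒᵖ →ₐ[k] Module.End k (Iter (lin ε)) where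
  toFun b := iterMap (P.right b) fun x => (lin_right ε b x).symm
  map_one' := iter_hom_ext fun n x => by simp
  map_mul' a b := iter_hom_ext fun n x => by simp
  map_zero' := iter_hom_ext fun n x => by simp
  map_add' a b := iter_hom_ext fun n x => by simp
  commutes' r := iter_hom_ext fun n x => by simp [Algebra.algebraMap_eq_smul_one]

/-- The differential of the colimit of the iterates of `ε`. -/
def teleD {P : DGBimod A B} (ε : P ⟶ P) : Iter (lin ε) →ₗ[k] Iter (lin ε) :=
  iterMap P.d fun x => (lin_d ε x).symm

section

variable {P : DGBimod A B} (ε : P ⟶ P) (n : ℕ) (p : P)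

theorem teleLeft_of (a : A) :
    teleLeft ε a (iterOf (lin ε) n p) = iterOf (lin ε) n (P.left a p) :=
  iterMap_of (P.left a) (fun x => (lin_left ε a x).symm) n p

theorem teleRight_of (b : Bᵐᵒᵖ) :
    teleRight ε b (iterOf (lin ε) n p) = iterOf (lin ε) n (P.right b p) :=
  iterMap_of (P.right b) (fun x => (lin_right ε b x).symm) n p

theorem teleD_of : teleD ε (iterOf (lin ε) n p) = iterOf (lin ε) n (P.d p) := iterMap_of _ _ _ _

end

/-- The colimit of the sequence `P → P → ⋯` all of whose maps are `ε`. If `ε` is idempotent on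
cohomology, it models the image of `ε` in the derived category. -/
def tele {P : DGBimod A B} (ε : P ⟶ P) : DGBimod A B where
  carrier := Iter (lin ε)
  left := teleLeft ε
  right := teleRight ε
  left_right a b x := by
    obtain ⟨n, p, rfl⟩ := exists_iterOf x
    rw [teleRight_of, teleLeft_of, teleLeft_of, teleRight_of, P.left_right]
  deg := teleDeg ε
  isInternal := tele_isInternal ε
  left_mem ha := by
    rintro ⟨n, p, hp, rfl⟩
    exact ⟨n, _, P.left_mem ha hp, (teleLeft_of ε n p _).symm⟩
  right_mem := by
    rintro i j _ b ⟨n, p, hp, rfl⟩ hb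
    exact ⟨n, _, P.right_mem hp hb, (teleRight_of ε n p _).symm⟩
  d := teleD ε
  d_mem := by
    rintro i _ ⟨n, p, hp, rfl⟩
    exact ⟨n, _, P.d_mem hp, (teleD_of ε n p).symm⟩
  d_d x := by
    obtain ⟨n, p, rfl⟩ := exists_iterOf x
    rw [teleD_of, teleD_of, P.d_d, map_zero]
  d_left {i a} x ha := by
    obtain ⟨n, p, rfl⟩ := exists_iterOf x
    rw [teleLeft_of, teleD_of, teleD_of, teleLeft_of, teleLeft_of, P.d_left p ha, map_add,
      units_smul_map]
  d_right {i x} b := by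
    rintro ⟨n, p, hp, rfl⟩
    rw [teleRight_of, teleD_of, teleD_of, teleRight_of, teleRight_of, P.d_right b hp, map_add,
      units_smul_map]

/-- The map from the `n`-th copy of `P` to the colimit. -/
def teleOf {P : DGBimod A B} (ε : P ⟶ P) (n : ℕ) : P ⟶ tele ε where
  toLin := iterOf (lin ε) n
  map_left a p := (teleLeft_of ε n p a).symm
  map_right b p := (teleRight_of ε n p b).symm
  map_deg hp := ⟨n, _, hp, rfl⟩
  map_d p := (teleD_of ε n p).symm

theorem exists_teleOf {P : DGBimod A B} (ε : P ⟶ P) (x : tele ε) :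
    ∃ n p, lin (teleOf ε n) p = x := exists_iterOf x

theorem teleOf_succ {P : DGBimod A B} (ε : P ⟶ P) (n : ℕ) (p : P) :
    lin (teleOf ε (n + 1)) (lin ε p) = lin (teleOf ε n) p := iterOf_succ (f := lin ε) n p

/-- A linear map out of the colimit. -/
def teleDescLin {P X : DGBimod A B} {ε : P ⟶ P} (φ : ℕ → (P ⟶ X))
    (hφ : ∀ n p, lin (φ (n + 1)) (lin ε p) = lin (φ n) p) : tele ε →ₗ[k] X :=
  iterDesc (f := lin ε) (fun n => lin (φ n)) hφ

theorem teleDescLin_of {P X : DGBimod A B} {ε : P ⟶ P} (φ : ℕ → (P ⟶ X))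
    (hφ : ∀ n p, lin (φ (n + 1)) (lin ε p) = lin (φ n) p) (n : ℕ) (p : P) :
    teleDescLin φ hφ (lin (teleOf ε n) p) = lin (φ n) p :=
  iterDesc_of (f := lin ε) (fun n => lin (φ n)) hφ n p

/-- A morphism out of the colimit. -/
def teleDesc {P X : DGBimod A B} {ε : P ⟶ P} (φ : ℕ → (P ⟶ X))
    (hφ : ∀ n p, lin (φ (n + 1)) (lin ε p) = lin (φ n) p) : tele ε ⟶ X where
  toLin := teleDescLin φ hφ
  map_left a x := by
    obtain ⟨n, p, rfl⟩ := exists_teleOf ε x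
    rw [← lin_left, teleDescLin_of, teleDescLin_of, lin_left]
  map_right b x := by
    obtain ⟨n, p, rfl⟩ := exists_teleOf ε x
    rw [← lin_right, teleDescLin_of, teleDescLin_of, lin_right]
  map_deg := by
    rintro i _ ⟨n, p, hp, rfl⟩
    have h := (φ n).map_deg hp
    have h' := teleDescLin_of φ hφ n p
    exact h'.symm ▸ h
  map_d x := by
    obtain ⟨n, p, rfl⟩ := exists_teleOf ε x
    rw [← lin_d, teleDescLin_of, teleDescLin_of, lin_d]

theorem teleDesc_of {P X : DGBimod A B} {ε : P ⟶ P} (φ : ℕ → (P ⟶ X))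
    (hφ : ∀ n p, lin (φ (n + 1)) (lin ε p) = lin (φ n) p) (n : ℕ) (p : P) :
    lin (teleDesc φ hφ) (lin (teleOf ε n) p) = lin (φ n) p := teleDescLin_of φ hφ n p

/-- The morphism induced on colimits. -/
def teleMap {P P' : DGBimod A B} {ε : P ⟶ P} {ε' : P' ⟶ P'} (f : P ⟶ P')
    (hf : ∀ p, lin f (lin ε p) = lin ε' (lin f p)) : tele ε ⟶ tele ε' :=
  teleDesc (fun n => f ≫ teleOf ε' n) fun n p =>
    (congrArg (lin (teleOf ε' (n + 1))) (hf p)).trans (teleOf_succ ε' n _)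

theorem teleMap_of {P P' : DGBimod A B} {ε : P ⟶ P} {ε' : P' ⟶ P'} (f : P ⟶ P')
    (hf : ∀ p, lin f (lin ε p) = lin ε' (lin f p)) (n : ℕ) (p : P) :
    lin (teleMap f hf) (lin (teleOf ε n) p) = lin (teleOf ε' n) (lin f p) :=
  teleDesc_of (fun n => f ≫ teleOf ε' n) _ n p

section Idempotent

variable {P : DGBimod A B} {ε : P ⟶ P}

theorem hmap_teleOf_succ (n : ℕ) (x : Cohomology P.d) :
    hmap (teleOf ε (n + 1)) (hmap ε x) = hmap (teleOf ε n) x := by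
  obtain ⟨z, hz, rfl⟩ := cls_surjective x
  exact cls_congr _ (iterOf_succ (f := lin ε) n z)

/-- If `ε` is idempotent on cohomology, each class of the colimit comes from the first copy of
`P`. -/
theorem hmap_teleOf_surjective (hε : ∀ x, hmap ε (hmap ε x) = hmap ε x) :
    Function.Surjective (hmap (teleOf ε 0)) := by
  have key : ∀ n x, hmap (teleOf ε (n + 1)) (hmap ε x) = hmap (teleOf ε 0) (hmap ε x) :=
    fun n x => by
      induction n with
      | zero => rw [← hε x, hmap_teleOf_succ, hε]
      | succ n ih => rw [← hε x, hmap_teleOf_succ, ih, hε]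
  intro y
  obtain ⟨w, hw, rfl⟩ := cls_surjective y
  obtain ⟨n, p, rfl⟩ := exists_teleOf ε w
  rw [← lin_d] at hw
  obtain ⟨m, hm⟩ := exists_pow_eq_zero (f := lin ε) hw
  have hz : P.d ((lin ε ^ m) p) = 0 := by rw [pow_comm_apply (fun x => (lin_d ε x).symm), hm]
  refine ⟨hmap ε (cls P.d _ hz), ?_⟩
  rw [← key (n + m), hmap_teleOf_succ]
  exact cls_congr _ (iterOf_pow (f := lin ε) n m p)

/-- If `ε` is idempotent on cohomology, the cohomology of the colimit is the image of `ε`. -/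
theorem hmap_teleOf_eq_zero_iff (hε : ∀ x, hmap ε (hmap ε x) = hmap ε x) (x : Cohomology P.d) :
    hmap (teleOf ε 0) x = 0 ↔ hmap ε x = 0 := by
  constructor
  · intro h
    obtain ⟨z, hz, rfl⟩ := cls_surjective x
    obtain ⟨w, hw⟩ := (cls_eq_zero_iff (d := (tele ε).d) (z := lin (teleOf ε 0) z) _).1 h
    obtain ⟨n, p, rfl⟩ := exists_teleOf ε w
    have hw' : iterOf (lin ε) n (P.d p) = iterOf (lin ε) 0 z :=
      (lin_d (teleOf ε n) p).trans hw
    rw [← iterOf_pow 0 n z, zero_add, ← sub_eq_zero, ← map_sub] at hw'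
    replace hw := hw'
    obtain ⟨m, hm⟩ := exists_pow_eq_zero (f := lin ε) hw
    have key : ∀ n : ℕ, ∀ z (hz : P.d z = 0) (hz' : P.d ((lin ε ^ (n + 1)) z) = 0),
        hmap ε (cls P.d z hz) = cls P.d ((lin ε ^ (n + 1)) z) hz' := fun n z hz => by
      induction n with
      | zero => intro hz'; exact cls_congr _ (by simp)
      | succ n ih =>
        intro hz'
        have h1 : P.d ((lin ε ^ (n + 1)) z) = 0 := by
          rw [pow_comm_apply (fun x => (lin_d ε x).symm), hz, map_zero]
        rw [← hε, ih h1, hmap_cls]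
        exact cls_congr _ (by rw [pow_succ' _ (n + 1), Module.End.mul_apply])
    have h1 : P.d ((lin ε ^ (m + n + 1)) z) = 0 := by
      rw [pow_comm_apply (fun x => (lin_d ε x).symm), hz, map_zero]
    rw [key (m + n) z hz h1, cls_eq_zero_iff]
    refine ⟨lin ε ((lin ε ^ m) p), ?_⟩
    rw [map_sub, sub_eq_zero] at hm
    rw [← lin_d, pow_comm_apply (fun x => (lin_d ε x).symm), hm,
      ← Module.End.mul_apply _ (lin ε ^ n), ← pow_add, ← Module.End.mul_apply, ← pow_succ']
  · intro h
    rw [← hmap_teleOf_succ, h, map_zero]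

end Idempotent

end DGBimod

/-! ### Induced modules -/

namespace DGBimod

variable {A B C : DGAlgebra k}

/-- The bilinear map `m, a ↦ m a`. -/
def rightMap (M : DGBimod C A) : M →ₗ[k] A →ₗ[k] M :=
  (M.right.toLinearMap ∘ₗ (MulOpposite.opLinearEquiv k).toLinearMap).flip

/-- The bimodule `M ⊗_k B`, in which the right action on `M` is forgotten. -/
def ind (M : DGBimod C A) (B : DGAlgebra k) : DGBimod C B :=
  M.forgetRight.tensor (diag B).forgetLeft

/-- The element `m ⊗ b` of `M ⊗_k B`. -/
def it (M : DGBimod C A) (B : DGAlgebra k) : M →ₗ[k] B →ₗ[k] M.ind B :=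
  tm M.forgetRight (diag B).forgetLeft

theorem left_it (M : DGBimod C A) (c : C) (m : M) (b : B) :
    (M.ind B).left c (it M B m b) = it M B (M.left c m) b := rfl

theorem right_it (M : DGBimod C A) (m : M) (b b' : B) :
    (M.ind B).right (.op b') (it M B m b) = it M B m (b * b') := rfl

theorem d_it (M : DGBimod C A) (m : M) (b : B) :
    (M.ind B).d (it M B m b) = it M B (M.d m) b + it M B (M.sgn m) (B.d b) := rfl

theorem it_mem {M : DGBimod C A} {i j : ℤ} {m : M} {b : B} (hm : m ∈ M.deg i) (hb : b ∈ B.deg j) :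
    it M B m b ∈ (M.ind B).deg (i + j) :=
  tm_mem (M := M.forgetRight) (K := (diag B).forgetLeft) hm hb

theorem it_mem_zero {M : DGBimod C A} {i : ℤ} {m : M} {b : B} (hm : m ∈ M.deg i)
    (hb : b ∈ B.deg 0) : it M B m b ∈ (M.ind B).deg i := by
  simpa using it_mem hm hb

theorem ind_induction {M : DGBimod C A} {p : M.ind B → Prop} (zero : p 0)
    (it : ∀ m b, p (it M B m b)) (add : ∀ s t, p s → p t → p (s + t)) (t : M.ind B) : p t :=
  tensor_induction (M := M.forgetRight) (K := (diag B).forgetLeft) zero it add t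

theorem ind_lin_ext {M : DGBimod C A} {W : Type*} [AddCommGroup W] [Module k W]
    {f g : M.ind B →ₗ[k] W} (h : ∀ m b, f (it M B m b) = g (it M B m b)) : f = g :=
  tensor_hom_ext (M := M.forgetRight) (K := (diag B).forgetLeft) h

/-- A linear map out of `M ⊗_k B`. -/
def ilift {M : DGBimod C A} {W : Type*} [AddCommGroup W] [Module k W] (f : M →ₗ[k] B →ₗ[k] W) :
    M.ind B →ₗ[k] W :=
  tlift (M := M.forgetRight) (K := (diag B).forgetLeft) f
    (base_balanced (M := M.forgetRight) (K := (diag B).forgetLeft) f)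

theorem ilift_it {M : DGBimod C A} {W : Type*} [AddCommGroup W] [Module k W]
    (f : M →ₗ[k] B →ₗ[k] W) (m : M) (b : B) : ilift f (it M B m b) = f m b := rfl

theorem ind_hom_ext {M : DGBimod C A} {N : DGBimod C B} {f g : M.ind B ⟶ N}
    (h : ∀ m, lin f (it M B m 1) = lin g (it M B m 1)) : f = g := by
  refine hom_ext fun x => LinearMap.congr_fun (ind_lin_ext fun m b => ?_) x
  have := congrArg (N.right (.op b)) (h m)
  rwa [← lin_right, ← lin_right, right_it, one_mul] at this

/-- The morphism `m ⊗ b ↦ f(m) b` out of `M ⊗_k B` given by a morphism `f` of complexes of left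
modules. -/
def indDesc {M : DGBimod C A} {N : DGBimod C B} (f : M →ₗ[k] N)
    (left : ∀ c m, f (M.left c m) = N.left c (f m))
    (deg : ∀ {i m}, m ∈ M.deg i → f m ∈ N.deg i) (d : ∀ m, f (M.d m) = N.d (f m)) :
    M.ind B ⟶ N where
  toLin := ilift (N.rightMap ∘ₗ f)
  map_left c x := by
    induction x using ind_induction with
    | zero => rw [map_zero, map_zero, map_zero]
    | it m b =>
      rw [left_it, ilift_it, ilift_it]
      change N.right (.op b) (f (M.left c m)) = N.left c (N.right (.op b) (f m))
      rw [left, N.left_right]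
    | add s t hs ht => simp only [map_add, hs, ht]
  map_right b' x := by
    induction x using ind_induction with
    | zero => simp only [map_zero]
    | it m b =>
      change N.right (.op (b * b'.unop)) (f m) = N.right b' (N.right (.op b) (f m))
      rw [MulOpposite.op_mul, map_mul]
      rfl
    | add s t hs ht => simp only [map_add, hs, ht]
  map_deg {i x} hx := by
    refine tensor_deg_le (M := M.forgetRight) (K := (diag B).forgetLeft) (S := (N.deg i).comap
      (ilift (N.rightMap ∘ₗ f)))
      ?_ hx
    rintro p q m b rfl hm hb
    exact N.right_mem (deg hm) hb
  map_d x := by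
    have hs : ∀ m, f (M.sgn m) = N.sgn (f m) := fun m =>
      graded_induction M.isInternal (p := fun m => f (M.sgn m) = N.sgn (f m))
        (fun i m hm => by rw [M.sgn_of_mem hm, N.sgn_of_mem (deg hm), units_smul_map])
        (fun x y hx hy => by simp only [map_add, hx, hy]) m
    induction x using ind_induction with
    | zero => simp only [map_zero]
    | it m b =>
      rw [d_it, map_add, ilift_it, ilift_it, ilift_it]
      change N.right (.op b) (f (M.d m)) + N.right (.op (B.d b)) (f (M.sgn m)) =
        N.d (N.right (.op b) (f m))
      rw [d, hs, N.d_right_sgn]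
    | add s t hs ht => simp only [map_add, hs, ht]

theorem indDesc_it {M : DGBimod C A} {N : DGBimod C B} (f : M →ₗ[k] N) (left deg d) (m : M)
    (b : B) : lin (indDesc f left deg d) (it M B m b) = N.right (.op b) (f m) := rfl

theorem d_it_one (M : DGBimod C A) (m : M) :
    (M.ind B).d (it M B m 1) = it M B (M.d m) 1 := by
  rw [d_it, B.d_one, map_zero, add_zero]

/-- The morphism `m ⊗ b ↦ f(m) ⊗ b`. -/
def indMap {M N : DGBimod C A} (f : M ⟶ N) (B : DGAlgebra k) : M.ind B ⟶ N.ind B :=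
  indDesc ((it N B).flip 1 ∘ₗ lin f)
    (fun c m => by
      rw [LinearMap.comp_apply, LinearMap.comp_apply, lin_left]; rfl)
    (fun hm => it_mem_zero (f.map_deg hm) B.one_mem)
    (fun m => by
      rw [LinearMap.comp_apply, LinearMap.comp_apply, lin_d]; exact (d_it_one N _).symm)

theorem indMap_it {M N : DGBimod C A} (f : M ⟶ N) (m : M) (b : B) :
    lin (indMap f B) (it M B m b) = it N B (lin f m) b := by
  refine (indDesc_it _ _ _ _ _ _).trans ?_
  change (N.ind B).right (.op b) (it N B (lin f m) 1) = _
  rw [right_it, one_mul]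

/-- The functor `M ↦ M ⊗_k B`. -/
def indFunctor (C A B : DGAlgebra k) : DGBimod C A ⥤ DGBimod C B where
  obj M := M.ind B
  map f := indMap f B
  map_id _ := ind_hom_ext fun _ => indMap_it _ _ _
  map_comp f g := ind_hom_ext fun m => (indMap_it (f ≫ g) m 1).trans
    ((congrArg (lin (indMap g B)) (indMap_it f m 1)).trans (indMap_it g _ _)).symm

/-! ### The cohomology of induced modules -/

/-- The product `[m] ⊗ [b] ↦ [m ⊗ b]` of cohomology classes. -/
def icross (M : DGBimod C A) (B : DGAlgebra k) :
    Cohomology M.d →ₗ[k] B.H →ₗ[k] Cohomology (M.ind B).d :=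
  (cross M.forgetRight (diag B).forgetLeft).compl₂ B.hEquiv.toLinearMap

theorem icross_cls (M : DGBimod C A) (m : M) (hm : M.d m = 0) (b : B) (hb : B.d b = 0) :
    icross M B (cls M.d m hm) (B.hcls b hb) =
      cls (M.ind B).d (it M B m b) (by rw [d_it, hm, hb]; simp) := by
  refine (congrArg (cross M.forgetRight (diag B).forgetLeft (cls M.d m hm))
    (B.hEquiv_hcls b hb)).trans ?_
  rfl

/-- The Künneth isomorphism for `M ⊗_k B`. -/
def ikunneth (M : DGBimod C A) (B : DGAlgebra k) :
    Cohomology M.d ⊗[k] B.H ≃ₗ[k] Cohomology (M.ind B).d :=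
  (TensorProduct.congr (LinearEquiv.refl k (Cohomology M.d)) B.hEquiv).trans
    (kunneth M.forgetRight (diag B).forgetLeft)

theorem ikunneth_symm_icross (M : DGBimod C A) (x : Cohomology M.d) (b : B.H) :
    (ikunneth M B).symm (icross M B x b) = x ⊗ₜ b :=
  (LinearEquiv.symm_apply_eq _).2 rfl

theorem icross_hom_ext {M : DGBimod C A} {W : Type*} [AddCommGroup W] [Module k W]
    {f g : Cohomology (M.ind B).d →ₗ[k] W} (h : ∀ x b, f (icross M B x b) = g (icross M B x b)) :
    f = g := by
  have : f ∘ₗ (ikunneth M B).toLinearMap = g ∘ₗ (ikunneth M B).toLinearMap :=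
    TensorProduct.ext' h
  refine LinearMap.ext fun x => ?_
  obtain ⟨y, rfl⟩ := (ikunneth M B).surjective x
  exact LinearMap.congr_fun this y

theorem hmap_indMap_icross {M N : DGBimod C A} (f : M ⟶ N) (x : Cohomology M.d) (b : B.H) :
    hmap (indMap f B) (icross M B x b) = icross N B (hmap f x) b := by
  obtain ⟨m, hm, rfl⟩ := cls_surjective x
  obtain ⟨b, hb, rfl⟩ := DGAlgebra.hcls_surjective b
  rw [icross_cls, hmap_cls, hmap_cls, icross_cls]
  exact cls_congr _ (indMap_it f m b)

theorem hRight_icross (M : DGBimod C A) (x : Cohomology M.d) (b b' : B.H) :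
    hRight (M.ind B) b' (icross M B x b) = icross M B x (b * b') := by
  obtain ⟨m, hm, rfl⟩ := cls_surjective x
  obtain ⟨b, hb, rfl⟩ := DGAlgebra.hcls_surjective b
  obtain ⟨b', hb', rfl⟩ := DGAlgebra.hcls_surjective b'
  rw [icross_cls, hRight_cls]
  exact (icross_cls M m hm (b * b') _).symm

/-- On cohomology, `f ⊗ B` is `H(f) ⊗ H(B)`. -/
theorem ikunneth_rTensor {M N : DGBimod C A} (f : M ⟶ N) (t : Cohomology M.d ⊗[k] B.H) :
    hmap (indMap f B) (ikunneth M B t) = ikunneth N B ((hmap f).rTensor B.H t) := by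
  induction t using TensorProduct.induction_on with
  | zero => simp
  | tmul x b => exact hmap_indMap_icross f x b
  | add s t hs ht => simp only [map_add, hs, ht]

theorem hmap_indMap_surjective {M N : DGBimod C A} {f : M ⟶ N}
    (hf : Function.Surjective (hmap f)) : Function.Surjective (hmap (indMap f B)) := by
  intro y
  obtain ⟨y, rfl⟩ := (ikunneth N B).surjective y
  obtain ⟨t, rfl⟩ := LinearMap.rTensor_surjective B.H hf y
  exact ⟨ikunneth M B t, ikunneth_rTensor f t⟩

theorem rTensor_eq_zero_iff {V W X : Type*} [AddCommGroup V] [Module k V] [AddCommGroup W]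
    [Module k W] [AddCommGroup X] [Module k X] {q : V →ₗ[k] W} (hq : Function.Injective q)
    (t : V ⊗[k] X) : q.rTensor X t = 0 ↔ t = 0 :=
  map_eq_zero_iff _ (Module.Flat.rTensor_preserves_injective_linearMap q hq)

/-- If `f` and `g` have the same kernel on cohomology, so have `f ⊗ B` and `g ⊗ B`. -/
theorem hmap_indMap_eq_zero_iff {M N P : DGBimod C A} {f : M ⟶ N} {g : M ⟶ P}
    (hf : Function.Surjective (hmap f)) (h : ∀ x, hmap f x = 0 ↔ hmap g x = 0)
    (x : Cohomology (M.ind B).d) :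
    hmap (indMap f B) x = 0 ↔ hmap (indMap g B) x = 0 := by
  let q : Cohomology N.d →ₗ[k] Cohomology P.d :=
    (LinearMap.ker (hmap f)).liftQ (hmap g) (fun x hx => (h x).1 hx) ∘ₗ
      ((hmap f).quotKerEquivOfSurjective hf).symm.toLinearMap
  have hq : ∀ x, q (hmap f x) = hmap g x := fun x => by
    have : ((hmap f).quotKerEquivOfSurjective hf).symm (hmap f x) = Submodule.Quotient.mk x :=
      (LinearEquiv.symm_apply_eq _).2 rfl
    simp only [q, LinearMap.comp_apply, LinearEquiv.coe_coe, this]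
    rfl
  have hqi : Function.Injective q := by
    rw [injective_iff_map_eq_zero]
    intro y hy
    obtain ⟨x, rfl⟩ := hf y
    rw [hq] at hy
    exact (h x).2 hy
  obtain ⟨t, rfl⟩ := (ikunneth M B).surjective x
  rw [ikunneth_rTensor, ikunneth_rTensor, LinearEquiv.map_eq_zero_iff,
    LinearEquiv.map_eq_zero_iff, show hmap g = q ∘ₗ hmap f from LinearMap.ext fun x => (hq x).symm,
    LinearMap.rTensor_comp_apply, rTensor_eq_zero_iff hqi]

theorem quasiIso_indMap {M N : DGBimod C A} {f : M ⟶ N} (hf : quasiIso C A f) :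
    quasiIso C B (indMap f B) := by
  rw [quasiIso_iff] at hf ⊢
  refine ⟨(injective_iff_map_eq_zero _).2 fun x hx => ?_, hmap_indMap_surjective hf.2⟩
  have h := (hmap_indMap_eq_zero_iff (B := B) (g := 𝟙 M) hf.2 (fun x => by
    rw [hmap_id, LinearMap.id_apply, ← (hmap f).map_zero, hf.1.eq_iff]) x).1 hx
  have : indMap (𝟙 M) B = 𝟙 (M.ind B) := (indFunctor C A B).map_id M
  rwa [this, hmap_id, LinearMap.id_apply] at h

end DGBimod

/-! ### Transfer functors -/

theorem cls_sum {V ι : Type*} [AddCommGroup V] [Module k V] [Fintype ι] {d : V →ₗ[k] V} (z : ι → V)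
    (hz : ∀ j, d (z j) = 0) (h : d (∑ j, z j) = 0) :
    cls d (∑ j, z j) h = ∑ j, cls d (z j) (hz j) := by
  have : (⟨∑ j, z j, h⟩ : LinearMap.ker d) = ∑ j, ⟨z j, hz j⟩ := Subtype.ext (by simp)
  exact (congrArg (Submodule.mkQ _) this).trans (map_sum (Submodule.mkQ _) _ _)

/-- Finitely many pairs of cocycles of degree `0`, which stand for the cocycle `∑ fst j ⊗ snd j` of
`A ⊗ B`. -/
structure Transfer (ι : Type u) (A B : DGAlgebra k) where
  fst : ι → A
  snd : ι → B
  fst_mem : ∀ j, fst j ∈ A.deg 0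
  snd_mem : ∀ j, snd j ∈ B.deg 0
  d_fst : ∀ j, A.d (fst j) = 0
  d_snd : ∀ j, B.d (snd j) = 0

namespace IsSeparabilityFamily

variable {E ι W : Type*} [Ring E] [Algebra k E] [Fintype ι] {p q : ι → E} [AddCommGroup W]
  [Module k W]

/-- The centrality of a separability element, tested on bilinear maps. -/
theorem sum_comm (h : IsSeparabilityFamily k p q) (g : E →ₗ[k] E →ₗ[k] W) (b : E) :
    ∑ j, g (b * p j) (q j) = ∑ j, g (p j) (q j * b) := by
  simpa using congrArg (TensorProduct.lift g) (h.central b)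

/-- The separability element is an idempotent of `E ⊗ Eᵒᵖ`. -/
theorem sum_sum (h : IsSeparabilityFamily k p q) (g : E →ₗ[k] E →ₗ[k] W) :
    ∑ j, ∑ l, g (p j * p l) (q l * q j) = ∑ l, g (p l) (q l) := by
  have h1 : ∀ j, ∑ l, g (p j * p l) (q l * q j) = ∑ l, g (p l) (q l * (p j * q j)) := fun j => by
    simpa [mul_assoc] using h.sum_comm (g.compl₂ (LinearMap.mulRight k (q j))) (p j)
  rw [Finset.sum_congr rfl fun j _ => h1 j, Finset.sum_comm]
  refine Finset.sum_congr rfl fun l _ => ?_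
  rw [← map_sum, ← Finset.mul_sum, h.sum_mul, mul_one]

end IsSeparabilityFamily

namespace DGBimod

variable {A B C : DGAlgebra k} {ι : Type u} [Fintype ι]

/-- The endomorphism `m ⊗ b ↦ ∑ m P_j ⊗ Q_j b` of `M ⊗_k B`, where `P_j`, `Q_j` are the components
of `t`. -/
def endo (t : Transfer ι A B) (M : DGBimod C A) : M.ind B ⟶ M.ind B :=
  indDesc (∑ j, (it M B).flip (t.snd j) ∘ₗ M.right (.op (t.fst j)))
    (fun c m => by
      simp only [LinearMap.sum_apply, map_sum]
      refine Finset.sum_congr rfl fun j _ => ?_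
      refine Eq.trans ?_ (left_it M c _ _).symm
      rw [M.left_right]
      rfl)
    (fun {i m} hm => by
      rw [LinearMap.sum_apply]
      refine sum_mem fun j _ => it_mem_zero ?_ (t.snd_mem j)
      simpa using M.right_mem hm (t.fst_mem j))
    (fun m => by
      simp only [LinearMap.sum_apply, map_sum]
      refine Finset.sum_congr rfl fun j _ => ?_
      refine Eq.trans ?_ (d_it M _ _).symm
      rw [t.d_snd, map_zero, add_zero, M.d_right_sgn, t.d_fst, MulOpposite.op_zero, map_zero,
        LinearMap.zero_apply, add_zero]
      rfl)

theorem endo_it (t : Transfer ι A B) (M : DGBimod C A) (m : M) (b : B) :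
    lin (endo t M) (it M B m b) = ∑ j, it M B (M.right (.op (t.fst j)) m) (t.snd j * b) := by
  refine (indDesc_it _ _ _ _ _ _).trans ?_
  rw [LinearMap.sum_apply, map_sum]
  exact Finset.sum_congr rfl fun j _ => right_it M _ _ _

theorem endo_indMap (t : Transfer ι A B) {M N : DGBimod C A} (f : M ⟶ N) (x : M.ind B) :
    lin (indMap f B) (lin (endo t M) x) = lin (endo t N) (lin (indMap f B) x) := by
  induction x using ind_induction with
  | zero => simp only [map_zero]
  | it m b =>
    rw [endo_it, indMap_it, endo_it, map_sum]
    exact Finset.sum_congr rfl fun j _ => by rw [indMap_it, lin_right]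
  | add s t hs ht => simp only [map_add, hs, ht]

/-- The morphism induced by `f` on the colimits of the iterates of `endo t`. -/
def transferMap (t : Transfer ι A B) {M N : DGBimod C A} (f : M ⟶ N) :
    tele (endo t M) ⟶ tele (endo t N) :=
  teleMap (indMap f B) (endo_indMap t f)

theorem transferMap_of (t : Transfer ι A B) {M N : DGBimod C A} (f : M ⟶ N) (n : ℕ)
    (x : M.ind B) : lin (transferMap t f) (lin (teleOf (endo t M) n) x) =
      lin (teleOf (endo t N) n) (lin (indMap f B) x) :=
  teleMap_of (indMap f B) (endo_indMap t f) n x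

/-- The functor which sends `M` to the colimit of the iterates of `endo t M`. -/
def transfer (C : DGAlgebra k) (t : Transfer ι A B) : DGBimod C A ⥤ DGBimod C B where
  obj M := tele (endo t M)
  map f := transferMap t f
  map_id M := hom_ext fun x => by
    obtain ⟨n, x, rfl⟩ := exists_teleOf _ x
    rw [transferMap_of]
    exact congrArg (fun f => lin (teleOf (endo t M) n) (lin f x)) ((indFunctor C A B).map_id M)
  map_comp {M N P} f g := hom_ext fun x => by
    obtain ⟨n, x, rfl⟩ := exists_teleOf _ x
    rw [transferMap_of]
    refine (congrArg (fun f => lin (teleOf (endo t P) n) (lin f x))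
      ((indFunctor C A B).map_comp f g)).trans ?_
    refine (transferMap_of t g n (lin (indMap f B) x)).symm.trans ?_
    exact congrArg _ (transferMap_of t f n x).symm

theorem hmap_endo_icross (t : Transfer ι A B) (M : DGBimod C A) (x : Cohomology M.d) (b : B.H) :
    hmap (endo t M) (icross M B x b) = ∑ j, icross M B
      (hRight M (A.hcls (t.fst j) (t.d_fst j)) x) (B.hcls (t.snd j) (t.d_snd j) * b) := by
  obtain ⟨m, hm, rfl⟩ := cls_surjective x
  obtain ⟨b, hb, rfl⟩ := DGAlgebra.hcls_surjective b
  have hz : ∀ j, M.d (M.right (.op (t.fst j)) m) = 0 := fun j => by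
    rw [M.d_right_sgn, hm, t.d_fst, MulOpposite.op_zero, map_zero, map_zero,
        LinearMap.zero_apply, add_zero]
  have hw : ∀ j, B.d (t.snd j * b) = 0 := fun j => by
    rw [B.d_mul_sgn, hb, t.d_snd, zero_mul, mul_zero, add_zero]
  have hzw : ∀ j, (M.ind B).d (it M B (M.right (.op (t.fst j)) m) (t.snd j * b)) = 0 := fun j => by
    rw [d_it, hz, hw, map_zero, map_zero, LinearMap.zero_apply, add_zero]
  have h1 : ∀ j, icross M B
      (hRight M (A.hcls (t.fst j) (t.d_fst j)) (cls M.d m hm))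
      (B.hcls (t.snd j) (t.d_snd j) * B.hcls b hb) = cls (M.ind B).d _ (hzw j) := fun j =>
    icross_cls M _ (hz j) _ (hw j)
  rw [Finset.sum_congr rfl fun j _ => h1 j, icross_cls, hmap_cls, ← cls_sum _ hzw (by
    rw [map_sum]; exact Finset.sum_eq_zero fun j _ => hzw j)]
  exact cls_congr _ (endo_it t M m b)

/-- The pairs `fst j ⊗ snd j` represent, on cohomology, the image of the family `p j ⊗ q j`. -/
structure Represents {E : Type*} [Ring E] [Algebra k E] (t : Transfer ι A B)
    (p q : ι → E) (α : E →ₗ[k] A.H) (β : E →ₗ[k] B.H) : Prop where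
  map_mul_left : ∀ x y, α (x * y) = α x * α y
  map_mul_right : ∀ x y, β (x * y) = β x * β y
  hcls_fst : ∀ j, A.hcls (t.fst j) (t.d_fst j) = α (p j)
  hcls_snd : ∀ j, B.hcls (t.snd j) (t.d_snd j) = β (q j)

variable {E : Type*} [Ring E] [Algebra k E] {t : Transfer ι A B} {p q : ι → E}
  {α : E →ₗ[k] A.H} {β : E →ₗ[k] B.H}

theorem Represents.hmap_endo_icross (ht : Represents t p q α β) (M : DGBimod C A)
    (x : Cohomology M.d) (b : B.H) : hmap (endo t M) (icross M B x b) =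
      ∑ j, icross M B (hRight M (α (p j)) x) (β (q j) * b) := by
  rw [DGBimod.hmap_endo_icross]
  exact Finset.sum_congr rfl fun j _ => by rw [ht.hcls_fst, ht.hcls_snd]

/-- The map `y ⊗ z ↦ x α(y) ⊗ β(z) b`. -/
def pairing (α : E →ₗ[k] A.H) (β : E →ₗ[k] B.H) (M : DGBimod C A) (x : Cohomology M.d)
    (b : B.H) : E →ₗ[k] E →ₗ[k] Cohomology (M.ind B).d :=
  (icross M B ∘ₗ (hRight M ∘ₗ α).flip x).compl₂ (LinearMap.mulRight k b ∘ₗ β)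

theorem pairing_apply (M : DGBimod C A) (x : Cohomology M.d) (b : B.H) (y z : E) :
    pairing α β M x b y z = icross M B (hRight M (α y) x) (β z * b) := rfl

/-- A separability element is an idempotent, so it acts on cohomology by an idempotent. -/
theorem Represents.hmap_endo_idem (ht : Represents t p q α β)
    (h : IsSeparabilityFamily k p q) (M : DGBimod C A) (x : Cohomology (M.ind B).d) :
    hmap (endo t M) (hmap (endo t M) x) = hmap (endo t M) x := by
  refine LinearMap.congr_fun (f := hmap (endo t M) ∘ₗ hmap (endo t M)) (g := hmap (endo t M))
    (icross_hom_ext fun x b => ?_) x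
  have := h.sum_sum (pairing α β M x b)
  simp only [pairing_apply, ht.map_mul_left, ht.map_mul_right, hRight_mul,
    mul_assoc] at this
  rw [LinearMap.comp_apply, ht.hmap_endo_icross, map_sum]
  simp only [ht.hmap_endo_icross]
  exact this

/-- The transfer functor preserves quasi-isomorphisms. -/
theorem Represents.quasiIso_transferMap (ht : Represents t p q α β)
    (h : IsSeparabilityFamily k p q) {M N : DGBimod C A} {f : M ⟶ N} (hf : quasiIso C A f) :
    quasiIso C B (transferMap t f) := by
  have hf' := quasiIso_indMap (B := B) hf
  rw [quasiIso_iff] at hf' ⊢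
  have key : ∀ x, hmap (transferMap t f) (hmap (teleOf (endo t M) 0) x) =
      hmap (teleOf (endo t N) 0) (hmap (indMap f B) x) := fun x => by
    obtain ⟨z, hz, rfl⟩ := cls_surjective x
    exact cls_congr _ (transferMap_of t f 0 z)
  have key' : ∀ x, hmap (indMap f B) (hmap (endo t M) x) =
      hmap (endo t N) (hmap (indMap f B) x) := fun x => by
    obtain ⟨z, hz, rfl⟩ := cls_surjective x
    exact cls_congr _ (endo_indMap t f z)
  refine ⟨(injective_iff_map_eq_zero _).2 fun y hy => ?_, fun y => ?_⟩
  · obtain ⟨x, rfl⟩ := hmap_teleOf_surjective (ht.hmap_endo_idem h M) y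
    replace hy := (key x).symm.trans hy
    rw [hmap_teleOf_eq_zero_iff (ht.hmap_endo_idem h N), ← key', map_eq_zero_iff _ hf'.1] at hy
    exact (hmap_teleOf_eq_zero_iff (ht.hmap_endo_idem h M) x).2 hy
  · obtain ⟨x, rfl⟩ := hmap_teleOf_surjective (ht.hmap_endo_idem h N) y
    obtain ⟨x, rfl⟩ := hf'.2 x
    exact ⟨_, key x⟩

/-- The morphism from the double induced module to the double transfer. -/
def toDouble (t : Transfer ι A B) (t' : Transfer ι B A) (M : DGBimod C A) :
    (M.ind B).ind A ⟶ tele (endo t' (tele (endo t M))) :=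
  indMap (teleOf (endo t M) 0) A ≫ teleOf (endo t' (tele (endo t M))) 0

theorem toDouble_apply (t : Transfer ι A B) (t' : Transfer ι B A) (M : DGBimod C A)
    (x : (M.ind B).ind A) : lin (toDouble t t' M) x =
      lin (teleOf (endo t' (tele (endo t M))) 0) (lin (indMap (teleOf (endo t M) 0) A) x) := rfl

theorem toDouble_naturality (t : Transfer ι A B) (t' : Transfer ι B A) {M N : DGBimod C A}
    (f : M ⟶ N) (x : (M.ind B).ind A) :
    lin (toDouble t t' N) (lin (indMap (indMap f B) A) x) =
      lin (transferMap t' (transferMap t f)) (lin (toDouble t t' M) x) := by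
  rw [toDouble_apply, toDouble_apply, transferMap_of]
  refine congrArg (lin (teleOf (endo t' (tele (endo t N))) 0)) ?_
  induction x using ind_induction with
  | zero => simp only [map_zero]
  | it y a => rw [indMap_it, indMap_it, indMap_it, indMap_it, transferMap_of]
  | add s t hs ht => simp only [map_add, hs, ht]

section Double

variable {t' : Transfer ι B A}

theorem hmap_toDouble_surjective (ht : Represents t p q α β) (ht' : Represents t' p q β α)
    (h : IsSeparabilityFamily k p q) (M : DGBimod C A) :
    Function.Surjective (hmap (toDouble t t' M)) := by
  rw [toDouble, hmap_comp]
  exact (hmap_teleOf_surjective (ht'.hmap_endo_idem h _)).comp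
    (hmap_indMap_surjective (hmap_teleOf_surjective (ht.hmap_endo_idem h M)))

/-- On cohomology, the double transfer is the image of the composite of the two idempotents. -/
theorem hmap_toDouble_eq_zero_iff (ht : Represents t p q α β) (ht' : Represents t' p q β α)
    (h : IsSeparabilityFamily k p q) (M : DGBimod C A)
    (x : Cohomology ((M.ind B).ind A).d) : hmap (toDouble t t' M) x = 0 ↔
      hmap (endo t' (M.ind B)) (hmap (indMap (endo t M) A) x) = 0 := by
  have key : ∀ {N N' : DGBimod C B} (f : N ⟶ N') x, hmap (endo t' N') (hmap (indMap f A) x) =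
      hmap (indMap f A) (hmap (endo t' N) x) := fun f x => by
    obtain ⟨z, hz, rfl⟩ := cls_surjective x
    exact (cls_congr _ (endo_indMap t' f z)).symm
  rw [toDouble, hmap_comp, LinearMap.comp_apply,
    hmap_teleOf_eq_zero_iff (ht'.hmap_endo_idem h _), key, key]
  exact hmap_indMap_eq_zero_iff (hmap_teleOf_surjective (ht.hmap_endo_idem h M))
    (hmap_teleOf_eq_zero_iff (ht.hmap_endo_idem h M)) _

end Double

end DGBimod

/-! ### Transfer as a tensor product -/

namespace DGBimod

variable {A B C : DGAlgebra k} {ι : Type u} [Fintype ι] (t : Transfer ι A B) (M : DGBimod C A)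

theorem right_mul (a a' : A) (m : M) :
    M.right (.op (a * a')) m = M.right (.op a') (M.right (.op a) m) := by
  rw [MulOpposite.op_mul, map_mul]
  rfl

/-- The bimodule which represents the transfer functor. -/
def kernelBimod : DGBimod A B := tele (endo t (diag A))

/-- The class of `a ⊗ b` in the `n`-th copy of `A ⊗_k B`. -/
def kernelOf (n : ℕ) (a : A) (b : B) : kernelBimod t :=
  lin (teleOf (endo t (diag A)) n) (it (diag A) B a b)

theorem left_kernelOf (n : ℕ) (a a' : A) (b : B) :
    (kernelBimod t).left a' (kernelOf t n a b) = kernelOf t n (a' * a) b :=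
  (lin_left (teleOf (endo t (diag A)) n) a' _).symm.trans rfl

theorem right_kernelOf (n : ℕ) (a : A) (b b' : B) :
    (kernelBimod t).right (.op b') (kernelOf t n a b) = kernelOf t n a (b * b') :=
  (lin_right (teleOf (endo t (diag A)) n) _ _).symm.trans rfl

theorem kernelOf_succ (n : ℕ) (a : A) (b : B) :
    ∑ j, kernelOf t (n + 1) (a * t.fst j) (t.snd j * b) = kernelOf t n a b := by
  refine Eq.trans ?_ (teleOf_succ (endo t (diag A)) n _)
  exact ((congrArg (lin (teleOf (endo t (diag A)) (n + 1))) (endo_it t (diag A) a b)).trans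
    (map_sum _ _ _)).symm

theorem d_kernelOf_one (n : ℕ) : (kernelBimod t).d (kernelOf t n 1 1) = 0 := by
  refine (lin_d (teleOf (endo t (diag A)) n) _).symm.trans ?_
  have h : ((diag A).ind B).d (it (diag A) B (1 : A) 1) = 0 :=
    (d_it_one (diag A) (1 : A)).trans ((congrArg (fun z => it (diag A) B z 1) A.d_one).trans
      (LinearMap.map_zero₂ (it (diag A) B) 1))
  exact (congrArg _ h).trans (map_zero _)

theorem kernelOf_one_mem (n : ℕ) : kernelOf t n 1 1 ∈ (kernelBimod t).deg 0 :=
  (teleOf (endo t (diag A)) n).map_deg (it_mem_zero (M := diag A) A.one_mem B.one_mem)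

/-- The morphism `m ⊗ b ↦ m ⊗ (1 ⊗ b)` from `M ⊗_k B` to `M ⊗_A K`, where `1 ⊗ b` is taken in the
`n`-th copy. -/
def indToTensor (n : ℕ) : M.ind B ⟶ M.tensor (kernelBimod t) :=
  indDesc ((tm M (kernelBimod t)).flip (kernelOf t n 1 1))
    (fun c m => left_tm M (kernelBimod t) c m _)
    (fun {i m} hm => by
      have := tm_mem hm (kernelOf_one_mem t n)
      rwa [add_zero] at this)
    (fun m => by
      refine Eq.trans ?_ (d_tm M (kernelBimod t) m _).symm
      rw [d_kernelOf_one, map_zero, add_zero]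
      rfl)

theorem indToTensor_it (n : ℕ) (m : M) (b : B) :
    lin (indToTensor t M n) (it M B m b) = tm M (kernelBimod t) m (kernelOf t n 1 b) := by
  refine (indDesc_it _ _ _ _ _ _).trans ?_
  refine (right_tm M (kernelBimod t) _ m _).trans ?_
  rw [right_kernelOf, one_mul]

theorem indToTensor_endo (n : ℕ) (x : M.ind B) :
    lin (indToTensor t M (n + 1)) (lin (endo t M) x) = lin (indToTensor t M n) x := by
  induction x using ind_induction with
  | zero => simp only [map_zero]
  | it m b =>
    rw [endo_it, map_sum, indToTensor_it, ← kernelOf_succ, map_sum]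
    refine Finset.sum_congr rfl fun j _ => ?_
    rw [indToTensor_it, tm_balanced, left_kernelOf, mul_one, one_mul]
  | add s t hs ht => simp only [map_add, hs, ht]

/-- The comparison of the transfer with the tensor product. -/
def transferToTensor : tele (endo t M) ⟶ M.tensor (kernelBimod t) :=
  teleDesc (indToTensor t M) (indToTensor_endo t M)

theorem transferToTensor_of (n : ℕ) (x : M.ind B) :
    lin (transferToTensor t M) (lin (teleOf (endo t M) n) x) = lin (indToTensor t M n) x :=
  teleDesc_of (indToTensor t M) (indToTensor_endo t M) n x

theorem transferToTensor_naturality {M N : DGBimod C A} (f : M ⟶ N) (x : tele (endo t M)) :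
    lin ((tensorFunctor C (kernelBimod t)).map f) (lin (transferToTensor t M) x) =
      lin (transferToTensor t N) (lin (transferMap t f) x) := by
  obtain ⟨n, x, rfl⟩ := exists_teleOf _ x
  rw [transferMap_of, transferToTensor_of, transferToTensor_of]
  induction x using ind_induction with
  | zero => rw [map_zero, map_zero, map_zero]; exact map_zero (lin _)
  | it m b => rw [indMap_it, indToTensor_it, indToTensor_it]; rfl
  | add s t hs ht =>
    rw [map_add, map_add, map_add, ← hs, ← ht]
    exact map_add (lin _) _ _

/-- The map `a ⊗ b ↦ m a ⊗ b`. -/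
def indAct : M →ₗ[k] (diag A).ind B →ₗ[k] M.ind B where
  toFun m := ilift (it M B ∘ₗ M.rightMap m)
  map_add' m m' := ind_lin_ext fun a b =>
    (congrArg (fun z => it M B z b) (map_add (M.right (.op a)) m m')).trans
      (LinearMap.map_add₂ (it M B) _ _ b)
  map_smul' c m := ind_lin_ext fun a b =>
    (congrArg (fun z => it M B z b) (map_smul (M.right (.op a)) c m)).trans
      (LinearMap.map_smul₂ (it M B) c _ b)

theorem indAct_it (m : M) (a : A) (b : B) :
    indAct M m (it (diag A) B a b) = it M B (M.right (.op a) m) b := rfl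

theorem indAct_endo (m : M) (x : (diag A).ind B) :
    indAct M m (lin (endo t (diag A)) x) = lin (endo t M) (indAct M m x) := by
  induction x using ind_induction with
  | zero => simp only [map_zero]
  | it a b =>
    refine Eq.trans ?_ ((congrArg (lin (endo t M)) (indAct_it M m a b)).trans
      (endo_it t M _ b)).symm
    rw [endo_it, map_sum]
    refine Finset.sum_congr rfl fun j _ => ?_
    refine (indAct_it M m _ _).trans ?_
    exact congrArg (fun z => it M B z (t.snd j * b)) (right_mul M a (t.fst j) m)
  | add s t hs ht => simp only [map_add, hs, ht]

/-- The inverse of the comparison map: on the `n`-th copies it is `m ⊗ (a ⊗ b) ↦ m a ⊗ b`. -/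
def tensorToTransferAux : M →ₗ[k] kernelBimod t →ₗ[k] tele (endo t M) :=
  LinearMap.mk₂ k (fun m x => iterMap (f := lin (endo t (diag A))) (g := lin (endo t M))
      (indAct M m) (indAct_endo t M m) x)
    (fun m m' x => by
      obtain ⟨n, x, rfl⟩ := exists_iterOf x
      rw [iterMap_of, iterMap_of, iterMap_of, map_add, LinearMap.add_apply, map_add]
      rfl)
    (fun c m x => by
      obtain ⟨n, x, rfl⟩ := exists_iterOf x
      rw [iterMap_of, iterMap_of, map_smul, LinearMap.smul_apply, map_smul]
      rfl)
    (fun m x x' => map_add (iterMap (indAct M m) (indAct_endo t M m)) x x')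
    (fun c m x => map_smul (iterMap (indAct M m) (indAct_endo t M m)) c x)

theorem tensorToTransferAux_of (m : M) (n : ℕ) (a : A) (b : B) :
    tensorToTransferAux t M m (kernelOf t n a b) =
      lin (teleOf (endo t M) n) (it M B (M.right (.op a) m) b) :=
  iterMap_of (indAct M m) (indAct_endo t M m) n _

theorem kernel_induction {p : kernelBimod t → Prop} (of : ∀ n a b, p (kernelOf t n a b))
    (add : ∀ x y, p x → p y → p (x + y)) (x : kernelBimod t) : p x := by
  obtain ⟨n, x, rfl⟩ := exists_teleOf _ x
  have hz : p (lin (teleOf (endo t (diag A)) n) 0) := by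
    have := of n 0 0
    rwa [kernelOf, map_zero] at this
  refine ind_induction (M := diag A)
    (p := fun x => p (lin (teleOf (endo t (diag A)) n) x)) hz (fun a b => of n a b)
    (fun s t hs ht => ?_) x
  rw [map_add]
  exact add _ _ hs ht

theorem bijective_transferToTensor : Function.Bijective (lin (transferToTensor t M)) := by
  let g : M.tensor (kernelBimod t) →ₗ[k] tele (endo t M) :=
    tlift (tensorToTransferAux t M) (fun m a x => by
      induction x using kernel_induction with
      | of n a' b =>
        rw [left_kernelOf, tensorToTransferAux_of, tensorToTransferAux_of, right_mul]
      | add x y hx hy => simp only [map_add, hx, hy])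
  refine Function.bijective_iff_has_inverse.2 ⟨g, fun x => ?_, fun x => ?_⟩
  · obtain ⟨n, x, rfl⟩ := exists_teleOf _ x
    rw [transferToTensor_of]
    induction x using ind_induction with
    | zero => simp only [map_zero]
    | it m b =>
      rw [indToTensor_it, tlift_tm, tensorToTransferAux_of, MulOpposite.op_one, map_one,
        Module.End.one_apply]
    | add s t hs ht => simp only [map_add, hs, ht]
  · induction x using tensor_induction with
    | zero => simp only [map_zero]
    | tmul m x =>
      rw [tlift_tm]
      induction x using kernel_induction with
      | of n a b =>
        rw [tensorToTransferAux_of, transferToTensor_of, indToTensor_it, tm_balanced,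
          left_kernelOf, mul_one]
      | add x y hx hy => simp only [map_add, hx, hy]
    | add s t hs ht => simp only [map_add, hs, ht]

end DGBimod

/-! ### Homotopy fibres -/

theorem DGAlgebra.sgn_one_sgn_neg_one (A : DGAlgebra k) (a : A) : A.sgn 1 (A.sgn (-1) a) = a := by
  refine graded_induction A.isInternal (p := fun a => A.sgn 1 (A.sgn (-1) a) = a)
    (fun i a ha => ?_) (fun x y hx hy => by simp only [map_add, hx, hy]) a
  rw [A.sgn_of_mem (-1) ha, units_smul_map, A.sgn_of_mem 1 ha, smul_smul, ← Int.negOnePow_add]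
  simp

namespace DGBimod

variable {A B C : DGAlgebra k} {M N M' N' P : DGBimod A B}

/-- The homotopy fibre of a morphism. -/
def fiber (f : M ⟶ N) : DGBimod A B := (cone f).shift (-1)

theorem fiber_d (f : M ⟶ N) (s : N) (m : M) :
    (fiber f).d ((s, m) : N × M) = ((-(N.d s + lin f m), M.d m) : N × M) := by
  change ((-1 : ℤ).negOnePow • ((N.d s + lin f m, -M.d m) : N × M)) = _
  rw [Int.negOnePow_neg, Int.negOnePow_one, Units.neg_smul, one_smul]
  exact Prod.ext rfl (neg_neg (M.d m))

/-- The projection of the homotopy fibre of `f : M ⟶ N` to `M`. -/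
def fiberFst (f : M ⟶ N) : fiber f ⟶ M where
  toLin := LinearMap.snd k N M
  map_left a m := congrArg (fun a => M.left a m.2) (A.sgn_one_sgn_neg_one a)
  map_right b m := rfl
  map_deg {i m} hm := by
    have h : m.2 ∈ M.deg (i + -1 + 1) := hm.2
    rwa [neg_add_cancel_right] at h
  map_d m := congrArg Prod.snd (fiber_d f m.1 m.2)

/-- The morphism induced on homotopy fibres by a commutative square. -/
def fiberMap {f : M ⟶ N} {f' : M' ⟶ N'} (g : M ⟶ M') (h : N ⟶ N')
    (w : ∀ x, lin f' (lin g x) = lin h (lin f x)) : fiber f ⟶ fiber f' where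
  toLin := (lin h).prodMap (lin g)
  map_left a m := Prod.ext (lin_left h _ m.1) (lin_left g _ m.2)
  map_right b m := Prod.ext (lin_right h b m.1) (lin_right g b m.2)
  map_deg hm := ⟨h.map_deg hm.1, g.map_deg hm.2⟩
  map_d m := by
    have h1 : (lin h).prodMap (lin g) ((fiber f).d m) =
        ((lin h (-(N.d m.1 + lin f m.2)), lin g (M.d m.2)) : N' × M') :=
      congrArg ((lin h).prodMap (lin g)) (fiber_d f m.1 m.2)
    refine h1.trans (Eq.trans ?_ (fiber_d f' (lin h m.1) (lin g m.2)).symm)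
    rw [w, map_neg, map_add, lin_d, lin_d]

/-- If `f` is surjective on cohomology, the cohomology of its homotopy fibre is the kernel of `f`
on cohomology. -/
theorem hmap_fiberFst_injective {f : M ⟶ N} (hf : Function.Surjective (hmap f)) :
    Function.Injective (hmap (fiberFst f)) := by
  rw [injective_iff_map_eq_zero]
  intro x hx
  obtain ⟨⟨s, m⟩, hz, rfl⟩ := cls_surjective x
  have hz' := (fiber_d f s m).symm.trans hz
  have h1 : -(N.d s + lin f m) = 0 := congrArg Prod.fst hz'
  obtain ⟨m', hm'⟩ := (cls_eq_zero_iff (d := M.d) (z := m) _).1 hx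
  have hm' : M.d m' = m := hm'
  have h2 : N.d (lin f m' + s) = 0 := by
    rw [map_add, ← lin_d, hm', add_comm]
    exact neg_eq_zero.1 h1
  obtain ⟨y, hy⟩ := hf (cls N.d _ h2)
  obtain ⟨z, hz0, rfl⟩ := cls_surjective y
  obtain ⟨s', hs'⟩ := (cls_eq_iff (d := N.d) (z := lin f z) _ h2).1 hy
  refine (cls_eq_zero_iff (d := (fiber f).d) _).2 ⟨((s', m' - z) : N × M), ?_⟩
  refine (fiber_d f s' (m' - z)).trans (Prod.ext ?_ ?_)
  · change -(N.d s' + lin f (m' - z)) = s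
    rw [hs', map_sub]
    abel
  · change M.d (m' - z) = m
    rw [map_sub, hz0, hm', sub_zero]

theorem exists_hmap_fiberFst {f : M ⟶ N} {x : Cohomology M.d} (hx : hmap f x = 0) :
    ∃ y, hmap (fiberFst f) y = x := by
  obtain ⟨m, hm, rfl⟩ := cls_surjective x
  obtain ⟨s, hs⟩ := (cls_eq_zero_iff (d := N.d) (z := lin f m) _).1 hx
  have h : (fiber f).d ((-s, m) : N × M) = 0 := by
    refine (fiber_d f (-s) m).trans (Prod.ext ?_ hm)
    change -(N.d (-s) + lin f m) = 0
    rw [map_neg, hs]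
    abel
  exact ⟨cls _ _ h, rfl⟩

theorem hmap_hmap_fiberFst {f : M ⟶ N} (x : Cohomology (fiber f).d) :
    hmap f (hmap (fiberFst f) x) = 0 := by
  obtain ⟨⟨s, m⟩, hz, rfl⟩ := cls_surjective x
  have hz' := (fiber_d f s m).symm.trans hz
  have h1 : -(N.d s + lin f m) = 0 := congrArg Prod.fst hz'
  refine (cls_eq_zero_iff (d := N.d) (z := lin f m) _).2 ⟨-s, ?_⟩
  rw [map_neg]
  exact (eq_neg_of_add_eq_zero_right (neg_eq_zero.1 h1)).symm

/-- A morphism `g` that is bijective from the kernel of `f` on cohomology restricts to a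
quasi-isomorphism from the homotopy fibre of `f`. -/
theorem quasiIso_fiberFst_comp {f : M ⟶ N} (hf : Function.Surjective (hmap f)) (g : M ⟶ P)
    (inj : ∀ x, hmap f x = 0 → hmap g x = 0 → x = 0)
    (surj : ∀ y, ∃ x, hmap f x = 0 ∧ hmap g x = y) : quasiIso A B (fiberFst f ≫ g) := by
  rw [quasiIso_iff, hmap_comp]
  refine ⟨(injective_iff_map_eq_zero _).2 fun x hx => ?_, fun y => ?_⟩
  · exact (map_eq_zero_iff _ (hmap_fiberFst_injective hf)).1 (inj _ (hmap_hmap_fiberFst x) hx)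
  · obtain ⟨x, hx, rfl⟩ := surj y
    obtain ⟨x, rfl⟩ := exists_hmap_fiberFst hx
    exact ⟨x, rfl⟩

/-- The morphism `1 - e`. -/
def oneSub (e : M ⟶ M) : M ⟶ M where
  toLin := LinearMap.id - lin e
  map_left a m := by
    rw [LinearMap.sub_apply, LinearMap.sub_apply, LinearMap.id_apply, LinearMap.id_apply, map_sub,
      lin_left]
  map_right b m := by
    rw [LinearMap.sub_apply, LinearMap.sub_apply, LinearMap.id_apply, LinearMap.id_apply, map_sub,
      lin_right]
  map_deg hm := sub_mem hm (e.map_deg hm)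
  map_d m := by
    rw [LinearMap.sub_apply, LinearMap.sub_apply, LinearMap.id_apply, LinearMap.id_apply, map_sub,
      lin_d]

theorem lin_oneSub (e : M ⟶ M) (m : M) : lin (oneSub e) m = m - lin e m := rfl

theorem hmap_oneSub (e : M ⟶ M) (x : Cohomology M.d) : hmap (oneSub e) x = x - hmap e x := by
  obtain ⟨m, hm, rfl⟩ := cls_surjective x
  rfl

end DGBimod

/-! ### The unit of the correspondence -/

namespace IsSeparabilityFamily

variable {E ι W : Type*} [Ring E] [Algebra k E] [Fintype ι] {p q : ι → E} [AddCommGroup W]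
  [Module k W]

/-- Elements can be moved through the two copies of a separability element. -/
theorem sum_sum_comm (h : IsSeparabilityFamily k p q) (F : E →ₗ[k] E →ₗ[k] E →ₗ[k] W) (b c : E) :
    ∑ j, ∑ l, F (b * c * p j) (q j * p l) (q l) =
      ∑ j, ∑ l, F (p j) (q j * b * p l) (q l * c) := by
  have h1 : ∑ j, ∑ l, F (b * c * p j) (q j * p l) (q l) =
      ∑ j, ∑ l, F (p j) (q j * (b * c) * p l) (q l) := by
    rw [Finset.sum_comm, Finset.sum_comm (f := fun j l => F (p j) (q j * (b * c) * p l) (q l))]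
    refine Finset.sum_congr rfl fun l _ => ?_
    have := h.sum_comm ((F.flip.flip.compl₂ (LinearMap.mulRight k (p l))).compr₂
      (LinearMap.applyₗ (q l))) (b * c)
    simpa using this
  rw [h1]
  refine Finset.sum_congr rfl fun j _ => ?_
  have := h.sum_comm (F (p j) ∘ₗ LinearMap.mulLeft k (q j * b)) c
  simpa [mul_assoc] using this

end IsSeparabilityFamily

/-- A dg algebra `B` with zero differential, concentrated in degree `0`, that is the corner of a
full idempotent `φ 1` of the cohomology algebra of `A`, together with a separability element
`∑ p j ⊗ q j` of `B`. -/
structure CornerData (A B : DGAlgebra k) (ι : Type u) [Fintype ι] where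
  d_eq_zero : ∀ b : B, B.d b = 0
  mem_deg : ∀ b : B, b ∈ B.deg 0
  p : ι → B
  q : ι → B
  sep : IsSeparabilityFamily k p q
  /-- the isomorphism to the corner -/
  φ : B →ₗ[k] A.H
  φ_mul : ∀ x y, φ (x * y) = φ x * φ y
  /-- the projection to the corner -/
  ψ : A.H →ₗ[k] B
  φ_ψ : ∀ x, φ (ψ x) = φ 1 * x * φ 1
  ψ_φ : ∀ b, ψ (φ b) = b
  /-- cocycles which represent the classes in the corner -/
  lift : B →ₗ[k] A
  lift_mem : ∀ b, lift b ∈ A.deg 0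
  d_lift : ∀ b, A.d (lift b) = 0
  hcls_lift : ∀ b, A.hcls (lift b) (d_lift b) = φ b
  /-- the index set of a decomposition of `1` that shows that the corner is full -/
  σ : Type u
  [fintype : Fintype σ]
  x : σ → A.H
  y : σ → A.H
  sum_mul : ∑ s, x s * φ 1 * y s = 1

attribute [instance] CornerData.fintype

namespace CornerData

open DGBimod

variable {A B C : DGAlgebra k} {ι : Type u} [Fintype ι] (D : CornerData A B ι)

/-- The transfer from `A` to `B`. -/
def t : Transfer ι A B where
  fst j := D.lift (D.p j)
  snd := D.q
  fst_mem _ := D.lift_mem _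
  snd_mem _ := D.mem_deg _
  d_fst _ := D.d_lift _
  d_snd _ := D.d_eq_zero _

/-- The transfer from `B` to `A`. -/
def t' : Transfer ι B A where
  fst := D.p
  snd j := D.lift (D.q j)
  fst_mem _ := D.mem_deg _
  snd_mem _ := D.lift_mem _
  d_fst _ := D.d_eq_zero _
  d_snd _ := D.d_lift _

/-- The identification of `B` with its cohomology algebra. -/
def χ : B →ₗ[k] B.H where
  toFun b := B.hcls b (D.d_eq_zero b)
  map_add' _ _ := rfl
  map_smul' _ _ := rfl

theorem χ_apply (b : B) : D.χ b = B.hcls b (D.d_eq_zero b) := rfl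

theorem χ_mul (b c : B) : D.χ (b * c) = D.χ b * D.χ c := rfl

theorem χ_one : D.χ 1 = 1 := rfl

theorem χ_surjective (x : B.H) : ∃ b, D.χ b = x := by
  obtain ⟨b, _, rfl⟩ := DGAlgebra.hcls_surjective x
  exact ⟨b, rfl⟩

theorem φ_one_mul (b : B) : D.φ 1 * D.φ b = D.φ b := by rw [← D.φ_mul, one_mul]

theorem φ_mul_one (b : B) : D.φ b * D.φ 1 = D.φ b := by rw [← D.φ_mul, mul_one]

theorem φ_mul_ψ_mul (b c : B) (x : A.H) : D.φ (b * D.ψ x * c) = D.φ b * x * D.φ c := by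
  rw [D.φ_mul, D.φ_mul, D.φ_ψ, ← mul_assoc, ← mul_assoc, φ_mul_one, mul_assoc _ (D.φ 1),
    φ_one_mul]

theorem represents_t : Represents D.t D.p D.q D.φ D.χ :=
  ⟨D.φ_mul, D.χ_mul, fun _ => D.hcls_lift _, fun _ => rfl⟩

theorem represents_t' : Represents D.t' D.p D.q D.χ D.φ :=
  ⟨D.χ_mul, D.φ_mul, fun _ => rfl, fun _ => D.hcls_lift _⟩

/-- The map `y ⊗ z ⊗ w ↦ n y ⊗ z ⊗ w`, where cocycles of `A` are chosen for `z`. -/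
def unitAux (N : DGBimod C B) (n : N) : B →ₗ[k] B →ₗ[k] B →ₗ[k] (N.ind A).ind B :=
  ((it N A).compl₁₂ (N.rightMap n) D.lift).compr₂ (it (N.ind A) B)

theorem unitAux_apply (N : DGBimod C B) (n : N) (y z w : B) : D.unitAux N n y z w =
    it (N.ind A) B (it N A (N.right (.op y) n) (D.lift z)) w := rfl

/-- The morphism `n ↦ ∑ n p_j ⊗ q_j p_l ⊗ q_l`; it is `B`-linear because the separability element
is central. -/
def unit (N : DGBimod C B) : N ⟶ (N.ind A).ind B where
  toLin := ∑ j, ∑ l, (it (N.ind A) B).flip (D.q l) ∘ₗ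
    (it N A).flip (D.lift (D.q j * D.p l)) ∘ₗ N.right (.op (D.p j))
  map_left c n := by
    simp only [LinearMap.sum_apply, map_sum]
    refine Finset.sum_congr rfl fun j _ => Finset.sum_congr rfl fun l _ => ?_
    change it (N.ind A) B (it N A (N.right _ (N.left c n)) _) _ = _
    rw [← N.left_right, ← left_it, ← left_it]
    rfl
  map_right b n := by
    have key := D.sep.sum_sum_comm (D.unitAux N n) 1 b.unop
    simp only [one_mul, mul_one, unitAux_apply, right_mul] at key
    simp only [LinearMap.sum_apply, map_sum]
    exact key
  map_deg {i n} hn := by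
    simp only [LinearMap.sum_apply]
    refine sum_mem fun j _ => sum_mem fun l _ => ?_
    refine it_mem_zero (it_mem_zero ?_ (D.lift_mem _)) (D.mem_deg _)
    have := N.right_mem hn (D.mem_deg (D.p j))
    rwa [add_zero] at this
  map_d n := by
    simp only [LinearMap.sum_apply, map_sum]
    refine Finset.sum_congr rfl fun j _ => Finset.sum_congr rfl fun l _ => ?_
    change it (N.ind A) B (it N A (N.right _ (N.d n)) _) _ =
      ((N.ind A).ind B).d (it (N.ind A) B (it N A (N.right _ n) _) _)
    rw [d_it, d_it, D.d_eq_zero, D.d_lift, map_zero, map_zero, add_zero, add_zero, N.d_right_sgn,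
      D.d_eq_zero, MulOpposite.op_zero, map_zero, LinearMap.zero_apply, add_zero]

theorem unit_apply (N : DGBimod C B) (n : N) : lin (D.unit N) n =
    ∑ j, ∑ l, it (N.ind A) B
      (it N A (N.right (.op (D.p j)) n) (D.lift (D.q j * D.p l))) (D.q l) := by
  change (∑ j, ∑ l, (it (N.ind A) B).flip (D.q l) ∘ₗ
    (it N A).flip (D.lift (D.q j * D.p l)) ∘ₗ N.right (.op (D.p j))) n = _
  simp only [LinearMap.sum_apply]
  rfl

theorem unit_naturality {N N' : DGBimod C B} (f : N ⟶ N') (n : N) :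
    lin (D.unit N') (lin f n) = lin (indMap (indMap f A) B) (lin (D.unit N) n) := by
  rw [unit_apply, unit_apply, map_sum]
  refine Finset.sum_congr rfl fun j _ => ?_
  rw [map_sum]
  refine Finset.sum_congr rfl fun l _ => ?_
  rw [indMap_it, indMap_it, lin_right]

theorem hmap_unit (N : DGBimod C B) (x : Cohomology N.d) : hmap (D.unit N) x =
    ∑ j, ∑ l, icross (N.ind A) B (icross N A (hRight N (D.χ (D.p j)) x) (D.φ (D.q j * D.p l)))
      (D.χ (D.q l)) := by
  obtain ⟨n, hn, rfl⟩ := cls_surjective x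
  have h1 : ∀ j, N.d (N.right (.op (D.p j)) n) = 0 := fun j => by
    rw [N.d_right_sgn, hn, D.d_eq_zero, MulOpposite.op_zero, map_zero, map_zero,
      LinearMap.zero_apply, add_zero]
  have h2 : ∀ j l, (N.ind A).d (it N A (N.right (.op (D.p j)) n) (D.lift (D.q j * D.p l))) = 0 :=
    fun j l => by rw [d_it, h1, D.d_lift, map_zero, map_zero, LinearMap.zero_apply, add_zero]
  have h3 : ∀ j l, ((N.ind A).ind B).d (it (N.ind A) B
      (it N A (N.right (.op (D.p j)) n) (D.lift (D.q j * D.p l))) (D.q l)) = 0 := fun j l => by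
    rw [d_it, h2, D.d_eq_zero, map_zero, map_zero, LinearMap.zero_apply, add_zero]
  have h4 : ∀ j l, icross (N.ind A) B (icross N A (hRight N (D.χ (D.p j)) (cls N.d n hn))
      (D.φ (D.q j * D.p l))) (D.χ (D.q l)) = cls _ _ (h3 j l) := fun j l => by
    rw [← D.hcls_lift, χ_apply, χ_apply, hRight_cls, icross_cls N _ (h1 j), icross_cls]
  simp only [h4]
  have h5 : ∀ j, ((N.ind A).ind B).d (∑ l, it (N.ind A) B
      (it N A (N.right (.op (D.p j)) n) (D.lift (D.q j * D.p l))) (D.q l)) = 0 := fun j => by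
    rw [map_sum]; exact Finset.sum_eq_zero fun l _ => h3 j l
  rw [Finset.sum_congr rfl fun j _ => (cls_sum _ (h3 j) (h5 j)).symm, ← cls_sum _ h5 (by
    rw [map_sum]; exact Finset.sum_eq_zero fun j _ => h5 j), hmap_cls]
  exact cls_congr _ (D.unit_apply N n)

end CornerData

/-! ### The unit is an isomorphism -/

namespace DGBimod

variable {A B C : DGAlgebra k}

/-- A linear map out of the cohomology of `M ⊗_k B`, from the Künneth formula. -/
def hElim (M : DGBimod C A) (B : DGAlgebra k) {W : Type*} [AddCommGroup W] [Module k W]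
    (g : Cohomology M.d →ₗ[k] B.H →ₗ[k] W) : Cohomology (M.ind B).d →ₗ[k] W :=
  TensorProduct.lift g ∘ₗ (ikunneth M B).symm.toLinearMap

theorem hElim_icross (M : DGBimod C A) {W : Type*} [AddCommGroup W] [Module k W]
    (g : Cohomology M.d →ₗ[k] B.H →ₗ[k] W) (x : Cohomology M.d) (b : B.H) :
    hElim M B g (icross M B x b) = g x b := by
  refine (congrArg (TensorProduct.lift g) (ikunneth_symm_icross M x b)).trans ?_
  exact TensorProduct.lift.tmul _ _

end DGBimod

/-- If `e = ν μ` with `μ ν = 1`, then a surjection with the same kernel as `e` restricts to an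
isomorphism on the image of `ν`. -/
theorem bijective_of_splitting {U W V : Type*} [AddCommGroup U] [Module k U] [AddCommGroup W]
    [Module k W] [AddCommGroup V] [Module k V] {v : U →ₗ[k] W} (hv : Function.Surjective v)
    {e : U → U} (hker : ∀ u, v u = 0 ↔ e u = 0) {ν : V →ₗ[k] U} {μ : U →ₗ[k] V}
    (he : ∀ u, e u = ν (μ u)) (hμν : ∀ x, μ (ν x) = x) : Function.Bijective (v ∘ₗ ν) := by
  refine ⟨(injective_iff_map_eq_zero _).2 fun x hx => ?_, fun w => ?_⟩
  · have h1 := (hker _).1 hx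
    rw [he, hμν] at h1
    rw [← hμν x, h1, map_zero]
  · obtain ⟨u, rfl⟩ := hv w
    refine ⟨μ u, ?_⟩
    rw [LinearMap.comp_apply, ← sub_eq_zero, ← map_sub, hker, he, map_sub, hμν, sub_self, map_zero]

namespace CornerData

variable {A B C : DGAlgebra k} {ι : Type u} [Fintype ι] (D : CornerData A B ι)

/-- The left inverse `n ⊗ h ⊗ b ↦ n ψ(h) b` of the unit on cohomology. -/
def unitInv (N : DGBimod C B) : Cohomology ((N.ind A).ind B).d →ₗ[k] Cohomology N.d :=
  hElim (N.ind A) B ((hRight N).flip ∘ₗ hElim N A (hRight N ∘ₗ D.χ ∘ₗ D.ψ).flip)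

theorem unitInv_icross (N : DGBimod C B) (x : Cohomology N.d) (h : A.H) (b : B.H) :
    D.unitInv N (icross (N.ind A) B (icross N A x h) b) =
      hRight N b (hRight N (D.χ (D.ψ h)) x) := by
  rw [unitInv, hElim_icross, LinearMap.comp_apply, hElim_icross]
  rfl

theorem sum_sum_mul : ∑ j, ∑ l, D.p j * (D.q j * D.p l) * D.q l = 1 := by
  have : ∀ j, ∑ l, D.p j * (D.q j * D.p l) * D.q l = D.p j * D.q j := fun j => by
    simp only [mul_assoc, ← Finset.mul_sum, D.sep.sum_mul, mul_one]
  rw [Finset.sum_congr rfl fun j _ => this j, D.sep.sum_mul]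

theorem unitInv_unit (N : DGBimod C B) (x : Cohomology N.d) :
    D.unitInv N (hmap (D.unit N) x) = x := by
  rw [hmap_unit]
  simp only [map_sum, unitInv_icross, D.ψ_φ, ← hRight_mul, ← χ_mul]
  have := congrArg (fun b => hRight N (D.χ b) x) D.sum_sum_mul
  simp only [map_sum, LinearMap.sum_apply, χ_one, hRight_one, Module.End.one_apply,
    mul_assoc] at this ⊢
  exact this

/-- The map `y ⊗ z ⊗ w ↦ x y ⊗ φ(z) ⊗ w` on cohomology. -/
def hUnitAux (N : DGBimod C B) (x : Cohomology N.d) :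
    B →ₗ[k] B →ₗ[k] B →ₗ[k] Cohomology ((N.ind A).ind B).d :=
  ((icross N A).compl₁₂ ((hRight N ∘ₗ D.χ).flip x) D.φ).compr₂
    ((LinearMap.lcomp k _ D.χ) ∘ₗ icross (N.ind A) B)

theorem hUnitAux_apply (N : DGBimod C B) (x : Cohomology N.d) (y z w : B) :
    D.hUnitAux N x y z w =
      icross (N.ind A) B (icross N A (hRight N (D.χ y) x) (D.φ z)) (D.χ w) := rfl

/-- On cohomology, the idempotent whose image is the double transfer of `N` factors through the
unit. -/
theorem hmap_endo_endo_unit (N : DGBimod C B) (u : Cohomology ((N.ind A).ind B).d) :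
    hmap (endo D.t (N.ind A)) (hmap (indMap (endo D.t' N) B) u) =
      hmap (D.unit N) (D.unitInv N u) := by
  refine LinearMap.congr_fun (f := hmap (endo D.t (N.ind A)) ∘ₗ hmap (indMap (endo D.t' N) B))
    (g := hmap (D.unit N) ∘ₗ D.unitInv N) (icross_hom_ext fun y b => ?_) u
  refine LinearMap.congr_fun (f := (hmap (endo D.t (N.ind A)) ∘ₗ
    hmap (indMap (endo D.t' N) B)) ∘ₗ (icross (N.ind A) B).flip b)
    (g := (hmap (D.unit N) ∘ₗ D.unitInv N) ∘ₗ (icross (N.ind A) B).flip b)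
    (icross_hom_ext fun x h => ?_) y
  obtain ⟨b, rfl⟩ := D.χ_surjective b
  simp only [LinearMap.comp_apply, LinearMap.flip_apply]
  rw [unitInv_icross, hmap_unit, hmap_indMap_icross, D.represents_t'.hmap_endo_icross]
  simp only [map_sum, LinearMap.sum_apply, D.represents_t.hmap_endo_icross, hRight_icross]
  have key := D.sep.sum_sum_comm (D.hUnitAux N x) (D.ψ h) b
  simp only [hUnitAux_apply, φ_mul_ψ_mul, χ_mul, hRight_mul] at key
  exact key.symm

/-- The unit is an isomorphism in the derived category. -/
theorem quasiIso_unit (N : DGBimod C B) : quasiIso C B (D.unit N ≫ toDouble D.t' D.t N) := by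
  rw [DGBimod.quasiIso_iff, hmap_comp]
  exact bijective_of_splitting (hmap_toDouble_surjective D.represents_t' D.represents_t D.sep N)
    (hmap_toDouble_eq_zero_iff D.represents_t' D.represents_t D.sep N)
    (D.hmap_endo_endo_unit N) (D.unitInv_unit N)

/-! ### The counit of the correspondence -/

/-- The morphism `m ⊗ b ⊗ a ↦ m b a`, where cocycles of `A` are chosen for `b`. -/
def counit (M : DGBimod C A) : (M.ind B).ind A ⟶ M :=
  indDesc (ilift (M.rightMap.compl₂ D.lift))
    (fun c x => by
      induction x using ind_induction with
      | zero => simp only [map_zero]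
      | it m b =>
        rw [left_it, ilift_it, ilift_it]
        exact (M.left_right _ _ _).symm
      | add s t hs ht => simp only [map_add, hs, ht])
    (fun {i x} hx => by
      refine tensor_deg_le (M := M.forgetRight) (K := (diag B).forgetLeft) (S := (M.deg i).comap
        (ilift (M.rightMap.compl₂ D.lift))) ?_ hx
      rintro p q m b rfl hm hb
      change M.right (.op (D.lift b)) m ∈ M.deg (p + q)
      by_cases hq : q = 0
      · subst hq
        exact M.right_mem hm (D.lift_mem b)
      · have hb0 : b = 0 := by
          rw [← proj_of_mem B.isInternal (D.mem_deg b)]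
          exact proj_of_mem_ne B.isInternal hq hb
        subst hb0
        have h0 : D.lift (0 : B) = 0 := map_zero _
        have h1 : M.right (.op (D.lift (0 : B))) m = 0 := by
          rw [h0, MulOpposite.op_zero, map_zero]
          rfl
        exact h1 ▸ zero_mem _)
    (fun x => by
      induction x using ind_induction with
      | zero => simp only [map_zero]
      | it m b =>
        rw [d_it, D.d_eq_zero, map_zero, add_zero, ilift_it, ilift_it]
        change M.right (.op (D.lift b)) (M.d m) = M.d (M.right (.op (D.lift b)) m)
        rw [M.d_right_sgn, D.d_lift, MulOpposite.op_zero, map_zero, LinearMap.zero_apply, add_zero]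
      | add s t hs ht => simp only [map_add, hs, ht])

theorem counit_it (M : DGBimod C A) (m : M) (b : B) (a : A) :
    lin (D.counit M) (it (M.ind B) A (it M B m b) a) =
      M.right (.op a) (M.right (.op (D.lift b)) m) := rfl

theorem counit_naturality {M M' : DGBimod C A} (f : M ⟶ M') (x : (M.ind B).ind A) :
    lin (D.counit M') (lin (indMap (indMap f B) A) x) = lin f (lin (D.counit M) x) := by
  induction x using ind_induction with
  | zero => simp only [map_zero]
  | it y a =>
    induction y using ind_induction with
    | zero => simp only [map_zero, LinearMap.zero_apply]
    | it m b => rw [indMap_it, indMap_it, counit_it, counit_it, lin_right, lin_right]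
    | add s t hs ht => simp only [map_add, LinearMap.add_apply, hs, ht]
  | add s t hs ht => simp only [map_add, hs, ht]

theorem hmap_counit_icross (M : DGBimod C A) (x : Cohomology M.d) (b : B) (h : A.H) :
    hmap (D.counit M) (icross (M.ind B) A (icross M B x (D.χ b)) h) =
      hRight M h (hRight M (D.φ b) x) := by
  obtain ⟨m, hm, rfl⟩ := cls_surjective x
  obtain ⟨a, ha, rfl⟩ := DGAlgebra.hcls_surjective h
  rw [← D.hcls_lift, χ_apply, hRight_cls, hRight_cls, icross_cls, icross_cls, hmap_cls]
  exact cls_congr _ (D.counit_it M m b a)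

/-- The right inverse `x ↦ ∑ x x_s p_j ⊗ q_j p_l ⊗ q_l y_s` of the counit on cohomology, where
`1 = ∑ x_s φ(1) y_s`. -/
def counitInv (M : DGBimod C A) : Cohomology M.d →ₗ[k] Cohomology ((M.ind B).ind A).d :=
  ∑ s, ∑ j, ∑ l, (icross (M.ind B) A).flip (D.φ (D.q l) * D.y s) ∘ₗ
    (icross M B).flip (D.χ (D.q j * D.p l)) ∘ₗ hRight M (D.x s * D.φ (D.p j))

theorem counitInv_apply (M : DGBimod C A) (x : Cohomology M.d) : D.counitInv M x =
    ∑ s, ∑ j, ∑ l, icross (M.ind B) A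
      (icross M B (hRight M (D.x s * D.φ (D.p j)) x) (D.χ (D.q j * D.p l)))
      (D.φ (D.q l) * D.y s) := by
  simp only [counitInv, LinearMap.sum_apply]
  rfl

theorem counit_counitInv (M : DGBimod C A) (x : Cohomology M.d) :
    hmap (D.counit M) (D.counitInv M x) = x := by
  rw [counitInv_apply]
  simp only [map_sum, hmap_counit_icross, ← hRight_mul]
  have key : ∑ s, ∑ j, ∑ l,
      (D.x s * D.φ (D.p j) * D.φ (D.q j * D.p l) * (D.φ (D.q l) * D.y s)) = 1 := by
    rw [← D.sum_mul]
    refine Finset.sum_congr rfl fun s _ => ?_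
    rw [← D.sum_sum_mul, map_sum, Finset.mul_sum, Finset.sum_mul]
    refine Finset.sum_congr rfl fun j _ => ?_
    rw [map_sum, Finset.mul_sum, Finset.sum_mul]
    refine Finset.sum_congr rfl fun l _ => ?_
    simp only [D.φ_mul, mul_assoc]
  have := congrArg (fun a => hRight M a x) key
  simpa only [map_sum, LinearMap.sum_apply, hRight_one, Module.End.one_apply] using this

/-- The map `z₁ ⊗ z₂ ⊗ z₃ ↦ x φ(z₁) ⊗ z₂ ⊗ φ(z₃) y` on cohomology. -/
def hCounitAux (M : DGBimod C A) (x : Cohomology M.d) (y : A.H) :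
    B →ₗ[k] B →ₗ[k] B →ₗ[k] Cohomology ((M.ind B).ind A).d :=
  ((icross M B).compl₁₂ ((hRight M ∘ₗ D.φ).flip x) D.χ).compr₂
    ((LinearMap.lcomp k _ (LinearMap.mulRight k y ∘ₗ D.φ)) ∘ₗ icross (M.ind B) A)

theorem hCounitAux_apply (M : DGBimod C A) (x : Cohomology M.d) (y : A.H) (z₁ z₂ z₃ : B) :
    D.hCounitAux M x y z₁ z₂ z₃ =
      icross (M.ind B) A (icross M B (hRight M (D.φ z₁) x) (D.χ z₂)) (D.φ z₃ * y) := rfl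

/-- On cohomology, the idempotent whose image is the double transfer of `M` factors through the
counit. This uses that the corner is full, through the decomposition `1 = ∑ x_s φ(1) y_s`. -/
theorem hmap_endo_endo_counit (M : DGBimod C A) (u : Cohomology ((M.ind B).ind A).d) :
    hmap (endo D.t' (M.ind B)) (hmap (indMap (endo D.t M) A) u) =
      D.counitInv M (hmap (D.counit M) u) := by
  refine LinearMap.congr_fun (f := hmap (endo D.t' (M.ind B)) ∘ₗ hmap (indMap (endo D.t M) A))
    (g := D.counitInv M ∘ₗ hmap (D.counit M)) (icross_hom_ext fun y h => ?_) u
  refine LinearMap.congr_fun (f := (hmap (endo D.t' (M.ind B)) ∘ₗ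
    hmap (indMap (endo D.t M) A)) ∘ₗ (icross (M.ind B) A).flip h)
    (g := (D.counitInv M ∘ₗ hmap (D.counit M)) ∘ₗ (icross (M.ind B) A).flip h)
    (icross_hom_ext fun x b => ?_) y
  obtain ⟨b, rfl⟩ := D.χ_surjective b
  simp only [LinearMap.comp_apply, LinearMap.flip_apply]
  rw [hmap_counit_icross, counitInv_apply, hmap_indMap_icross, D.represents_t.hmap_endo_icross]
  simp only [map_sum, LinearMap.sum_apply, D.represents_t'.hmap_endo_icross, hRight_icross]
  have h1 : ∀ s j, D.φ b * (h * (D.x s * D.φ (D.p j))) =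
      D.φ (b * D.ψ (h * D.x s) * D.p j) := fun s j => by
    rw [φ_mul_ψ_mul]; simp only [mul_assoc]
  have h2 : ∀ s, ∑ j, ∑ l, icross (M.ind B) A
      (icross M B (hRight M (D.x s * D.φ (D.p j)) (hRight M h (hRight M (D.φ b) x)))
        (D.χ (D.q j * D.p l))) (D.φ (D.q l) * D.y s) =
      ∑ j, ∑ l, icross (M.ind B) A (icross M B (hRight M (D.φ (D.p j)) x)
        (D.χ (D.q j * b * D.p l))) (D.φ (D.q l) * h * (D.x s * D.φ 1 * D.y s)) := fun s => by
    have key := D.sep.sum_sum_comm (D.hCounitAux M x (D.y s)) b (D.ψ (h * D.x s))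
    simp only [hCounitAux_apply, ← h1] at key
    simp only [← hRight_mul, mul_assoc] at key ⊢
    rw [key]
    refine Finset.sum_congr rfl fun j _ => Finset.sum_congr rfl fun l _ => ?_
    have h3 := D.φ_mul_ψ_mul (D.q l) 1 (h * D.x s)
    rw [mul_one] at h3
    rw [h3]
    simp only [mul_assoc]
  refine Eq.trans ?_ (Finset.sum_congr rfl fun s _ => h2 s).symm
  conv_rhs => rw [Finset.sum_comm]
  refine Finset.sum_congr rfl fun j _ => ?_
  conv_rhs => rw [Finset.sum_comm]
  refine Finset.sum_congr rfl fun l _ => ?_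
  have h3 : ∀ z, ∑ s, icross (M.ind B) A z (D.φ (D.q l) * h * (D.x s * D.φ 1 * D.y s)) =
      icross (M.ind B) A z (D.φ (D.q l) * h) := fun z => by
    refine (map_sum (icross (M.ind B) A z) (fun s => D.φ (D.q l) * h * (D.x s * D.φ 1 * D.y s))
      Finset.univ).symm.trans ?_
    rw [← Finset.mul_sum, D.sum_mul, mul_one]
  rw [h3, χ_mul, χ_mul]

end CornerData

/-! ### The roof between the identity and the double transfer -/

namespace CornerData

variable {A B C : DGAlgebra k} {ι : Type u} [Fintype ι] (D : CornerData A B ι)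

/-- The strict endomorphism of `M ⊗ B ⊗ A` which is an idempotent on cohomology, with image `M`. -/
def idem (M : DGBimod C A) : (M.ind B).ind A ⟶ (M.ind B).ind A :=
  indMap (endo D.t M) A ≫ endo D.t' (M.ind B)

theorem hmap_idem (M : DGBimod C A) (u : Cohomology ((M.ind B).ind A).d) :
    hmap (D.idem M) u = D.counitInv M (hmap (D.counit M) u) := by
  rw [← hmap_endo_endo_counit, idem, hmap_comp, LinearMap.comp_apply]

theorem idem_naturality {M M' : DGBimod C A} (f : M ⟶ M') (x : (M.ind B).ind A) :
    lin (indMap (indMap f B) A) (lin (D.idem M) x) =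
      lin (D.idem M') (lin (indMap (indMap f B) A) x) := by
  refine (endo_indMap D.t' (indMap f B) _).trans ?_
  have key : lin (indMap (indMap f B) A) (lin (indMap (endo D.t M) A) x) =
      lin (indMap (endo D.t M') A) (lin (indMap (indMap f B) A) x) := by
    induction x using ind_induction with
    | zero => simp only [map_zero]
    | it y a => rw [indMap_it, indMap_it, indMap_it, indMap_it, endo_indMap]
    | add s t hs ht => simp only [map_add, hs, ht]
  exact congrArg (lin (endo D.t' (M'.ind B))) key

theorem hmap_oneSub_idem (M : DGBimod C A) (u : Cohomology ((M.ind B).ind A).d) :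
    hmap (oneSub (D.idem M)) (hmap (oneSub (D.idem M)) u) = hmap (oneSub (D.idem M)) u := by
  simp only [hmap_oneSub, hmap_idem, map_sub, counit_counitInv, sub_self, sub_zero]

/-- The map from `M ⊗ B ⊗ A` to the image of `1 - e` in the derived category, where `e` is the
idempotent with image `M`. -/
def complementMap (M : DGBimod C A) : (M.ind B).ind A ⟶ tele (oneSub (D.idem M)) :=
  teleOf (oneSub (D.idem M)) 0

/-- The kernel of the map to the complement is, on cohomology, the image of `M`. -/
theorem hmap_complementMap_eq_zero_iff (M : DGBimod C A) (u : Cohomology ((M.ind B).ind A).d) :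
    hmap (D.complementMap M) u = 0 ↔ u = D.counitInv M (hmap (D.counit M) u) := by
  rw [complementMap, hmap_teleOf_eq_zero_iff (D.hmap_oneSub_idem M), hmap_oneSub, hmap_idem,
    sub_eq_zero]

theorem oneSub_idem_naturality {M M' : DGBimod C A} (f : M ⟶ M') (x : (M.ind B).ind A) :
    lin (indMap (indMap f B) A) (lin (oneSub (D.idem M)) x) =
      lin (oneSub (D.idem M')) (lin (indMap (indMap f B) A) x) := by
  rw [lin_oneSub, lin_oneSub, map_sub, idem_naturality]

/-- The morphism induced on the complements. -/
def complementFunMap {M M' : DGBimod C A} (f : M ⟶ M') :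
    tele (oneSub (D.idem M)) ⟶ tele (oneSub (D.idem M')) :=
  teleMap (indMap (indMap f B) A) (D.oneSub_idem_naturality f)

theorem complementFunMap_of {M M' : DGBimod C A} (f : M ⟶ M') (n : ℕ) (x : (M.ind B).ind A) :
    lin (D.complementFunMap f) (lin (teleOf (oneSub (D.idem M)) n) x) =
      lin (teleOf (oneSub (D.idem M')) n) (lin (indMap (indMap f B) A) x) :=
  teleMap_of (indMap (indMap f B) A) (D.oneSub_idem_naturality f) n x

theorem indMap_indMap_id (M : DGBimod C A) :
    indMap (indMap (𝟙 M) B) A = 𝟙 ((M.ind B).ind A) :=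
  (congrArg (fun g => indMap g A) ((indFunctor C A B).map_id M)).trans
    ((indFunctor C B A).map_id _)

theorem indMap_indMap_comp {M M' M'' : DGBimod C A} (f : M ⟶ M') (g : M' ⟶ M'') :
    indMap (indMap (f ≫ g) B) A = indMap (indMap f B) A ≫ indMap (indMap g B) A :=
  (congrArg (fun g => indMap g A) ((indFunctor C A B).map_comp f g)).trans
    ((indFunctor C B A).map_comp _ _)

/-- The morphism induced on the homotopy fibres of the maps to the complements. -/
def roofMap {M M' : DGBimod C A} (f : M ⟶ M') :
    fiber (D.complementMap M) ⟶ fiber (D.complementMap M') :=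
  fiberMap (indMap (indMap f B) A) (D.complementFunMap f) fun x =>
    (D.complementFunMap_of f 0 x).symm

/-- The homotopy fibre of the map to the complement, a module which maps to `M` and to its double
transfer by quasi-isomorphisms. -/
def roof (C : DGAlgebra k) : DGBimod C A ⥤ DGBimod C A where
  obj M := fiber (D.complementMap M)
  map f := D.roofMap f
  map_id M := hom_ext fun x => by
    refine Prod.ext ?_ (congrArg (fun g => lin g x.2) (indMap_indMap_id M))
    obtain ⟨n, y, hy⟩ := exists_teleOf _ x.1
    change lin (D.complementFunMap (𝟙 M)) x.1 = x.1
    rw [← hy, complementFunMap_of, indMap_indMap_id]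
    rfl
  map_comp {M M' M''} f g := hom_ext fun x => by
    refine Prod.ext ?_ (congrArg (fun g => lin g x.2) (indMap_indMap_comp f g))
    obtain ⟨n, y, hy⟩ := exists_teleOf _ x.1
    change lin (D.complementFunMap (f ≫ g)) x.1 =
      lin (D.complementFunMap g) (lin (D.complementFunMap f) x.1)
    rw [← hy, complementFunMap_of, complementFunMap_of, complementFunMap_of, indMap_indMap_comp]
    rfl

/-- The natural map from the roof to the identity. -/
def roofToId (C : DGAlgebra k) : D.roof C ⟶ 𝟭 (DGBimod C A) where
  app M := fiberFst (D.complementMap M) ≫ D.counit M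
  naturality _ _ f := hom_ext fun x => D.counit_naturality f x.2

/-- The natural map from the roof to the double transfer. -/
def roofToDouble (C : DGAlgebra k) : D.roof C ⟶ transfer C D.t ⋙ transfer C D.t' where
  app M := fiberFst (D.complementMap M) ≫ toDouble D.t D.t' M
  naturality _ _ f := hom_ext fun x => toDouble_naturality D.t D.t' f x.2

theorem quasiIso_roofToId (M : DGBimod C A) : quasiIso C A ((D.roofToId C).app M) := by
  refine quasiIso_fiberFst_comp (hmap_teleOf_surjective (D.hmap_oneSub_idem M)) (D.counit M)
    (fun u h h' => ?_) fun x => ⟨D.counitInv M x, ?_, D.counit_counitInv M x⟩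
  · rw [(D.hmap_complementMap_eq_zero_iff M u).1 h, h', map_zero]
  · exact (D.hmap_complementMap_eq_zero_iff M _).2 (by rw [counit_counitInv])

theorem hmap_toDouble_eq_zero_iff_counit (M : DGBimod C A)
    (u : Cohomology ((M.ind B).ind A).d) :
    hmap (toDouble D.t D.t' M) u = 0 ↔ D.counitInv M (hmap (D.counit M) u) = 0 := by
  rw [hmap_toDouble_eq_zero_iff D.represents_t D.represents_t' D.sep, hmap_endo_endo_counit]

theorem quasiIso_roofToDouble (M : DGBimod C A) : quasiIso C A ((D.roofToDouble C).app M) := by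
  refine quasiIso_fiberFst_comp (hmap_teleOf_surjective (D.hmap_oneSub_idem M))
    (toDouble D.t D.t' M) (fun u h h' => ?_) fun y => ?_
  · rw [(D.hmap_complementMap_eq_zero_iff M u).1 h]
    exact (D.hmap_toDouble_eq_zero_iff_counit M u).1 h'
  · obtain ⟨u, rfl⟩ := hmap_toDouble_surjective D.represents_t D.represents_t' D.sep M y
    refine ⟨D.counitInv M (hmap (D.counit M) u),
      (D.hmap_complementMap_eq_zero_iff M _).2 (by rw [counit_counitInv]), ?_⟩
    rw [← sub_eq_zero, ← map_sub, hmap_toDouble_eq_zero_iff_counit, map_sub, counit_counitInv,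
      sub_self, map_zero]

/-! ### The Morita equivalence -/

/-- The unit as a natural transformation. -/
def unitNatTrans (C : DGAlgebra k) : 𝟭 (DGBimod C B) ⟶ transfer C D.t' ⋙ transfer C D.t where
  app N := D.unit N ≫ toDouble D.t' D.t N
  naturality _ N' f := hom_ext fun n =>
    (congrArg (lin (toDouble D.t' D.t N')) (D.unit_naturality f n)).trans
      (toDouble_naturality D.t' D.t f _)

/-- A natural quasi-isomorphism becomes an isomorphism in the derived category. -/
def _root_.DGDim.DGBimod.isoOfQuasiIso {X : Type*} [Category* X] {F G : X ⥤ DGBimod A B}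
    (τ : F ⟶ G) (h : ∀ x, quasiIso A B (τ.app x)) : F ⋙ Q A B ≅ G ⋙ Q A B :=
  NatIso.ofComponents (fun x => Localization.isoOfHom (Q A B) (quasiIso A B) (τ.app x) (h x))
    fun f => by
      change (Q A B).map _ ≫ (Q A B).map _ = (Q A B).map _ ≫ (Q A B).map _
      rw [← Functor.map_comp, ← Functor.map_comp, τ.naturality]

/-- The comparison of the transfer with the tensor product is natural. -/
def transferIso (C : DGAlgebra k) :
    transfer C D.t ⋙ Q C B ≅ tensorFunctor C (kernelBimod D.t) ⋙ Q C B :=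
  isoOfQuasiIso
    { app := fun M => transferToTensor D.t M
      naturality := fun _ _ f => hom_ext fun x => (transferToTensor_naturality D.t f x).symm }
    fun M => bijective_hmap (bijective_transferToTensor D.t M)

theorem inverts_t (C : DGAlgebra k) : (quasiIso C A).IsInvertedBy (transfer C D.t ⋙ Q C B) :=
  fun _ _ _ hf => Localization.inverts (Q C B) (quasiIso C B) _
    (D.represents_t.quasiIso_transferMap D.sep hf)

theorem inverts_t' (C : DGAlgebra k) : (quasiIso C B).IsInvertedBy (transfer C D.t' ⋙ Q C A) :=
  fun _ _ _ hf => Localization.inverts (Q C A) (quasiIso C A) _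
    (D.represents_t'.quasiIso_transferMap D.sep hf)

/-- If a full corner of the cohomology of a dg algebra is separable and of degree `0`, it is Morita
equivalent to the dg algebra: both transfers preserve quasi-isomorphisms, so they descend to the
derived categories, where the unit and the roof make them mutually inverse. -/
theorem moritaEquivalent (E : CornerData A B ι) : A.MoritaEquivalent B := by
  let b := DGAlgebra.base k
  let LA := Q b A
  let LB := Q b B
  let F := Localization.lift (transfer b E.t ⋙ LB) (E.inverts_t b) LA
  let G := Localization.lift (transfer b E.t' ⋙ LA) (E.inverts_t' b) LB
  let iF : LA ⋙ F ≅ transfer b E.t ⋙ LB := Localization.fac _ (E.inverts_t b) LA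
  let iG : LB ⋙ G ≅ transfer b E.t' ⋙ LA := Localization.fac _ (E.inverts_t' b) LB
  let α : (transfer b E.t ⋙ LB) ⋙ G ≅ LA :=
    Functor.associator _ _ _ ≪≫ Functor.isoWhiskerLeft (transfer b E.t) iG ≪≫
      (Functor.associator _ _ _).symm ≪≫
      (isoOfQuasiIso (E.roofToDouble b) E.quasiIso_roofToDouble).symm ≪≫
      isoOfQuasiIso (E.roofToId b) E.quasiIso_roofToId ≪≫ Functor.leftUnitor _
  let β : (transfer b E.t' ⋙ LA) ⋙ F ≅ LB :=
    Functor.associator _ _ _ ≪≫ Functor.isoWhiskerLeft (transfer b E.t') iF ≪≫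
      (Functor.associator _ _ _).symm ≪≫
      (isoOfQuasiIso (E.unitNatTrans b) E.quasiIso_unit).symm ≪≫ Functor.leftUnitor _
  have hF : F.IsEquivalence := Localization.isEquivalence LA (quasiIso b A) LB (quasiIso b B)
    (transfer b E.t ⋙ LB) F (transfer b E.t' ⋙ LA) G α β
  exact ⟨kernelBimod E.t, F, (iF ≪≫ E.transferIso b).hom,
    Functor.isLeftDerivedFunctor_of_inverts (quasiIso b A) F (iF ≪≫ E.transferIso b), hF⟩

end CornerData

/-! ### The grading of the cohomology algebra -/

theorem isInternal_of_projections {V : Type*} [AddCommGroup V] [Module k V]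
    {G : ℤ → Submodule k V} (P : ℤ → V →ₗ[k] V) (hP : ∀ i, ∀ x ∈ G i, P i x = x)
    (hP' : ∀ i j, i ≠ j → ∀ x ∈ G i, P j x = 0) (hG : ⨆ i, G i = ⊤) :
    DirectSum.IsInternal G := by
  have key : ∀ z : ⨁ i, G i, ∀ j, P j (DirectSum.coeLinearMap G z) = (z j : V) := fun z j => by
    induction z using DirectSum.induction_on with
    | zero => simp
    | of i x =>
      have : DirectSum.coeLinearMap G (DirectSum.of (fun i => G i) i x) = x :=
        DirectSum.coeLinearMap_lof G i x
      rw [this]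
      by_cases hij : i = j
      · subst hij; rw [hP i x x.2, DirectSum.of_eq_same]
      · rw [hP' i j hij x x.2, DirectSum.of_eq_of_ne _ _ _ (Ne.symm hij)]
        rfl
    | add x y hx hy => simp [hx, hy]
  refine ⟨(injective_iff_map_eq_zero (DirectSum.coeLinearMap G)).2 fun z hz => ?_, ?_⟩
  · ext j
    rw [← key, hz, map_zero]; rfl
  · change Function.Surjective (DirectSum.coeLinearMap G)
    rw [← LinearMap.range_eq_top, DirectSum.range_coeLinearMap, hG]

theorem exists_lift_of_mem_map {V W B : Type*} [AddCommGroup V] [Module k V] [AddCommGroup W]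
    [Module k W] [AddCommGroup B] [Module k B] (f : V →ₗ[k] W) (S : Submodule k V)
    (φ : B →ₗ[k] W) (hφ : ∀ b, φ b ∈ S.map f) :
    ∃ m : B →ₗ[k] V, (∀ b, m b ∈ S) ∧ ∀ b, f (m b) = φ b := by
  obtain ⟨s, hs⟩ := (f.submoduleMap S).exists_rightInverse_of_surjective
    (LinearMap.range_eq_top.2 (f.submoduleMap_surjective S))
  exact ⟨S.subtype ∘ₗ s ∘ₗ φ.codRestrict _ hφ, fun b => (s (φ.codRestrict _ hφ b)).2,
    fun b => congrArg Subtype.val (LinearMap.congr_fun hs (φ.codRestrict _ hφ b))⟩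

namespace DGAlgebra

variable (A : DGAlgebra k)

/-- The cocycles of degree `i`. -/
def homCocycles (i : ℤ) : Submodule k A.cocycles := (A.deg i).comap A.cocycles.val.toLinearMap

/-- The linear map from cocycles to cohomology classes. -/
def hmk : A.cocycles →ₗ[k] A.H := (Ideal.Quotient.mkₐ k A.coboundaries).toLinearMap

/-- The cohomology classes of degree `i`. -/
def hdeg (i : ℤ) : Submodule k A.H := (A.homCocycles i).map A.hmk

theorem hcls_mem_hdeg {i : ℤ} {a : A} (ha : A.d a = 0) (hai : a ∈ A.deg i) :
    A.hcls a ha ∈ A.hdeg i := ⟨⟨a, ha⟩, hai, rfl⟩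

theorem exists_of_mem_hdeg {i : ℤ} {x : A.H} (hx : x ∈ A.hdeg i) :
    ∃ a ha, a ∈ A.deg i ∧ A.hcls a ha = x := by
  obtain ⟨⟨a, ha⟩, hai, rfl⟩ := hx
  exact ⟨a, ha, hai, rfl⟩

/-- The map induced on cohomology by the projection to the homogeneous component of degree `i`. -/
def cohProj (i : ℤ) : Cohomology (diag A).d →ₗ[k] Cohomology (diag A).d :=
  cohMap (proj (diag A).isInternal i)
    (fun z hz => by rw [← proj_comm (diag A).isInternal (diag A).d_mem, hz, map_zero])
    (fun x => ⟨proj (diag A).isInternal (i - 1) x, by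
      rw [← proj_comm (diag A).isInternal (diag A).d_mem, sub_add_cancel]⟩)

/-- The projection to the cohomology classes of degree `i`. -/
def hproj (i : ℤ) : A.H →ₗ[k] A.H :=
  A.hEquiv.symm.toLinearMap ∘ₗ A.cohProj i ∘ₗ A.hEquiv.toLinearMap

theorem d_proj {a : A} (ha : A.d a = 0) (i : ℤ) : A.d (proj A.isInternal i a) = 0 := by
  rw [← proj_comm A.isInternal A.d_mem, ha, map_zero]

theorem hproj_hcls (i : ℤ) (a : A) (ha : A.d a = 0) :
    A.hproj i (A.hcls a ha) = A.hcls (proj A.isInternal i a) (A.d_proj ha i) := by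
  refine (LinearEquiv.symm_apply_eq _).2 ?_
  refine Eq.trans ?_ (A.hEquiv_hcls _ (A.d_proj ha i)).symm
  exact congrArg (A.cohProj i) (A.hEquiv_hcls a ha)

theorem isInternal_hdeg : DirectSum.IsInternal A.hdeg := by
  refine isInternal_of_projections A.hproj (fun i x hx => ?_) (fun i j hij x hx => ?_) ?_
  · obtain ⟨a, ha, hai, rfl⟩ := A.exists_of_mem_hdeg hx
    rw [hproj_hcls]
    congr 1
    exact proj_of_mem _ hai
  · obtain ⟨a, ha, hai, rfl⟩ := A.exists_of_mem_hdeg hx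
    rw [hproj_hcls, ← (A.hmk).map_zero]
    exact congrArg A.hmk (Subtype.ext (proj_of_mem_ne _ hij hai))
  · refine eq_top_iff.2 fun x _ => ?_
    obtain ⟨a, ha, rfl⟩ := hcls_surjective x
    have h : (⟨a, ha⟩ : A.cocycles) = ∑ i ∈ (components A.isInternal a).support,
        ⟨proj A.isInternal i a, A.d_proj ha i⟩ := Subtype.ext (by
      rw [AddSubmonoidClass.coe_finsetSum]
      exact (sum_proj A.isInternal a).symm)
    change A.hmk ⟨a, ha⟩ ∈ _
    rw [h, map_sum]
    exact sum_mem fun i _ => Submodule.mem_iSup_of_mem i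
      (A.hcls_mem_hdeg (A.d_proj ha i) (proj_mem A.isInternal i a))

theorem one_mem_hdeg : (1 : A.H) ∈ A.hdeg 0 := A.hcls_mem_hdeg A.d_one A.one_mem

theorem mul_mem_hdeg {i j : ℤ} {x y : A.H} (hx : x ∈ A.hdeg i) (hy : y ∈ A.hdeg j) :
    x * y ∈ A.hdeg (i + j) := by
  obtain ⟨a, ha, hai, rfl⟩ := A.exists_of_mem_hdeg hx
  obtain ⟨b, hb, hbj, rfl⟩ := A.exists_of_mem_hdeg hy
  exact A.hcls_mem_hdeg (A.cocycles.mul_mem ha hb) (A.mul_mem hai hbj)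

/-- A linear map to the classes of degree `0` lifts to the cocycles of degree `0`. -/
theorem exists_lift {B : Type*} [AddCommGroup B] [Module k B] (φ : B →ₗ[k] A.H)
    (hφ : ∀ b, φ b ∈ A.hdeg 0) : ∃ l : B →ₗ[k] A, (∀ b, l b ∈ A.deg 0) ∧
      ∃ hl : ∀ b, A.d (l b) = 0, ∀ b, A.hcls (l b) (hl b) = φ b := by
  obtain ⟨m, hm, hm'⟩ := exists_lift_of_mem_map A.hmk (A.homCocycles 0) φ hφ
  exact ⟨A.cocycles.val.toLinearMap ∘ₗ m, hm, fun b => (m b).2, hm'⟩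

end DGAlgebra

/-- The sums `∑ x_i e y_i` form a two-sided ideal, which contains `1` if `e` is full. -/
theorem IsFull.exists_sum_eq_one {R : Type u} [Ring R] {e : R} (he : IsFull e) :
    ∃ (n : ℕ) (x y : Fin n → R), ∑ i, x i * e * y i = 1 := by
  let P : Set R := {z | ∃ (n : ℕ) (x y : Fin n → R), ∑ i, x i * e * y i = z}
  have hl : ∀ {a z}, z ∈ P → a * z ∈ P := by
    rintro a _ ⟨n, x, y, rfl⟩
    exact ⟨n, fun i => a * x i, y, by simp only [Finset.mul_sum, mul_assoc]⟩
  refine (TwoSidedIdeal.mem_mk' P ?_ ?_ ?_ hl ?_ 1).1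
    (he _ ((TwoSidedIdeal.mem_mk' P _ _ _ _ _ e).2 ?_))
  · exact ⟨0, Fin.elim0, Fin.elim0, by simp⟩
  · rintro _ _ ⟨n, x, y, rfl⟩ ⟨m, x', y', rfl⟩
    exact ⟨n + m, Fin.append x x', Fin.append y y', by simp [Fin.sum_univ_add]⟩
  · intro z hz
    simpa using hl (a := -1) hz
  · rintro _ a ⟨n, x, y, rfl⟩
    exact ⟨n, x, fun i => y i * a, by simp only [Finset.sum_mul, mul_assoc]⟩
  · exact ⟨1, 1, 1, by simp⟩

theorem DGAlgebra.mem_deg_ofAlgebra {B : Type u} [Ring B] [Algebra k B] (b : B) :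
    b ∈ (ofAlgebra k B).deg 0 := by
  change b ∈ (if (0 : ℤ) = 0 then (⊤ : Submodule k B) else ⊥)
  rw [if_pos rfl]
  exact Submodule.mem_top

/-! ### The product of division algebras -/

/-- A compact dg algebra of diagonal dimension `0` is Morita equivalent to a product of division
algebras. -/
theorem DGAlgebra.exists_moritaEquivalent {A : DGAlgebra k} (hcompact : A.IsCompact)
    (hdim : A.diagDim = 0) :
    ∃ (s : ℕ) (D : Fin s → Type u) (_ : ∀ i, DivisionRing (D i)) (_ : ∀ i, Algebra k (D i)),
      (∀ i, Module.Finite k (D i)) ∧ A.MoritaEquivalent (ofAlgebra k (∀ i, D i)) := by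
  have : Module.Finite k (Cohomology (diag A).d) := hcompact
  have : Module.Finite k A.H := Module.Finite.equiv A.hEquiv.symm
  obtain ⟨F, G, ⟨E⟩⟩ := exists_externalRetract hdim
  have hΓ := isGradedRegular_of_regular A.isInternal_hdeg A.one_mem_hdeg A.mul_mem_hdeg E.regular
  obtain ⟨e, he⟩ := exists_isMinimalFull A.one_mem_hdeg
  have hle := he.corner_le hΓ
  obtain ⟨s, D, _, _, hfin, φ, hmul, rfl, hinj, hrange⟩ := exists_divisionRings he.idem
    fun x hx hn => he.eq_zero_of_isNilpotent hΓ hx (hle hx) hn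
  obtain ⟨S, hS⟩ := E.exists_isSeparabilityFamily φ hmul hinj hrange
  obtain ⟨l, hl, hdl, hlφ⟩ := A.exists_lift φ fun b => hle (hrange ▸ LinearMap.mem_range_self φ b)
  obtain ⟨g, hg⟩ := φ.exists_leftInverse_of_injective (LinearMap.ker_eq_bot.2 hinj)
  obtain ⟨n, x, y, hxy⟩ := he.full.exists_sum_eq_one
  have hφg : ∀ z ∈ cornerSpace k (φ 1), φ (g z) = z := fun z hz => by
    rw [← hrange] at hz
    obtain ⟨b, rfl⟩ := hz
    exact congrArg φ (LinearMap.congr_fun hg b)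
  have hgφ : ∀ b, g (φ 1 * (φ b * φ 1)) = b := fun b => by
    rw [← hmul, ← hmul, one_mul, mul_one]
    exact LinearMap.congr_fun hg b
  refine ⟨s, D, inferInstance, inferInstance, hfin, CornerData.moritaEquivalent (ι := S)
    { d_eq_zero := fun _ => rfl
      mem_deg := fun b => mem_deg_ofAlgebra b
      p := fun j => j.1.1
      q := fun j => j.1.2
      sep := hS
      φ := φ
      φ_mul := hmul
      ψ := g ∘ₗ LinearMap.mulLeft k (φ 1) ∘ₗ LinearMap.mulRight k (φ 1)
      φ_ψ := fun z => ?_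
      ψ_φ := hgφ
      lift := l
      lift_mem := hl
      d_lift := hdl
      hcls_lift := hlφ
      σ := ULift (Fin n)
      x := fun i => x i.down
      y := fun i => y i.down
      sum_mul := ?_ }⟩
  · refine (hφg (φ 1 * (z * φ 1)) ⟨?_, ?_⟩).trans (mul_assoc _ _ _).symm
    · rw [← mul_assoc, he.idem]
    · rw [mul_assoc, mul_assoc, he.idem]
  · exact (Equiv.ulift.sum_comp fun i => x i * φ 1 * y i).trans hxy

end DGDim

end

theorem mainTheorem2 {k : Type u} [Field k] (A : DGDim.DGAlgebra k)
    (hsmooth : A.IsSmooth) (hcompact : A.IsCompact) (hdim : A.diagDim = 0) :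
    ∃ (s : ℕ) (D : Fin s → Type u) (_ : ∀ i, DivisionRing (D i)) (_ : ∀ i, Algebra k (D i)),
      (∀ i, Module.Finite k (D i)) ∧
        A.MoritaEquivalent (DGDim.DGAlgebra.ofAlgebra k (∀ i, D i)) := by
  exact DGDim.DGAlgebra.exists_moritaEquivalent hcompact hdim
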